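/- **Definitions.** A loop in a simplicial complex $X$ is a subcomplex $\gamma$ that is a triangulated circle. A filling diagram for $\gamma$ is a simplicial map $f:D\to X$, where $D$ is a (finite) triangulated $2$-disc, mapping $\partial D$ isomorphically onto $\gamma$; it is minimal if $D$ has the least number of triangles among all filling diagrams for $\gamma$. Distances in $D$ are taken in its $1$-skeleton, $\deg w$ is the number of neighbours of $w$ in $D$, and a $k$-vertex of $D$ is an interior vertex with $k$ neighbours. For $s,t\ge 4$, a flag, simply connected simplicial complex $X$ is $(s,t)$-uniform if for every loop $\gamma$ in $X$ and every minimal filling diagram $(D,f)$ for $\gamma$ the following holds. If $s=t$: every interior vertex of $D$ is a $t$-vertex. If $s\ne t$: every interior vertex of $D$ is an $s$-vertex or a $t$-vertex; all neighbours of an $s$-vertex are $t$-vertices or boundary vertices; and the neighbours of a $t$-vertex form a full cycle $(v_1,\dots,v_t)$ in which the vertices with odd index are $t$-vertices or boundary vertices and those with even index are $s$-vertices or boundary vertices. **Theorem.** Let $s,t\ge 6$ be integers with $t$ even and $(s,t)\neq(6,6)$. Put $S=s-4$, $T=t-4$ and $$P=\frac{T+\sqrt{T^2+8ST}}{4}.$$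 There is a sequence of real numbers $(\kappa_n)_{n\ge 1}$, depending only on $s$ and $t$, such that the following holds for every $(s,t)$-uniform simplicial complex $X$, every loop $\gamma$ in $X$, every minimal filling diagram $(D,f)$ for $\gamma$, every $s$-vertex $v$ of $D$, and every $n\ge 1$ such that all vertices of $D$ at distance less than $n$ from $v$ are interior vertices of $D$. The average combinatorial Gaussian curvature inside the sphere $S_n$ of radius $n$ centered at $v$, $$K_{Avg}(S_n)=\frac{\sum_{w:\,d(v,w)<n}(6-\deg w)}{\#\{w:\ d(v,w)<n\}},$$ is equal to $\kappa_n$. Moreover $$\lim_{n\to\infty}\kappa_n = 2-P,$$ that is, $\lim_{n\to\infty}K_{Avg}(S_n)=2-\frac{T+\sqrt{T^2+8ST}}{4}$. -/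

import Mathlib

open Filter Topology

noncomputable section

namespace STUniform

/-! ### Simplicial complexes: one-skeleton, flagness, links, cycles and arcs -/

/-- `a` and `b` lie in a common simplex, i.e. they are equal or span an edge (for vertices). -/
def Joined {V : Type*} (K : PreAbstractSimplicialComplex V) (a b : V) : Prop :=
  ∃ σ ∈ K.faces, a ∈ σ ∧ b ∈ σ

/-- The one-skeleton as a graph. -/
def skeleton {V : Type*} (K : PreAbstractSimplicialComplex V) : SimpleGraph V where
  Adj a b := a ≠ b ∧ Joined K a b
  symm := ⟨fun _ _ h => ⟨h.1.symm, h.2.imp fun _ hσ => ⟨hσ.1, hσ.2.2, hσ.2.1⟩⟩⟩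
  loopless := ⟨fun _ h => h.1 rfl⟩

/-- Every finite nonempty set of pairwise joined vertices spans a simplex. -/
def IsFlag {V : Type*} (K : PreAbstractSimplicialComplex V) : Prop :=
  ∀ s : Finset V, s.Nonempty → (∀ a ∈ s, ∀ b ∈ s, Joined K a b) → s ∈ K.faces

/-- The link of the vertex `v`: the simplices that do not contain `v` and that span a simplex
together with `v`. -/
def link {V : Type*} (K : PreAbstractSimplicialComplex V) (v : V) :
    PreAbstractSimplicialComplex V where
  faces := {σ | σ.Nonempty ∧ v ∉ σ ∧ ∃ τ ∈ K.faces, v ∈ τ ∧ σ ⊆ τ}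
  isRelLowerSet_faces := fun {_} h => ⟨h.1, fun _ hts ht =>
    ⟨ht, fun hv => h.2.1 (hts hv), h.2.2.imp fun _ hτ => ⟨hτ.1, hτ.2.1, hts.trans hτ.2.2⟩⟩⟩

/-- The full subcomplex spanned by a set of vertices. -/
def fullSpan {V : Type*} (K : PreAbstractSimplicialComplex V) (A : Set V) :
    PreAbstractSimplicialComplex V where
  faces := {σ | σ ∈ K.faces ∧ (σ : Set V) ⊆ A}
  isRelLowerSet_faces := fun {_} h => ⟨(K.isRelLowerSet_faces h.1).1, fun _ hts ht =>
    ⟨(K.isRelLowerSet_faces h.1).2 hts ht, fun _ hx => h.2 (hts hx)⟩⟩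

/-- `c` is a cyclic enumeration exhibiting `K` as a triangulated circle with `k` vertices. -/
def IsCycleEnum {V : Type*} (K : PreAbstractSimplicialComplex V) (k : ℕ) (c : ZMod k → V) :
    Prop :=
  3 ≤ k ∧ Function.Injective c ∧
    ∀ σ : Finset V, σ ∈ K.faces ↔
      ∃ i : ZMod k, (σ : Set V) = {c i} ∨ (σ : Set V) = {c i, c (i + 1)}

/-- `K` is a triangulation of the circle. -/
def IsCycle {V : Type*} (K : PreAbstractSimplicialComplex V) : Prop :=
  ∃ (k : ℕ) (c : ZMod k → V), IsCycleEnum K k c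

/-- `K` is a triangulation of a compact interval (with `k ≥ 1` edges). -/
def IsArc {V : Type*} (K : PreAbstractSimplicialComplex V) : Prop :=
  ∃ (k : ℕ) (c : ℕ → V), 1 ≤ k ∧ Set.InjOn c (Set.Iic k) ∧
    ∀ σ : Finset V, σ ∈ K.faces ↔
      (∃ i ≤ k, (σ : Set V) = {c i}) ∨ (∃ i < k, (σ : Set V) = {c i, c (i + 1)})

/-- A loop of `X`: a subcomplex of `X` that is a triangulated circle. -/
def IsLoop {V : Type*} (X : AbstractSimplicialComplex V) (γ : PreAbstractSimplicialComplex V) :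
    Prop :=
  γ ≤ X.toPreAbstractSimplicialComplex ∧ IsCycle γ

/-! ### Simple connectedness, through edge paths -/

/-- An elementary move of edge paths (lists of vertices): `a, b, c` is replaced by `a, c` when
`a, b, c` (not necessarily distinct) lie in a common simplex. -/
inductive EdgeMove {V : Type*} (K : PreAbstractSimplicialComplex V) : List V → List V → Prop
  | mk (l₁ l₂ : List V) (a b c : V) (h : ∃ σ ∈ K.faces, a ∈ σ ∧ b ∈ σ ∧ c ∈ σ) :
      EdgeMove K (l₁ ++ a :: b :: c :: l₂) (l₁ ++ a :: c :: l₂)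

/-- `K` is connected and its edge-path group is trivial: every closed edge path
`a, l₁, …, lₘ, a` can be changed to the constant edge path `a, a` by elementary moves and their
inverses. -/
structure IsSimplyConnected {V : Type*} (K : AbstractSimplicialComplex V) : Prop where
  connected : (skeleton K.toPreAbstractSimplicialComplex).Connected
  closed_path : ∀ (a : V) (l : List V),
    (a :: (l ++ [a])).IsChain (Joined K.toPreAbstractSimplicialComplex) →
      Relation.EqvGen (EdgeMove K.toPreAbstractSimplicialComplex) (a :: (l ++ [a])) [a, a]

/-! ### Triangulated discs and filling diagrams -/

/-- A vertex of a triangulated surface is interior when its link is a circle. -/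
def IsInterior {W : Type*} (D : AbstractSimplicialComplex W) (v : W) : Prop :=
  IsCycle (link D.toPreAbstractSimplicialComplex v)

/-- A triangulated 2-disc: a finite triangulated surface (every vertex link is a circle or an arc)
which is simply connected and has non-empty boundary. -/
structure IsDisc {W : Type*} (D : AbstractSimplicialComplex W) : Prop where
  finite : Finite W
  simplyConnected : IsSimplyConnected D
  surface : ∀ v : W, IsInterior D v ∨ IsArc (link D.toPreAbstractSimplicialComplex v)
  boundary : ∃ v : W, ¬ IsInterior D v

/-- The boundary complex of a triangulated surface: the edges that lie in exactly one triangle,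
with their vertices. -/
def boundaryComplex {W : Type*} (D : AbstractSimplicialComplex W) :
    PreAbstractSimplicialComplex W where
  faces := {σ | σ.Nonempty ∧ ∃ e ∈ D.faces, e.card = 2 ∧
    (∃! τ : Finset W, τ ∈ D.faces ∧ τ.card = 3 ∧ e ⊆ τ) ∧ σ ⊆ e}
  isRelLowerSet_faces := fun {_} h => ⟨h.1, fun _ hts ht =>
    ⟨ht, h.2.imp fun _ he => ⟨he.1, he.2.1, he.2.2.1, hts.trans he.2.2.2⟩⟩⟩

/-- A simplicial map, given on vertices: the image of every simplex is a simplex. -/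
def IsSimplicialMap {W V : Type*} (D : AbstractSimplicialComplex W)
    (X : AbstractSimplicialComplex V) (f : W → V) : Prop :=
  ∀ σ ∈ D.faces, ∃ τ ∈ X.faces, (τ : Set V) = f '' (σ : Set W)

/-- `(D, f)` is a filling diagram for `γ`: `D` is a triangulated disc, `f : D → X` is simplicial,
and `f` maps the boundary of `D` isomorphically onto `γ`. -/
structure IsFilling {V W : Type*} (X : AbstractSimplicialComplex V)
    (γ : PreAbstractSimplicialComplex V) (D : AbstractSimplicialComplex W) (f : W → V) :
    Prop where
  disc : IsDisc D
  simplicial : IsSimplicialMap D X f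
  injOn : Set.InjOn f {w | {w} ∈ (boundaryComplex D).faces}
  image : ∀ τ : Finset V, τ ∈ γ.faces ↔
    ∃ σ ∈ (boundaryComplex D).faces, (τ : Set V) = f '' (σ : Set W)

/-- The area: the number of triangles. -/
def area {W : Type*} (D : AbstractSimplicialComplex W) : ℕ :=
  {τ : Finset W | τ ∈ D.faces ∧ τ.card = 3}.ncard

/-- A filling diagram of least area among all filling diagrams of `γ`. (Discs are finite, so it is
enough to consider vertex sets in the lowest universe.) -/
def IsMinimalFilling {V : Type*} (X : AbstractSimplicialComplex V)
    (γ : PreAbstractSimplicialComplex V) {W : Type} (D : AbstractSimplicialComplex W)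
    (f : W → V) : Prop :=
  IsFilling X γ D f ∧
    ∀ (W' : Type) (D' : AbstractSimplicialComplex W') (f' : W' → V),
      IsFilling X γ D' f' → area D ≤ area D'

/-! ### `(s,t)`-uniform complexes -/

/-- The number of neighbours of a vertex. -/
def degree {W : Type*} (D : AbstractSimplicialComplex W) (v : W) : ℕ :=
  ((skeleton D.toPreAbstractSimplicialComplex).neighborSet v).ncard

/-- A `k`-vertex of a disc: an interior vertex with `k` neighbours. -/
def IsKVertex {W : Type*} (D : AbstractSimplicialComplex W) (k : ℕ) (v : W) : Prop :=
  IsInterior D v ∧ degree D v = k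

/-- The conditions on a minimal filling diagram `D` in the definition of an `(s,t)`-uniform
complex for `s ≠ t`. -/
structure IsUniformDiagram {W : Type*} (D : AbstractSimplicialComplex W) (s t : ℕ) : Prop where
  /-- Every interior vertex is an `s`-vertex or a `t`-vertex. -/
  interior : ∀ v, IsInterior D v → IsKVertex D s v ∨ IsKVertex D t v
  /-- Neighbours of an `s`-vertex are `t`-vertices or boundary vertices. -/
  s_vertex : ∀ v, IsKVertex D s v →
    ∀ w, (skeleton D.toPreAbstractSimplicialComplex).Adj v w → IsKVertex D t w ∨ ¬ IsInterior D w
  /-- The neighbours of a `t`-vertex form a full cycle `(c 1, …, c t)`, with `t`-vertices or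
  boundary vertices at odd indices and `s`-vertices or boundary vertices at even indices. -/
  t_vertex : ∀ v, IsKVertex D t v →
    ∃ c : ZMod t → W,
      IsCycleEnum (fullSpan D.toPreAbstractSimplicialComplex
        ((skeleton D.toPreAbstractSimplicialComplex).neighborSet v)) t c ∧
      ∀ j : ℕ, 1 ≤ j → j ≤ t →
        (Odd j → IsKVertex D t (c j) ∨ ¬ IsInterior D (c j)) ∧
        (Even j → IsKVertex D s (c j) ∨ ¬ IsInterior D (c j))

/-- `(s,t)`-uniform complexes. For `s = t` this is `t`-uniformness: every interior vertex of every
minimal filling diagram has exactly `t` neighbours. -/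
structure IsUniform {V : Type*} (X : AbstractSimplicialComplex V) (s t : ℕ) : Prop where
  four_le_s : 4 ≤ s
  four_le_t : 4 ≤ t
  flag : IsFlag X.toPreAbstractSimplicialComplex
  simplyConnected : IsSimplyConnected X
  of_eq : s = t → ∀ γ : PreAbstractSimplicialComplex V, IsLoop X γ →
    ∀ (W : Type) (D : AbstractSimplicialComplex W) (f : W → V), IsMinimalFilling X γ D f →
      ∀ v, IsInterior D v → IsKVertex D t v
  of_ne : s ≠ t → ∀ γ : PreAbstractSimplicialComplex V, IsLoop X γ →
    ∀ (W : Type) (D : AbstractSimplicialComplex W) (f : W → V), IsMinimalFilling X γ D f →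
      IsUniformDiagram D s t

/-! ### Curvature inside spheres -/

/-- The vertices inside the sphere `S_n` centered at `v`: those at distance less than `n`. -/
def inside {W : Type*} (D : AbstractSimplicialComplex W) (v : W) (n : ℕ) : Set W :=
  {w | (skeleton D.toPreAbstractSimplicialComplex).dist v w < n}

/-- The average of the combinatorial Gaussian curvature `6 - deg w` over the vertices `w` inside
the sphere `S_n` centered at `v`. -/
def avgCurvature {W : Type*} (D : AbstractSimplicialComplex W) (v : W) (n : ℕ) : ℝ :=
  (∑ᶠ w ∈ inside D v n, (6 - (degree D w : ℝ))) / ((inside D v n).ncard : ℝ)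

end STUniform

end

/-! Only two properties of the minimal diagram are used: D is a triangulated disc, and its interior
vertices of degree s and t are arranged as in the definition of uniformity. The argument is planar
geometry, then counting, then a linear recurrence.

Geometry. For s ≠ t, every interior vertex has degree at least 6, so D is nonpositively curved. This
is used through the Gauss–Bonnet inequality `IsPolygon.gaussBonnet`: if a simple closed edge path
with N vertices bounds a set of triangles, these triangles make at most 3N - 6 corners along the
path. The fillings are mod 2 chains; they exist because a simply connected complex has no mod 2
homology in degree one. Applied to a least-area bigon between two geodesics from v
(`IsBigon.exists_corner_sum_le`), the inequality gives `isLayering_dist`: adjacent vertices on a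
common sphere have a common neighbour one level below, and two lower neighbours of a vertex are
adjacent. So a vertex of positive level below n has one or two lower neighbours and exactly two on
its own sphere, and an edge of such a sphere has exactly one common neighbour above it.

Counting. Let a_k and b_k be the numbers of s- and t-vertices at level k ≥ 1, with formal value 0 at
k = 0. Double counting edges and triangles between consecutive spheres gives
(`IsTypedLayering.card_layer_aux`) a_{k+2} = (T/2) b_{k+1} - a_k and b_{k+2} = S a_{k+1} + (T/2)
b_{k+1} - b_k. Thus the average curvature depends only on s, t and n.

Limit. Let p > 0 > q be the roots of x² = (T/2)x + ST/2, so p = P. For either root x the sequence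
f_k = S a_k + x b_k satisfies f_{k+2} = x f_{k+1} - f_k (`sphereCounts_eigen`). Since |q| < p and p
> 2, the latter failing exactly for (s,t) = (6,6) in the given range, the partial sums for p grow
exponentially and dominate those for q. Moreover (2-S) a_k + (2-T) b_k = (2-p)(a_k + b_k) -
((S-p)/S)(S a_k + q b_k), and the last term is negligible on average; the limit is 2 - p. For s = t
all degrees inside are t, and 2 - P = 6 - t. -/

namespace STUniform

/-! ### Vertex links and triangles in a triangulated surface -/

section Links

theorem mem_faces_of_subset {W : Type*} {D : AbstractSimplicialComplex W} {σ τ : Finset W}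
    (h : σ ∈ D.faces) (hτ : τ ⊆ σ) (hne : τ.Nonempty) :
    τ ∈ D.faces :=
  (D.isRelLowerSet_faces h).2 hτ hne

variable {W : Type*} [DecidableEq W] {D : AbstractSimplicialComplex W}

theorem skeleton_adj_iff {a b : W} :
    (skeleton D.toPreAbstractSimplicialComplex).Adj a b ↔ a ≠ b ∧ {a, b} ∈ D.faces := by
  refine and_congr_right fun _ => ⟨?_, fun h => ⟨_, h, by simp, by simp⟩⟩
  rintro ⟨σ, hσ, ha, hb⟩
  exact mem_faces_of_subset hσ (by simp [Finset.insert_subset_iff, ha, hb]) (by simp)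

theorem mem_link_iff {w : W} {σ : Finset W} :
    σ ∈ (link D.toPreAbstractSimplicialComplex w).faces ↔
      σ.Nonempty ∧ w ∉ σ ∧ insert w σ ∈ D.faces := by
  refine and_congr_right fun _ => and_congr_right fun _ =>
    ⟨?_, fun h => ⟨_, h, by simp, Finset.subset_insert _ _⟩⟩
  rintro ⟨τ, hτ, hw, hsub⟩
  exact mem_faces_of_subset hτ (Finset.insert_subset hw hsub) (by simp)

theorem IsCycleEnum.tri_iff {w : W} {k : ℕ} {c : ZMod k → W}
    (h : IsCycleEnum (link D.toPreAbstractSimplicialComplex w) k c) {x y : W} (hxy : x ≠ y) :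
    (w ≠ x ∧ w ≠ y ∧ {w, x, y} ∈ D.faces) ↔
      ∃ i, (x = c i ∧ y = c (i + 1)) ∨ (x = c (i + 1) ∧ y = c i) := by
  have := h.2.2 {x, y}
  rw [mem_link_iff] at this
  simp only [Finset.coe_insert, Finset.coe_singleton, Finset.mem_insert, Finset.mem_singleton,
    not_or, Finset.insert_nonempty, true_and, and_assoc] at this
  rw [← Ne.eq_def, ← Ne.eq_def] at this
  rw [this]
  refine exists_congr fun i => ?_
  rw [Set.pair_eq_pair_iff]
  constructor
  · rintro (h1 | h1)
    · have hx : x ∈ ({c i} : Set W) := h1 ▸ (by simp)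
      have hy : y ∈ ({c i} : Set W) := h1 ▸ (by simp)
      exact absurd (hx.trans hy.symm) hxy
    · exact h1
  · exact Or.inr

theorem IsCycleEnum.adj_iff {w : W} {k : ℕ} {c : ZMod k → W}
    (h : IsCycleEnum (link D.toPreAbstractSimplicialComplex w) k c) {x : W} :
    (skeleton D.toPreAbstractSimplicialComplex).Adj w x ↔ ∃ i, x = c i := by
  have := h.2.2 {x}
  rw [mem_link_iff] at this
  simp only [Finset.singleton_nonempty, Finset.mem_singleton, true_and,
    Finset.coe_singleton] at this
  rw [skeleton_adj_iff, this]
  refine exists_congr fun i => ?_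
  constructor
  · rintro (h1 | h1)
    · exact Set.singleton_injective h1
    · have : c (i + 1) ∈ ({x} : Set W) := h1 ▸ (by simp)
      have h2 : c i ∈ ({x} : Set W) := h1 ▸ (by simp)
      exact (Set.mem_singleton_iff.1 h2).symm
  · rintro rfl
    exact Or.inl rfl

theorem IsCycleEnum.degree_eq {w : W} {k : ℕ} {c : ZMod k → W}
    (h : IsCycleEnum (link D.toPreAbstractSimplicialComplex w) k c) : degree D w = k := by
  have : (skeleton D.toPreAbstractSimplicialComplex).neighborSet w = Set.range c := by
    ext x
    rw [SimpleGraph.mem_neighborSet, h.adj_iff]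
    simp [eq_comm]
  rw [degree, this, ← Set.image_univ, Set.ncard_image_of_injective _ h.2.1, Set.ncard_univ,
    Nat.card_zmod]

theorem arc_tri_iff {w : W} {k : ℕ} {c : ℕ → W}
    (h : ∀ σ : Finset W, σ ∈ (link D.toPreAbstractSimplicialComplex w).faces ↔
      (∃ i ≤ k, (σ : Set W) = {c i}) ∨ (∃ i < k, (σ : Set W) = {c i, c (i + 1)}))
    {x y : W} (hxy : x ≠ y) :
    (w ≠ x ∧ w ≠ y ∧ {w, x, y} ∈ D.faces) ↔
      ∃ i < k, (x = c i ∧ y = c (i + 1)) ∨ (x = c (i + 1) ∧ y = c i) := by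
  have := h {x, y}
  rw [mem_link_iff] at this
  simp only [Finset.coe_insert, Finset.coe_singleton, Finset.mem_insert, Finset.mem_singleton,
    not_or, Finset.insert_nonempty, true_and, and_assoc] at this
  rw [← Ne.eq_def, ← Ne.eq_def] at this
  rw [this, or_iff_right]
  · simp_rw [Set.pair_eq_pair_iff]
  · rintro ⟨i, -, h1⟩
    have hx : x ∈ ({c i} : Set W) := h1 ▸ (by simp)
    have hy : y ∈ ({c i} : Set W) := h1 ▸ (by simp)
    exact hxy (hx.trans hy.symm)

/-- A vertex of a circle or an arc has at most two neighbours in it. This is only an upper bound: y₁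
and y₂ may coincide or be dummy values, as happens when x is not in the link or is an end of the
arc. -/
theorem exists_two_apices
    (hD : ∀ v : W, IsInterior D v ∨ IsArc (link D.toPreAbstractSimplicialComplex v)) (w x : W) :
    ∃ y₁ y₂, ∀ y, y ≠ x → w ≠ x → w ≠ y → {w, x, y} ∈ D.faces → y = y₁ ∨ y = y₂ := by
  rcases hD w with ⟨k, c, h⟩ | ⟨k, c, -, hinj, h⟩
  · by_cases hx : ∃ i, x = c i
    · obtain ⟨i, rfl⟩ := hx
      refine ⟨c (i + 1), c (i - 1), fun y hyx hwx hwy hf => ?_⟩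
      obtain ⟨j, ⟨h1, h2⟩ | ⟨h1, h2⟩⟩ := (h.tri_iff hyx.symm).1 ⟨hwx, hwy, hf⟩
      · rw [h.2.1 h1]; exact Or.inl h2
      · rw [h.2.1 h1]; right; simpa using h2
    · refine ⟨x, x, fun y hyx hwx hwy hf => ?_⟩
      obtain ⟨j, ⟨h1, h2⟩ | ⟨h1, h2⟩⟩ := (h.tri_iff hyx.symm).1 ⟨hwx, hwy, hf⟩
      · exact (hx ⟨_, h1⟩).elim
      · exact (hx ⟨_, h1⟩).elim
  · by_cases hx : ∃ i ≤ k, x = c i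
    · obtain ⟨i, hi, rfl⟩ := hx
      refine ⟨c (i + 1), c (i - 1), fun y hyx hwx hwy hf => ?_⟩
      obtain ⟨j, hj, ⟨h1, h2⟩ | ⟨h1, h2⟩⟩ := (arc_tri_iff h hyx.symm).1 ⟨hwx, hwy, hf⟩
      · rw [hinj hi (le_of_lt hj : j ≤ k) h1]; exact Or.inl h2
      · rw [hinj hi (hj : j + 1 ≤ k) h1]; right; simpa using h2
    · refine ⟨x, x, fun y hyx hwx hwy hf => ?_⟩
      obtain ⟨j, hj, ⟨h1, h2⟩ | ⟨h1, h2⟩⟩ := (arc_tri_iff h hyx.symm).1 ⟨hwx, hwy, hf⟩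
      · exact (hx ⟨_, hj.le, h1⟩).elim
      · exact (hx ⟨_, hj, h1⟩).elim

theorem exists_eq_triple {w : W} {t : Finset W} (ht : t.card = 3) (hw : w ∈ t) :
    ∃ x y, w ≠ x ∧ w ≠ y ∧ x ≠ y ∧ t = {w, x, y} := by
  obtain ⟨x, y, hxy, h⟩ := Finset.card_eq_two.1 (by
    rw [Finset.card_erase_of_mem hw, ht] : (t.erase w).card = 2)
  have hx : x ∈ t.erase w := h ▸ by simp
  have hy : y ∈ t.erase w := h ▸ by simp
  refine ⟨x, y, (Finset.ne_of_mem_erase hx).symm, (Finset.ne_of_mem_erase hy).symm, hxy, ?_⟩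
  rw [← h, Finset.insert_erase hw]

theorem exists_eq_triple' {w x : W} {t : Finset W} (hwx : w ≠ x) (ht : t.card = 3)
    (h : {w, x} ⊆ t) : ∃ y, w ≠ y ∧ y ≠ x ∧ t = {w, x, y} := by
  obtain ⟨a, b, hwa, hwb, hab, rfl⟩ := exists_eq_triple ht (h (by simp : w ∈ ({w, x} : Finset W)))
  have hx := h (by simp : x ∈ ({w, x} : Finset W))
  simp only [Finset.mem_insert, Finset.mem_singleton] at hx
  rcases hx with rfl | rfl | rfl
  · exact (hwx rfl).elim
  · exact ⟨b, hwb, hab.symm, rfl⟩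
  · exact ⟨a, hwa, hab, by rw [Finset.pair_comm a x]⟩

/-- `T` consists of triangles of `D`. -/
def IsTriangles (D : AbstractSimplicialComplex W) (T : Finset (Finset W)) : Prop :=
  ∀ t ∈ T, t ∈ D.faces ∧ t.card = 3

theorem card_filter_le_two
    (hD : ∀ v : W, IsInterior D v ∨ IsArc (link D.toPreAbstractSimplicialComplex v))
    {T : Finset (Finset W)} (hT : IsTriangles D T) {e : Finset W} (he : e.card = 2) :
    (T.filter (e ⊆ ·)).card ≤ 2 := by
  obtain ⟨w, x, hwx, rfl⟩ := Finset.card_eq_two.1 he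
  obtain ⟨y₁, y₂, hy⟩ := exists_two_apices hD w x
  refine (Finset.card_le_card (t := {{w, x, y₁}, {w, x, y₂}}) ?_).trans Finset.card_le_two
  intro t ht
  rw [Finset.mem_filter] at ht
  obtain ⟨y, hwy, hyx, rfl⟩ := exists_eq_triple' hwx (hT t ht.1).2 ht.2
  rcases hy y hyx hwx hwy (hT _ ht.1).1 with rfl | rfl <;> simp

/-- If the number of triangles of `T` on the edge `wx` is even and one of them is `wxy`, there is
another one. -/
theorem exists_other_apex {T : Finset (Finset W)} (hT : IsTriangles D T) {w x y : W}
    (hwx : w ≠ x) (he : Even (T.filter ({w, x} ⊆ ·)).card) (hy : {w, x, y} ∈ T) :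
    ∃ z, w ≠ z ∧ z ≠ x ∧ z ≠ y ∧ {w, x, z} ∈ T := by
  have hmem : ({w, x, y} : Finset W) ∈ T.filter ({w, x} ⊆ ·) := by
    rw [Finset.mem_filter]
    refine ⟨hy, ?_⟩
    intro a; simp only [Finset.mem_insert, Finset.mem_singleton]; tauto
  have h1 : 1 < (T.filter ({w, x} ⊆ ·)).card := by
    have := Finset.card_pos.2 ⟨_, hmem⟩
    obtain ⟨r, hr⟩ := he
    omega
  obtain ⟨t, ht, hne⟩ := Finset.exists_mem_ne h1 {w, x, y}
  rw [Finset.mem_filter] at ht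
  obtain ⟨z, hwz, hzx, rfl⟩ := exists_eq_triple' hwx (hT t ht.1).2 ht.2
  exact ⟨z, hwz, hzx, fun h => hne (by rw [h]), ht.1⟩

/-- Evenness lets one turn around w: behind each edge at w the next triangle of T follows. An arc
has an end, where this fails; on a circle it forces T to contain every triangle at w. -/
theorem isInterior_and_degree_le
    (hD : ∀ v : W, IsInterior D v ∨ IsArc (link D.toPreAbstractSimplicialComplex v))
    {T : Finset (Finset W)} (hT : IsTriangles D T) {w : W}
    (he : ∀ x, w ≠ x → Even (T.filter ({w, x} ⊆ ·)).card) (hw : ∃ t ∈ T, w ∈ t) :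
    IsInterior D w ∧ degree D w ≤ (T.filter (w ∈ ·)).card := by
  obtain ⟨t, ht, hwt⟩ := hw
  obtain ⟨x, y, hwx, hwy, hxy, rfl⟩ := exists_eq_triple (hT t ht).2 hwt
  rcases hD w with hint | ⟨k, c, -, hinj, h⟩
  · refine ⟨hint, ?_⟩
    obtain ⟨k, c, h⟩ := hint
    rw [h.degree_eq]
    have hk := h.1
    have : NeZero k := ⟨by omega⟩
    have h10 : (1 : ZMod k) ≠ 0 := by
      have := (CharP.cast_eq_zero_iff (ZMod k) k 1).not.2
        (by intro h; have := Nat.le_of_dvd (by norm_num) h; omega)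
      simpa using this
    have h20 : (2 : ZMod k) ≠ 0 := by
      have := (CharP.cast_eq_zero_iff (ZMod k) k 2).not.2
        (by intro h; have := Nat.le_of_dvd (by norm_num) h; omega)
      simpa using this
    have hcw : ∀ i, w ≠ c i := fun i => ((h.adj_iff (x := c i)).2 ⟨i, rfl⟩).1
    -- One turn: the other triangle of T on the edge w c(i+1) has to be the next one in the link.
    have hstep : ∀ i, ({w, c i, c (i + 1)} : Finset W) ∈ T →
        ({w, c (i + 1), c (i + 1 + 1)} : Finset W) ∈ T := by
      intro i hi
      rw [Finset.pair_comm (c i)] at hi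
      obtain ⟨z, hwz, hz1, hz2, hzT⟩ := exists_other_apex hT (hcw (i + 1)) (he _ (hcw _)) hi
      obtain ⟨j, ⟨h1, h2⟩ | ⟨h1, h2⟩⟩ := (h.tri_iff hz1.symm).1 ⟨hcw _, hwz, (hT _ hzT).1⟩
      · rw [h.2.1 h1, ← h2, ← h1]; exact hzT
      · have := h.2.1 h1
        rw [add_left_inj] at this
        exact (hz2 (by rw [h2, this])).elim
    have hex : ∃ i, ({w, c i, c (i + 1)} : Finset W) ∈ T := by
      obtain ⟨i, ⟨h1, h2⟩ | ⟨h1, h2⟩⟩ := (h.tri_iff hxy).1 ⟨hwx, hwy, (hT _ ht).1⟩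
      · exact ⟨i, by rw [← h1, ← h2]; exact ht⟩
      · exact ⟨i, by rw [← h1, ← h2, Finset.pair_comm]; exact ht⟩
    obtain ⟨i₀, hi₀⟩ := hex
    have hall : ∀ n : ℕ, ({w, c (i₀ + n), c (i₀ + n + 1)} : Finset W) ∈ T := by
      intro n
      induction n with
      | zero => simpa using hi₀
      | succ n ih => push_cast; rw [← add_assoc]; exact hstep _ ih
    have hall' : ∀ i, ({w, c i, c (i + 1)} : Finset W) ∈ T := by
      intro i
      have := hall (i - i₀).val
      rwa [ZMod.natCast_zmod_val, add_sub_cancel] at this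
    -- Two link edges could only coincide with their ends exchanged, which would give 2 = 0 in `ZMod
    -- k`, impossible for k ≥ 3.
    have : Function.Injective fun i => ({w, c i, c (i + 1)} : Finset W) := by
      intro i j hij
      have h1 := congrArg (fun s => s.erase w) hij
      simp only at h1
      have hne : ∀ i, w ∉ ({c i, c (i + 1)} : Finset W) := fun i => by simp [hcw]
      rw [Finset.erase_insert (hne i), Finset.erase_insert (hne j)] at h1
      have h2 : ({c i, c (i + 1)} : Set W) = {c j, c (j + 1)} := by
        have := congrArg (fun s : Finset W => (s : Set W)) h1
        simpa using this
      rw [Set.pair_eq_pair_iff] at h2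
      rcases h2 with ⟨h2, -⟩ | ⟨h2, h3⟩
      · exact h.2.1 h2
      · have e1 := h.2.1 h2
        have e2 := h.2.1 h3
        exact (h20 (by linear_combination e2 - e1)).elim
    calc k = (Finset.univ : Finset (ZMod k)).card := by rw [Finset.card_univ, ZMod.card]
      _ = (Finset.univ.image fun i => ({w, c i, c (i + 1)} : Finset W)).card :=
        (Finset.card_image_of_injective _ this).symm
      _ ≤ _ := Finset.card_le_card (by
        intro s hs
        obtain ⟨i, -, rfl⟩ := Finset.mem_image.1 hs
        simp [hall'])
  · exfalso
    -- The edge from w to the end c 0 of the arc lies in one triangle of D only, so by evenness in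
    -- none of T; this propagates along the arc.
    have hstep : ∀ i < k, ({w, c i, c (i + 1)} : Finset W) ∉ T := by
      intro i
      induction i with
      | zero =>
        intro hi hmem
        have hne : c 0 ≠ c 1 := fun h0 => by
          have := hinj (Nat.zero_le k : 0 ∈ Set.Iic k) (hi : 1 ∈ Set.Iic k) h0
          omega
        obtain ⟨hw0, hw1, -⟩ := (arc_tri_iff h hne).2 ⟨0, hi, Or.inl ⟨rfl, rfl⟩⟩
        obtain ⟨z, hwz, hz1, hz2, hzT⟩ := exists_other_apex hT hw0 (he _ hw0) hmem
        obtain ⟨j, hj, ⟨h1, h2⟩ | ⟨h1, h2⟩⟩ := (arc_tri_iff h hz1.symm).1 ⟨hw0, hwz, (hT _ hzT).1⟩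
        · have := hinj (Nat.zero_le k : 0 ∈ Set.Iic k) (hj.le : j ∈ Set.Iic k) h1
          subst this
          exact hz2 h2
        · have := hinj (Nat.zero_le k : 0 ∈ Set.Iic k) (hj : j + 1 ∈ Set.Iic k) h1
          omega
      | succ i ih =>
        intro hi hmem
        have hne : c (i + 1) ≠ c (i + 1 + 1) := fun h0 => by
          have := hinj (hi.le : i + 1 ∈ Set.Iic k) (hi : i + 1 + 1 ∈ Set.Iic k) h0
          omega
        obtain ⟨hw0, hw1, -⟩ := (arc_tri_iff h hne).2 ⟨i + 1, hi, Or.inl ⟨rfl, rfl⟩⟩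
        obtain ⟨z, hwz, hz1, hz2, hzT⟩ := exists_other_apex hT hw0 (he _ hw0) hmem
        obtain ⟨j, hj, ⟨h1, h2⟩ | ⟨h1, h2⟩⟩ := (arc_tri_iff h hz1.symm).1 ⟨hw0, hwz, (hT _ hzT).1⟩
        · have := hinj (hi.le : i + 1 ∈ Set.Iic k) (hj.le : j ∈ Set.Iic k) h1
          subst this
          exact hz2 h2
        · have := hinj (hi.le : i + 1 ∈ Set.Iic k) (hj : j + 1 ∈ Set.Iic k) h1
          have : i = j := by omega
          subst this
          apply ih (by omega)
          rw [← h2, Finset.pair_comm]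
          exact hzT
    obtain ⟨i, hi, ⟨h1, h2⟩ | ⟨h1, h2⟩⟩ := (arc_tri_iff h hxy).1 ⟨hwx, hwy, (hT _ ht).1⟩
    · exact hstep i hi (by rw [← h1, ← h2]; exact ht)
    · exact hstep i hi (by rw [← h1, ← h2, Finset.pair_comm]; exact ht)

end Links

/-! ### Mod 2 chains: from simple connectedness to fillings of cycles -/

section Chains

theorem add_self_chain {W : Type*} (f : Finset W → ZMod 2) : f + f = 0 := by
  ext e
  exact CharTwo.add_self_eq_zero _

variable {W : Type*} [DecidableEq W] {D : AbstractSimplicialComplex W}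

/-- The boundary of a triangle, as a chain with coefficients in `ZMod 2`. -/
def triChain (t : Finset W) : Finset W → ZMod 2 := fun e => if e.card = 2 ∧ e ⊆ t then 1 else 0

/-- The boundary of a set of triangles, as a chain with coefficients in `ZMod 2`. -/
def bdry (T : Finset (Finset W)) : Finset W → ZMod 2 := ∑ t ∈ T, triChain t

/-- The chain of a single (possibly degenerate) edge. -/
def edgeChain (a b : W) : Finset W → ZMod 2 := if a = b then 0 else Pi.single {a, b} 1

theorem bdry_apply (T : Finset (Finset W)) {e : Finset W} (he : e.card = 2) :
    bdry T e = ((T.filter (e ⊆ ·)).card : ZMod 2) := by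
  simp [bdry, triChain, he, Finset.sum_apply]

theorem bdry_apply_of_ne (T : Finset (Finset W)) {e : Finset W} (he : e.card ≠ 2) :
    bdry T e = 0 := by
  simp [bdry, triChain, he, Finset.sum_apply]

theorem edgeChain_comm (a b : W) : edgeChain a b = edgeChain b a := by
  simp only [edgeChain, Finset.pair_comm a b, eq_comm]

theorem edgeChain_add_add {a b c : W} (hab : a ≠ b) (hbc : b ≠ c) (hac : a ≠ c) :
    edgeChain a b + edgeChain b c + edgeChain a c = triChain {a, b, c} := by
  have h1 : ({a, b} : Finset W) ≠ {b, c} := fun h => by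
    have : a ∈ ({b, c} : Finset W) := h ▸ (by simp)
    simp_all
  have h2 : ({a, b} : Finset W) ≠ {a, c} := fun h => by
    have : b ∈ ({a, c} : Finset W) := h ▸ (by simp)
    simp_all
  have h3 : ({b, c} : Finset W) ≠ {a, c} := fun h => by
    have : b ∈ ({a, c} : Finset W) := h ▸ (by simp)
    simp_all
  ext e
  simp only [edgeChain, hab, hbc, hac, if_false, Pi.add_apply, triChain, Pi.single_apply]
  by_cases he : e.card = 2 ∧ e ⊆ {a, b, c}
  · rw [if_pos he]
    have : e = {a, b} ∨ e = {b, c} ∨ e = {a, c} := by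
      obtain ⟨x, y, hxy, rfl⟩ := Finset.card_eq_two.1 he.1
      have hx := he.2 (by simp : x ∈ ({x, y} : Finset W))
      have hy := he.2 (by simp : y ∈ ({x, y} : Finset W))
      simp only [Finset.mem_insert, Finset.mem_singleton] at hx hy
      rcases hx with rfl | rfl | rfl <;> rcases hy with rfl | rfl | rfl <;>
        simp_all [Finset.pair_comm]
    rcases this with rfl | rfl | rfl
    · simp [h1, h2]
    · simp [h1.symm, h3]
    · simp [h2.symm, h3.symm]
  · rw [if_neg he, if_neg, if_neg, if_neg]
    · simp
    · rintro rfl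
      exact he ⟨Finset.card_pair hac, by simp [Finset.insert_subset_iff]⟩
    · rintro rfl
      exact he ⟨Finset.card_pair hbc, by simp⟩
    · rintro rfl
      exact he ⟨Finset.card_pair hab, by simp [Finset.insert_subset_iff]⟩

variable (D) in
/-- The chains that are boundaries of sets of triangles of `D`. -/
def boundaries : Submodule (ZMod 2) (Finset W → ZMod 2) :=
  Submodule.span (ZMod 2) (triChain '' {t | t ∈ D.faces ∧ t.card = 3})

theorem bdry_symmDiff (S T : Finset (Finset W)) : bdry (symmDiff S T) = bdry S + bdry T := by
  have h : ∀ A B : Finset (Finset W), Disjoint A B → bdry (A ∪ B) = bdry A + bdry B :=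
    fun A B hAB => Finset.sum_union hAB
  have hS : bdry S = bdry (S \ T) + bdry (S ∩ T) := by
    rw [← h _ _ (Finset.disjoint_sdiff_inter S T), Finset.sdiff_union_inter]
  have hT : bdry T = bdry (T \ S) + bdry (S ∩ T) := by
    rw [Finset.inter_comm, ← h _ _ (Finset.disjoint_sdiff_inter T S), Finset.sdiff_union_inter]
  rw [symmDiff_def, Finset.sup_eq_union, h _ _ disjoint_sdiff_sdiff, hS, hT,
    add_add_add_comm, add_self_chain, add_zero]

/-- The scalars are 0 and 1, so a linear combination of triangles is a set of triangles, and
addition is symmetric difference. -/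
theorem exists_bdry_eq {f : Finset W → ZMod 2} (hf : f ∈ boundaries D) :
    ∃ T, IsTriangles D T ∧ bdry T = f := by
  induction hf using Submodule.span_induction with
  | mem x hx =>
    obtain ⟨t, ht, rfl⟩ := hx
    exact ⟨{t}, fun s hs => by rw [Finset.mem_singleton.1 hs]; exact ht, by simp [bdry]⟩
  | zero => exact ⟨∅, fun s hs => by simp at hs, by simp [bdry]⟩
  | add x y _ _ hx hy =>
    obtain ⟨S, hS, rfl⟩ := hx
    obtain ⟨T, hT, rfl⟩ := hy
    refine ⟨symmDiff S T, fun t ht => ?_, bdry_symmDiff S T⟩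
    rcases Finset.mem_symmDiff.1 ht with h | h
    · exact hS t h.1
    · exact hT t h.1
  | smul r x _ hx =>
    have : r = 0 ∨ r = 1 := by revert r; decide
    rcases this with rfl | rfl
    · exact ⟨∅, fun s hs => by simp at hs, by simp [bdry]⟩
    · simpa using hx

/-- Elementary moves allow repeated vertices; in these degenerate cases the two surviving edges
cancel mod 2. -/
theorem edgeChain_mem_boundaries {a b c : W} {σ : Finset W} (hσ : σ ∈ D.faces) (ha : a ∈ σ)
    (hb : b ∈ σ) (hc : c ∈ σ) : edgeChain a b + edgeChain b c + edgeChain a c ∈ boundaries D := by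
  by_cases hab : a = b
  · subst hab
    rw [show edgeChain a a = 0 by simp [edgeChain], zero_add, add_self_chain]
    exact zero_mem _
  by_cases hbc : b = c
  · subst hbc
    rw [show edgeChain b b = 0 by simp [edgeChain], add_zero, add_self_chain]
    exact zero_mem _
  by_cases hac : a = c
  · subst hac
    rw [show edgeChain a a = 0 by simp [edgeChain], add_zero, edgeChain_comm, add_self_chain]
    exact zero_mem _
  rw [edgeChain_add_add hab hbc hac]
  refine Submodule.subset_span ⟨_, ⟨?_, ?_⟩, rfl⟩
  · exact mem_faces_of_subset hσ (by simp [Finset.insert_subset_iff, *]) (by simp)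
  · rw [Finset.card_eq_three]
    exact ⟨a, b, c, hab, hac, hbc, rfl⟩

/-- The chain of an edge path given as a list of vertices. -/
def listChain : List W → Finset W → ZMod 2
  | [] => 0
  | [_] => 0
  | a :: b :: l => edgeChain a b + listChain (b :: l)

theorem listChain_append (l₁ l₂ : List W) (a : W) :
    listChain (l₁ ++ a :: l₂) = listChain (l₁ ++ [a]) + listChain (a :: l₂) := by
  induction l₁ with
  | nil => simp [listChain]
  | cons b l ih =>
    cases l with
    | nil => simp [listChain]
    | cons c l =>
      simp only [List.cons_append, listChain] at ih ⊢
      rw [ih, add_assoc]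

theorem EdgeMove.sub_mem {l₁ l₂ : List W} (h : EdgeMove D.toPreAbstractSimplicialComplex l₁ l₂) :
    listChain l₁ - listChain l₂ ∈ boundaries D := by
  obtain ⟨l₁, l₂, a, b, c, σ, hσ, ha, hb, hc⟩ := h
  rw [listChain_append l₁ (b :: c :: l₂) a, listChain_append l₁ (c :: l₂) a]
  simp only [listChain]
  have := edgeChain_mem_boundaries hσ ha hb hc
  convert this using 1
  have h2 : -edgeChain a c = edgeChain a c := neg_eq_of_add_eq_zero_left (add_self_chain _)
  linear_combination h2

theorem eqvGen_sub_mem {l₁ l₂ : List W}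
    (h : Relation.EqvGen (EdgeMove D.toPreAbstractSimplicialComplex) l₁ l₂) :
    listChain l₁ - listChain l₂ ∈ boundaries D := by
  induction h with
  | rel _ _ h => exact h.sub_mem
  | refl => rw [sub_self]; exact zero_mem _
  | symm _ _ _ ih => rw [← neg_sub]; exact neg_mem ih
  | trans _ _ _ _ _ ih₁ ih₂ => rw [← sub_add_sub_cancel]; exact add_mem ih₁ ih₂

/-- The chain of a walk. -/
def walkChain {a b : W} (p : (skeleton D.toPreAbstractSimplicialComplex).Walk a b) :
    Finset W → ZMod 2 :=
  (p.darts.map fun d => edgeChain d.fst d.snd).sum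

theorem listChain_support {a b : W} (p : (skeleton D.toPreAbstractSimplicialComplex).Walk a b) :
    listChain p.support = walkChain p := by
  induction p with
  | nil => simp [listChain, walkChain]
  | cons h p ih =>
    cases p with
    | nil => simp [listChain, walkChain]
    | cons h' p =>
      simp only [walkChain, SimpleGraph.Walk.support_cons, SimpleGraph.Walk.darts_cons,
        List.map_cons, List.sum_cons, listChain] at ih ⊢
      rw [ih]

/-- Each elementary move changes the chain by the boundary of a possibly degenerate triangle, and
the final path a, a has chain zero. -/
theorem walkChain_mem_boundaries (hD : IsSimplyConnected D) {a : W}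
    (p : (skeleton D.toPreAbstractSimplicialComplex).Walk a a) : walkChain p ∈ boundaries D := by
  rw [← listChain_support]
  have hchain : p.support.IsChain (Joined D.toPreAbstractSimplicialComplex) :=
    p.isChain_adj_support.imp fun _ _ h => h.2
  cases p with
  | nil => simp [listChain]
  | cons h p =>
    rw [SimpleGraph.Walk.support_cons] at hchain ⊢
    have hlast : p.support = p.support.dropLast ++ [a] := by
      have := List.dropLast_append_getLast (SimpleGraph.Walk.support_ne_nil p)
      rw [SimpleGraph.Walk.getLast_support] at this
      exact this.symm
    rw [hlast] at hchain ⊢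
    have := eqvGen_sub_mem (hD.closed_path a _ hchain)
    simpa [listChain, edgeChain] using this

theorem walkChain_append {a b c : W} (p : (skeleton D.toPreAbstractSimplicialComplex).Walk a b)
    (q : (skeleton D.toPreAbstractSimplicialComplex).Walk b c) :
    walkChain (p.append q) = walkChain p + walkChain q := by
  simp [walkChain]

theorem walkChain_reverse {a b : W} (p : (skeleton D.toPreAbstractSimplicialComplex).Walk a b) :
    walkChain p.reverse = walkChain p := by
  simp only [walkChain, SimpleGraph.Walk.darts_reverse, List.map_reverse, List.sum_reverse,
    List.map_map]
  congr 2
  ext d : 1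
  exact edgeChain_comm _ _

/-- Every one-cycle of a simply connected complex is the boundary of a set of triangles. -/
theorem exists_bdry_eq_of_cycle [Fintype W] (hD : IsSimplyConnected D) {f : Finset W → ZMod 2}
    (hf : ∀ e, f e ≠ 0 → e ∈ D.faces ∧ e.card = 2)
    (hcyc : ∀ w, ∑ e ∈ Finset.univ.filter (w ∈ ·), f e = 0) :
    ∃ T, IsTriangles D T ∧ bdry T = f := by
  apply exists_bdry_eq
  obtain ⟨v⟩ := hD.connected.nonempty
  have hw : ∀ w, ∃ p : (skeleton D.toPreAbstractSimplicialComplex).Walk v w, True := fun w =>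
    ⟨(hD.connected.preconnected v w).some, trivial⟩
  choose p _ using hw
  -- Each edge is closed up through the base point v by the chosen paths to its two ends.
  have key : ∀ e, e ∈ D.faces → e.card = 2 →
      Pi.single e 1 + ∑ w ∈ e, walkChain (p w) ∈ boundaries D := by
    intro e he he2
    obtain ⟨a, b, hab, rfl⟩ := Finset.card_eq_two.1 he2
    have hadj : (skeleton D.toPreAbstractSimplicialComplex).Adj a b :=
      skeleton_adj_iff.2 ⟨hab, he⟩
    have := walkChain_mem_boundaries hD
      ((p a).append (SimpleGraph.Walk.cons hadj (p b).reverse))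
    rw [walkChain_append, ← SimpleGraph.Walk.cons_nil_append, walkChain_append,
      walkChain_reverse] at this
    rw [Finset.sum_pair hab]
    convert this using 1
    have : walkChain (SimpleGraph.Walk.cons hadj SimpleGraph.Walk.nil)
        = Pi.single {a, b} 1 := by
      simp [walkChain, edgeChain]
    rw [this]; abel
  have hsum : f = ∑ e, f e • (Pi.single e 1 + ∑ w ∈ e, walkChain (p w)) := by
    simp_rw [smul_add, Finset.sum_add_distrib]
    have h1 : ∑ e, f e • (Pi.single e 1 : Finset W → ZMod 2) = f := by
      ext e
      simp [Finset.sum_apply, Pi.single_apply]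
    -- The total coefficient of the path to w is the sum of f over the edges at w, which vanishes
    -- because f is a cycle.
    have h2 : ∑ e, f e • ∑ w ∈ e, walkChain (p w) = 0 := by
      simp_rw [Finset.smul_sum]
      have : ∀ e : Finset W, ∑ w ∈ e, f e • walkChain (p w) =
          ∑ w, if w ∈ e then f e • walkChain (p w) else 0 := fun e => by simp
      simp_rw [this]
      rw [Finset.sum_comm]
      refine Finset.sum_eq_zero fun w _ => ?_
      rw [← Finset.sum_filter, ← Finset.sum_smul, hcyc w, zero_smul]
    rw [h1, h2, add_zero]
  rw [hsum]
  refine Submodule.sum_mem _ fun e _ => ?_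
  by_cases he : f e = 0
  · rw [he, zero_smul]; exact zero_mem _
  · exact Submodule.smul_mem _ _ (key e (hf e he).1 (hf e he).2)

/-- Each vertex of a triangle lies on exactly two of its edges. -/
theorem sum_triChain [Fintype W] (w : W) {t : Finset W} (ht : t.card = 3) :
    ∑ e ∈ Finset.univ.filter (w ∈ ·), triChain t e = 0 := by
  obtain ⟨a, b, c, hab, hac, hbc, rfl⟩ := Finset.card_eq_three.1 ht
  rw [← edgeChain_add_add hab hbc hac]
  simp only [Pi.add_apply, Finset.sum_add_distrib, edgeChain, hab, hbc, hac, if_false,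
    Pi.single_apply, Finset.sum_ite_eq', Finset.mem_filter, Finset.mem_univ, true_and,
    Finset.mem_insert, Finset.mem_singleton]
  have h2 : (1 : ZMod 2) + 1 = 0 := by decide
  by_cases h1 : w = a
  · subst h1; simp [hab, hac, h2]
  by_cases h3 : w = b
  · subst h3; simp [h1, hbc, h2]
  by_cases h4 : w = c
  · subst h4; simp [h1, h3, h2]
  simp [h1, h3, h4]

theorem sum_bdry [Fintype W] (w : W) {T : Finset (Finset W)} (hT : IsTriangles D T) :
    ∑ e ∈ Finset.univ.filter (w ∈ ·), bdry T e = 0 := by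
  simp only [bdry, Finset.sum_apply]
  rw [Finset.sum_comm]
  exact Finset.sum_eq_zero fun t ht => sum_triChain w (hT t ht).2

end Chains

/-! ### Polygons, the Euler inequality and combinatorial Gauss–Bonnet -/

section GaussBonnet

theorem sum_card_filter_comm {α β : Type*} (s : Finset α) (t : Finset β) (r : α → β → Prop)
    [∀ a b, Decidable (r a b)] :
    ∑ a ∈ s, (t.filter (fun b => r a b)).card = ∑ b ∈ t, (s.filter (fun a => r a b)).card := by
  simp only [Finset.card_filter]
  exact Finset.sum_comm

/-- Rank–nullity for A → B → C: the kernel of g has dimension at most dim A, and its image, killed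
by φ, is a proper subspace of C. With triangles, edges and vertices this becomes F - E + V ≥ 1. -/
theorem finrank_add_one_le {k A B C : Type*} [Field k] [AddCommGroup A] [Module k A]
    [AddCommGroup B] [Module k B] [AddCommGroup C] [Module k C] [FiniteDimensional k A]
    [FiniteDimensional k B] [FiniteDimensional k C] (f : A →ₗ[k] B) (g : B →ₗ[k] C)
    (h : LinearMap.ker g ≤ LinearMap.range f) (φ : C →ₗ[k] k) (hφ : φ ≠ 0) (hφg : φ ∘ₗ g = 0) :
    Module.finrank k B + 1 ≤ Module.finrank k A + Module.finrank k C := by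
  have h1 := g.finrank_range_add_finrank_ker
  have h2 := Submodule.finrank_mono h
  have h3 := f.finrank_range_le
  have h4 : LinearMap.range g < ⊤ := by
    rw [lt_top_iff_ne_top]
    intro htop
    apply hφ
    ext x
    obtain ⟨y, rfl⟩ := LinearMap.range_eq_top.1 htop x
    exact LinearMap.congr_fun hφg y
  have h5 := Submodule.finrank_lt h4.ne
  omega

/-- `c 0, …, c N` is a simple closed edge path. -/
structure IsPolygon {W : Type*} (D : AbstractSimplicialComplex W) (N : ℕ) (c : ℕ → W) : Prop where
  three_le : 3 ≤ N
  closed : c N = c 0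
  inj : Set.InjOn c (Set.Iio N)
  adj : ∀ i < N, (skeleton D.toPreAbstractSimplicialComplex).Adj (c i) (c (i + 1))

theorem IsPolygon.index_eq {W : Type*} {D : AbstractSimplicialComplex W} {N : ℕ} {c : ℕ → W}
    (h : IsPolygon D N c) {i j : ℕ} (hi : i ≤ N) (hj : j ≤ N) (hij : c i = c j) :
    i = j ∨ (i = 0 ∧ j = N) ∨ (i = N ∧ j = 0) := by
  have h3 := h.three_le
  have key : ∀ i j, i < N → j < N → c i = c j → i = j := fun i j hi hj => h.inj hi hj
  rcases hi.lt_or_eq with hi | rfl <;> rcases hj.lt_or_eq with hj | rfl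
  · exact Or.inl (key _ _ hi hj hij)
  · rw [h.closed] at hij
    have := key _ _ hi (by omega) hij
    omega
  · rw [h.closed] at hij
    have := key _ _ (by omega) hj hij
    omega
  · exact Or.inl rfl

variable {W : Type*} [DecidableEq W] {D : AbstractSimplicialComplex W}

/-- The chain of the edge path `c 0, …, c N`. -/
def pathChain (c : ℕ → W) (N : ℕ) : Finset W → ZMod 2 :=
  ∑ i ∈ Finset.range N, edgeChain (c i) (c (i + 1))

theorem sum_edgeChain [Fintype W] (w : W) {a b : W} (hab : a ≠ b) :
    ∑ e ∈ Finset.univ.filter (w ∈ ·), edgeChain a b e =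
      (if w = a then 1 else 0) + (if w = b then 1 else 0) := by
  simp only [edgeChain, hab, if_false, Pi.single_apply, Finset.sum_ite_eq', Finset.mem_filter,
    Finset.mem_univ, true_and, Finset.mem_insert, Finset.mem_singleton]
  by_cases h : w = a
  · subst h; simp [hab]
  · simp [h]

theorem sum_pathChain [Fintype W] (w : W) {c : ℕ → W} {N : ℕ}
    (hadj : ∀ i < N, (skeleton D.toPreAbstractSimplicialComplex).Adj (c i) (c (i + 1))) :
    ∑ e ∈ Finset.univ.filter (w ∈ ·), pathChain c N e =
      (if w = c 0 then 1 else 0) + (if w = c N then 1 else 0) := by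
  induction N with
  | zero => simp [pathChain, CharTwo.add_self_eq_zero]
  | succ N ih =>
    have : pathChain c (N + 1) = pathChain c N + edgeChain (c N) (c (N + 1)) :=
      Finset.sum_range_succ _ _
    rw [this]
    simp only [Pi.add_apply, Finset.sum_add_distrib]
    rw [ih fun i hi => hadj i (hi.trans N.lt_succ_self), sum_edgeChain _ (hadj N N.lt_succ_self).1]
    have := CharTwo.add_self_eq_zero (if w = c N then (1 : ZMod 2) else 0)
    linear_combination this

theorem exists_filling_of_closed [Fintype W] (hD : IsSimplyConnected D) {c : ℕ → W} {N : ℕ}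
    (hc : c N = c 0)
    (hadj : ∀ i < N, (skeleton D.toPreAbstractSimplicialComplex).Adj (c i) (c (i + 1))) :
    ∃ T, IsTriangles D T ∧ bdry T = pathChain c N := by
  refine exists_bdry_eq_of_cycle hD (fun e he => ?_) fun w => ?_
  · rw [pathChain, Finset.sum_apply] at he
    obtain ⟨i, hi, hne⟩ := Finset.exists_ne_zero_of_sum_ne_zero he
    have hi' := skeleton_adj_iff.1 (hadj i (Finset.mem_range.1 hi))
    simp only [edgeChain, hi'.1, if_false] at hne
    have : e = {c i, c (i + 1)} := by
      by_contra h
      exact hne (Pi.single_eq_of_ne h _)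
    rw [this]
    exact ⟨hi'.2, Finset.card_pair hi'.1⟩
  · rw [sum_pathChain w hadj, hc]
    exact CharTwo.add_self_eq_zero _

namespace IsPolygon

variable {N : ℕ} {c : ℕ → W}

/-- With at least three vertices, an edge cannot be traversed again in the opposite direction. -/
theorem edge_injOn (h : IsPolygon D N c) {i j : ℕ} (hi : i < N) (hj : j < N)
    (hij : ({c i, c (i + 1)} : Finset W) = {c j, c (j + 1)}) : i = j := by
  have h3 := h.three_le
  have h2 : ({c i, c (i + 1)} : Set W) = {c j, c (j + 1)} := by
    have := congrArg (fun s : Finset W => (s : Set W)) hij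
    simpa using this
  rw [Set.pair_eq_pair_iff] at h2
  rcases h2 with ⟨h2, -⟩ | ⟨h2, h4⟩
  · have := h.index_eq hi.le hj.le h2
    omega
  · have := h.index_eq hi.le hj h2
    have := h.index_eq hi hj.le h4
    omega

/-- The set of edges of a polygon. -/
def edges (N : ℕ) (c : ℕ → W) : Finset (Finset W) :=
  (Finset.range N).image fun i => {c i, c (i + 1)}

theorem card_edges (h : IsPolygon D N c) : (edges N c).card = N := by
  rw [edges, Finset.card_image_of_injOn, Finset.card_range]
  intro i hi j hj hij
  exact h.edge_injOn (by simpa using hi) (by simpa using hj) hij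

theorem pathChain_apply (h : IsPolygon D N c) (e : Finset W) :
    pathChain c N e = if e ∈ edges N c then 1 else 0 := by
  have : ∀ i ∈ Finset.range N, edgeChain (c i) (c (i + 1)) e =
      if e = {c i, c (i + 1)} then 1 else 0 := fun i hi => by
    rw [edgeChain, if_neg (h.adj i (Finset.mem_range.1 hi)).1, Pi.single_apply]
  rw [pathChain, Finset.sum_apply, Finset.sum_congr rfl this]
  split_ifs with he
  · obtain ⟨i, hi, rfl⟩ := Finset.mem_image.1 he
    rw [Finset.sum_eq_single i]
    · simp
    · intro j hj hne
      rw [if_neg]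
      exact fun heq => hne (h.edge_injOn (Finset.mem_range.1 hi) (Finset.mem_range.1 hj) heq).symm
    · intro h; exact (h hi).elim
  · refine Finset.sum_eq_zero fun i hi => if_neg ?_
    rintro rfl
    exact he (Finset.mem_image_of_mem _ hi)

theorem mem_edges_iff (h : IsPolygon D N c) {i : ℕ} (h0 : 0 < i) (hi : i < N) {e : Finset W} :
    e ∈ edges N c ∧ c i ∈ e ↔ e = {c (i - 1), c i} ∨ e = {c i, c (i + 1)} := by
  constructor
  · rintro ⟨he, hmem⟩
    obtain ⟨j, hj, rfl⟩ := Finset.mem_image.1 he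
    rw [Finset.mem_range] at hj
    simp only [Finset.mem_insert, Finset.mem_singleton] at hmem
    rcases hmem with hmem | hmem
    · have := h.index_eq hi.le hj.le hmem
      obtain rfl : i = j := by omega
      exact Or.inr rfl
    · have := h.index_eq hi.le hj hmem
      obtain rfl : i = j + 1 := by omega
      exact Or.inl rfl
  · rintro (rfl | rfl)
    · refine ⟨Finset.mem_image.2 ⟨i - 1, Finset.mem_range.2 (by omega), ?_⟩, by simp⟩
      rw [Nat.sub_add_cancel h0]
    · exact ⟨Finset.mem_image.2 ⟨i, Finset.mem_range.2 hi, rfl⟩, by simp⟩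

/-- A cycle contained in a polygon is trivial or the whole polygon. -/
theorem eq_zero_or_eq [Fintype W] (h : IsPolygon D N c) {f : Finset W → ZMod 2}
    (hf : ∀ e, f e ≠ 0 → e ∈ edges N c)
    (hcyc : ∀ w, ∑ e ∈ Finset.univ.filter (w ∈ ·), f e = 0) : f = 0 ∨ f = pathChain c N := by
  -- At an inner vertex of the path only two polygon edges meet, so the cycle condition equates
  -- their coefficients.
  have hstep : ∀ i, i + 1 < N → f {c (i + 1), c (i + 1 + 1)} = f {c i, c (i + 1)} := by
    intro i hi
    have h1 := hcyc (c (i + 1))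
    have hne : ({c i, c (i + 1)} : Finset W) ≠ {c (i + 1), c (i + 1 + 1)} := fun heq => by
      have := h.edge_injOn (by omega) hi heq
      omega
    rw [← Finset.sum_subset (s₁ := {{c i, c (i + 1)}, {c (i + 1), c (i + 1 + 1)}}),
      Finset.sum_pair hne] at h1
    · exact (CharTwo.add_eq_zero.1 h1).symm
    · intro e he
      simp only [Finset.mem_insert, Finset.mem_singleton] at he
      rcases he with rfl | rfl <;> simp
    · intro e he1 he2
      by_contra hfe
      have := (h.mem_edges_iff i.succ_pos hi).1 ⟨hf e hfe, (Finset.mem_filter.1 he1).2⟩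
      simp only [Nat.succ_eq_add_one, Nat.add_sub_cancel] at this
      exact he2 (by simpa using this)
  have hall : ∀ i, i < N → f {c i, c (i + 1)} = f {c 0, c 1} := by
    intro i
    induction i with
    | zero => simp
    | succ i ih => exact fun hi => (hstep i hi).trans (ih (by omega))
  have h01 : f {c 0, c 1} = 0 ∨ f {c 0, c 1} = 1 := by
    generalize f {c 0, c 1} = r
    revert r
    decide
  refine h01.imp (fun h0 => ?_) fun h1 => ?_
  · ext e
    by_contra hne
    obtain ⟨i, hi, rfl⟩ := Finset.mem_image.1 (hf e hne)
    exact hne ((hall i (Finset.mem_range.1 hi)).trans h0)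
  · ext e
    rw [h.pathChain_apply]
    split_ifs with he
    · obtain ⟨i, hi, rfl⟩ := Finset.mem_image.1 he
      exact (hall i (Finset.mem_range.1 hi)).trans h1
    · by_contra hne
      exact he (hf e hne)

end IsPolygon

/-- The edges of the triangles of `T`. -/
def edgesOf (T : Finset (Finset W)) : Finset (Finset W) := T.biUnion (Finset.powersetCard 2)

/-- The vertices of the triangles of `T`. -/
def verticesOf (T : Finset (Finset W)) : Finset W := T.biUnion id

theorem mem_edgesOf {T : Finset (Finset W)} {e : Finset W} :
    e ∈ edgesOf T ↔ e.card = 2 ∧ ∃ t ∈ T, e ⊆ t := by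
  simp only [edgesOf, Finset.mem_biUnion, Finset.mem_powersetCard]
  constructor
  · rintro ⟨t, ht, h1, h2⟩; exact ⟨h2, t, ht, h1⟩
  · rintro ⟨h2, t, ht, h1⟩; exact ⟨t, ht, h1, h2⟩

theorem mem_verticesOf {T : Finset (Finset W)} {w : W} :
    w ∈ verticesOf T ↔ ∃ t ∈ T, w ∈ t := by
  simp [verticesOf]

/-- The region T has no first homology of its own. Fill f by a set T₁ of triangles of D; the
boundary of T₁ \ T is then supported on the polygon, hence is zero or the whole polygon.
Correspondingly T₁ ∩ T or T \ T₁ fills f inside T. -/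
theorem exists_subset_bdry_eq [Fintype W] (hD : IsDisc D) {N : ℕ} {c : ℕ → W}
    (hc : IsPolygon D N c) {T : Finset (Finset W)} (hT : IsTriangles D T)
    (hbd : bdry T = pathChain c N) {f : Finset W → ZMod 2}
    (hf : ∀ e, f e ≠ 0 → e ∈ edgesOf T)
    (hcyc : ∀ w, ∑ e ∈ Finset.univ.filter (w ∈ ·), f e = 0) :
    ∃ T' ⊆ T, bdry T' = f := by
  obtain ⟨T₁, hT₁, rfl⟩ := exists_bdry_eq_of_cycle hD.simplyConnected (fun e he => by
    obtain ⟨h2, t, ht, hsub⟩ := mem_edgesOf.1 (hf e he)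
    exact ⟨mem_faces_of_subset (hT t ht).1 hsub (Finset.card_pos.1 (by omega)), h2⟩) hcyc
  have hsplit : ∀ A B : Finset (Finset W), bdry A = bdry (A \ B) + bdry (A ∩ B) := fun A B => by
    rw [bdry, bdry, bdry, ← Finset.sum_union (Finset.disjoint_sdiff_inter A B),
      Finset.sdiff_union_inter]
  have hT₂ : IsTriangles D (T₁ \ T) := fun t ht => hT₁ t (Finset.mem_sdiff.1 ht).1
  -- Off the polygon T has an even number of triangles at e. If T₁ \ T has an odd number there, the
  -- bound of two triangles per edge leaves none for T. Then e is not an edge of T, so f vanishes at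
  -- e and T₁ has an even number there, a contradiction.
  have hsupp : ∀ e, bdry (T₁ \ T) e ≠ 0 → e ∈ IsPolygon.edges N c := by
    intro e he
    have he2 : e.card = 2 := by
      by_contra h
      exact he (bdry_apply_of_ne _ h)
    by_contra hZ
    have h0 : bdry T e = 0 := by rw [hbd, hc.pathChain_apply, if_neg hZ]
    rw [bdry_apply _ he2, CharP.cast_eq_zero_iff _ 2] at h0
    rw [bdry_apply _ he2, Ne, CharP.cast_eq_zero_iff _ 2] at he
    have hdisj : Disjoint (T.filter (e ⊆ ·)) ((T₁ \ T).filter (e ⊆ ·)) :=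
      Finset.disjoint_filter_filter Finset.disjoint_sdiff
    have hU : IsTriangles D (T ∪ (T₁ \ T)) := fun t ht =>
      (Finset.mem_union.1 ht).elim (hT t) (hT₂ t)
    have hle := card_filter_le_two hD.surface hU he2
    rw [Finset.filter_union, Finset.card_union_of_disjoint hdisj] at hle
    have hT0 : (T.filter (e ⊆ ·)).card = 0 := by
      by_contra hne
      omega
    have hemp := Finset.card_eq_zero.1 hT0
    have hnot : e ∉ edgesOf T := fun hmem => by
      obtain ⟨-, t, ht, hsub⟩ := mem_edgesOf.1 hmem
      have : t ∈ T.filter (e ⊆ ·) := Finset.mem_filter.2 ⟨ht, hsub⟩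
      rw [hemp] at this
      simp at this
    have hf0 : bdry T₁ e = 0 := by
      by_contra h
      exact hnot (hf e h)
    rw [bdry_apply _ he2, CharP.cast_eq_zero_iff _ 2] at hf0
    have heq : (T₁ \ T).filter (e ⊆ ·) = T₁.filter (e ⊆ ·) := by
      ext t
      simp only [Finset.mem_filter, Finset.mem_sdiff]
      constructor
      · rintro ⟨⟨h1, -⟩, h2⟩; exact ⟨h1, h2⟩
      · rintro ⟨h1, h2⟩
        exact ⟨⟨h1, fun h => hnot (mem_edgesOf.2 ⟨he2, t, h, h2⟩)⟩, h2⟩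
    rw [heq] at he
    exact he hf0
  rcases hc.eq_zero_or_eq hsupp fun w => sum_bdry w hT₂ with h | h
  · refine ⟨T₁ ∩ T, Finset.inter_subset_right, ?_⟩
    rw [hsplit T₁ T, h, zero_add]
  · refine ⟨T \ T₁, Finset.sdiff_subset, ?_⟩
    have h1 := hsplit T₁ T
    have h2 := hsplit T T₁
    rw [hbd, ← h, Finset.inter_comm] at h2
    have h3 := add_self_chain (bdry (T₁ ∩ T))
    linear_combination -h2 - h1 - h3

/-- The rank count applied to the incidence matrices of T: exactness at the edges is
`exists_subset_bdry_eq`, and the functional on vertices is the sum of coefficients, which kills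
boundaries since an edge has two ends. -/
theorem card_edgesOf_add_one_le [Fintype W] (hD : IsDisc D) {N : ℕ} {c : ℕ → W}
    (hc : IsPolygon D N c) {T : Finset (Finset W)} (hT : IsTriangles D T) (hne : T.Nonempty)
    (hbd : bdry T = pathChain c N) :
    (edgesOf T).card + 1 ≤ T.card + (verticesOf T).card := by
  let M₂ : Matrix (edgesOf T) T (ZMod 2) := Matrix.of fun e t => if e.1 ⊆ t.1 then 1 else 0
  let M₁ : Matrix (verticesOf T) (edgesOf T) (ZMod 2) :=
    Matrix.of fun w e => if w.1 ∈ e.1 then 1 else 0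
  let φ : (verticesOf T → ZMod 2) →ₗ[ZMod 2] ZMod 2 := ∑ w, LinearMap.proj w
  have key := finrank_add_one_le M₂.mulVecLin M₁.mulVecLin ?_ φ ?_ ?_
  · simpa using key
  · intro h hh
    rw [LinearMap.mem_ker] at hh
    let f : Finset W → ZMod 2 := fun e => if he : e ∈ edgesOf T then h ⟨e, he⟩ else 0
    have hfcoe : ∀ e : edgesOf T, f e.1 = h e := fun e => by simp [f, e.2]
    have hfsupp : ∀ e, f e ≠ 0 → e ∈ edgesOf T := by
      intro e he
      by_contra hn
      exact he (by simp [f, hn])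
    obtain ⟨T', hT', hbd'⟩ := exists_subset_bdry_eq hD hc hT hbd (f := f) hfsupp (by
      intro w
      by_cases hw : w ∈ verticesOf T
      · have h1 := congrFun hh ⟨w, hw⟩
        simp only [Matrix.mulVecLin_apply, Matrix.mulVec, dotProduct, M₁, Matrix.of_apply,
          Pi.zero_apply, ite_mul, one_mul, zero_mul] at h1
        simp_rw [← hfcoe] at h1
        rw [Finset.sum_coe_sort (edgesOf T) (fun e => if w ∈ e then f e else 0),
          ← Finset.sum_filter] at h1
        rw [← h1]
        symm
        refine Finset.sum_subset (Finset.filter_subset_filter _ (Finset.subset_univ _)) ?_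
        intro e he1 he2
        by_contra hn
        exact he2 (Finset.mem_filter.2 ⟨hfsupp e hn, (Finset.mem_filter.1 he1).2⟩)
      · refine Finset.sum_eq_zero fun e he => ?_
        by_contra hn
        obtain ⟨-, t, ht, hsub⟩ := mem_edgesOf.1 (hfsupp e hn)
        exact hw (mem_verticesOf.2 ⟨t, ht, hsub (Finset.mem_filter.1 he).2⟩))
    refine ⟨fun t => if t.1 ∈ T' then 1 else 0, ?_⟩
    ext e
    have he2 := (mem_edgesOf.1 e.2).1
    rw [← hfcoe, ← hbd', bdry_apply _ he2]
    simp only [Matrix.mulVecLin_apply, Matrix.mulVec, dotProduct, M₂, Matrix.of_apply,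
      ite_mul, one_mul, zero_mul]
    rw [Finset.sum_coe_sort T (fun t => if e.1 ⊆ t then (if t ∈ T' then (1 : ZMod 2) else 0) else 0),
      Finset.card_filter, Nat.cast_sum, ← Finset.sum_subset hT']
    · refine Finset.sum_congr rfl fun t ht => ?_
      simp [ht]
    · intro t _ ht
      simp [ht]
  · intro h0
    obtain ⟨t, ht⟩ := hne
    obtain ⟨w, hw⟩ := Finset.card_pos.1 (by rw [(hT t ht).2]; norm_num : 0 < t.card)
    have := LinearMap.congr_fun h0 (Pi.single ⟨w, mem_verticesOf.2 ⟨t, ht, hw⟩⟩ 1)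
    simp [φ, LinearMap.sum_apply] at this
  · ext e
    simp only [φ, LinearMap.comp_apply, LinearMap.sum_apply, LinearMap.proj_apply,
      Matrix.mulVecLin_apply, LinearMap.coe_single, Matrix.mulVec_single_one,
      LinearMap.zero_comp, LinearMap.zero_apply, M₁, Matrix.col_apply, Matrix.of_apply]
    rw [Finset.sum_coe_sort (verticesOf T) (fun w => if w ∈ e.1 then (1 : ZMod 2) else 0),
      ← Finset.sum_filter, Finset.sum_const, nsmul_one]
    obtain ⟨he2, t, ht, hsub⟩ := mem_edgesOf.1 e.2
    have : (verticesOf T).filter (· ∈ e.1) = e.1 := by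
      ext w
      simp only [Finset.mem_filter, mem_verticesOf, and_iff_right_iff_imp]
      exact fun hw => ⟨t, ht, hsub hw⟩
    rw [this, he2]
    rfl

/-- The combinatorial Gauss–Bonnet inequality for the region bounded by a polygon. -/
theorem IsPolygon.gaussBonnet [Fintype W] (hD : IsDisc D)
    (hdeg : ∀ w, IsInterior D w → 6 ≤ degree D w) {N : ℕ} {c : ℕ → W} (hc : IsPolygon D N c)
    {T : Finset (Finset W)} (hT : IsTriangles D T) (hbd : bdry T = pathChain c N) :
    ∑ i ∈ Finset.range N, (T.filter (c i ∈ ·)).card + 6 ≤ 3 * N := by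
  have h3 := hc.three_le
  have hZE : IsPolygon.edges N c ⊆ edgesOf T := by
    intro e he
    have h1 : bdry T e = 1 := by rw [hbd, hc.pathChain_apply, if_pos he]
    have he2 : e.card = 2 := by
      by_contra h
      rw [bdry_apply_of_ne _ h] at h1
      exact zero_ne_one h1
    rw [bdry_apply _ he2] at h1
    have : (T.filter (e ⊆ ·)).Nonempty := by
      rw [Finset.nonempty_iff_ne_empty]
      intro h
      rw [h] at h1
      simp at h1
    obtain ⟨t, ht⟩ := this
    exact mem_edgesOf.2 ⟨he2, t, Finset.mem_filter.1 ht⟩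
  have hcE : ∀ i < N, ({c i, c (i + 1)} : Finset W) ∈ edgesOf T := fun i hi =>
    hZE (Finset.mem_image.2 ⟨i, Finset.mem_range.2 hi, rfl⟩)
  have hne : T.Nonempty := by
    obtain ⟨-, t, ht, -⟩ := mem_edgesOf.1 (hcE 0 (by omega))
    exact ⟨t, ht⟩
  have hEuler := card_edgesOf_add_one_le hD hc hT hne hbd
  -- Counting pairs (triangle, edge): the parity of the boundary and the bound of two triangles per
  -- edge put one triangle on each polygon edge and two on every other edge of T.
  have hedges : 3 * T.card + N = 2 * (edgesOf T).card := by
    have h1 : ∑ t ∈ T, ((edgesOf T).filter (· ⊆ t)).card =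
        ∑ e ∈ edgesOf T, (T.filter (e ⊆ ·)).card :=
      sum_card_filter_comm T (edgesOf T) (fun t e => e ⊆ t)
    have h2 : ∀ t ∈ T, ((edgesOf T).filter (· ⊆ t)).card = 3 := by
      intro t ht
      have : (edgesOf T).filter (· ⊆ t) = Finset.powersetCard 2 t := by
        ext e
        simp only [Finset.mem_filter, mem_edgesOf, Finset.mem_powersetCard]
        constructor
        · rintro ⟨⟨h, -⟩, h'⟩; exact ⟨h', h⟩
        · rintro ⟨h', h⟩; exact ⟨⟨h, t, ht, h'⟩, h'⟩
      rw [this, Finset.card_powersetCard, (hT t ht).2]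
      rfl
    rw [Finset.sum_congr rfl h2, Finset.sum_const, smul_eq_mul] at h1
    have h3 : ∀ e ∈ edgesOf T, (T.filter (e ⊆ ·)).card +
        (if e ∈ IsPolygon.edges N c then 1 else 0) = 2 := by
      intro e he
      obtain ⟨he2, t, ht, hsub⟩ := mem_edgesOf.1 he
      have hle := card_filter_le_two hD.surface hT he2
      have hpos : 0 < (T.filter (e ⊆ ·)).card :=
        Finset.card_pos.2 ⟨t, Finset.mem_filter.2 ⟨ht, hsub⟩⟩
      have hpar : ((T.filter (e ⊆ ·)).card : ZMod 2) =
          if e ∈ IsPolygon.edges N c then 1 else 0 := by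
        rw [← bdry_apply _ he2, hbd, hc.pathChain_apply]
      generalize (T.filter (e ⊆ ·)).card = n at hle hpos hpar ⊢
      have : n = 1 ∨ n = 2 := by omega
      split_ifs at hpar ⊢ with hz
      · rcases this with rfl | rfl
        · rfl
        · exact absurd hpar (by decide)
      · rcases this with rfl | rfl
        · exact absurd hpar (by decide)
        · rfl
    have h4 := Finset.sum_congr rfl h3
    rw [Finset.sum_add_distrib, ← h1, ← Finset.card_filter, Finset.sum_const, smul_eq_mul] at h4
    have h5 : (edgesOf T).filter (· ∈ IsPolygon.edges N c) = IsPolygon.edges N c := by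
      ext e
      simp only [Finset.mem_filter, and_iff_right_iff_imp]
      exact fun h => hZE h
    rw [h5, hc.card_edges] at h4
    omega
  have hverts : 3 * T.card = ∑ w ∈ verticesOf T, (T.filter (w ∈ ·)).card := by
    have h1 : ∑ t ∈ T, ((verticesOf T).filter (· ∈ t)).card =
        ∑ w ∈ verticesOf T, (T.filter (w ∈ ·)).card :=
      sum_card_filter_comm T (verticesOf T) (fun t w => w ∈ t)
    have h2 : ∀ t ∈ T, ((verticesOf T).filter (· ∈ t)).card = 3 := by
      intro t ht
      have : (verticesOf T).filter (· ∈ t) = t := by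
        ext w
        simp only [Finset.mem_filter, mem_verticesOf, and_iff_right_iff_imp]
        exact fun h => ⟨t, ht, h⟩
      rw [this, (hT t ht).2]
    rw [Finset.sum_congr rfl h2, Finset.sum_const, smul_eq_mul] at h1
    omega
  have hinj : Set.InjOn c (Finset.range N : Set ℕ) := by
    rw [Finset.coe_range]
    exact hc.inj
  have hsub : (Finset.range N).image c ⊆ verticesOf T := by
    intro w hw
    obtain ⟨i, hi, rfl⟩ := Finset.mem_image.1 hw
    obtain ⟨-, t, ht, hs⟩ := mem_edgesOf.1 (hcE i (Finset.mem_range.1 hi))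
    exact mem_verticesOf.2 ⟨t, ht, hs (by simp)⟩
  -- A vertex of T off the polygon has only boundary-free edges, so T contains its full star and the
  -- degree bound applies.
  have hrest : 6 * (verticesOf T \ (Finset.range N).image c).card ≤
      ∑ w ∈ verticesOf T \ (Finset.range N).image c, (T.filter (w ∈ ·)).card := by
    rw [mul_comm, ← smul_eq_mul]
    refine Finset.card_nsmul_le_sum _ _ _ fun w hw => ?_
    rw [Finset.mem_sdiff] at hw
    obtain ⟨hint, hle⟩ := isInterior_and_degree_le hD.surface hT (w := w) (fun x hwx => by
      have h1 : bdry T {w, x} = 0 := by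
        rw [hbd, hc.pathChain_apply, if_neg]
        intro hmem
        obtain ⟨i, hi, he⟩ := Finset.mem_image.1 hmem
        rw [Finset.mem_range] at hi
        have hw' : w ∈ ({c i, c (i + 1)} : Finset W) := he ▸ (by simp)
        simp only [Finset.mem_insert, Finset.mem_singleton] at hw'
        apply hw.2
        rcases hw' with rfl | rfl
        · exact Finset.mem_image_of_mem _ (Finset.mem_range.2 hi)
        · by_cases hi' : i + 1 < N
          · exact Finset.mem_image_of_mem _ (Finset.mem_range.2 hi')
          · rw [show i + 1 = N by omega, hc.closed]
            exact Finset.mem_image_of_mem _ (Finset.mem_range.2 (by omega))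
      rw [bdry_apply _ (Finset.card_pair hwx), CharP.cast_eq_zero_iff _ 2] at h1
      exact even_iff_two_dvd.2 h1) (mem_verticesOf.1 hw.1)
    exact (hdeg w hint).trans hle
  have hcard := Finset.card_sdiff_add_card_eq_card hsub
  rw [Finset.card_image_of_injOn hinj, Finset.card_range] at hcard
  rw [← Finset.sum_sdiff hsub, Finset.sum_image hinj] at hverts
  -- With E, F and V the numbers of edges, triangles and vertices, 2E = 3F + N and E + 1 ≤ F + V
  -- give 3F + 3N + 6 ≤ 6V, while 3F is at least the corner sum plus 6(V - N).
  omega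

end GaussBonnet

/-! ### Corners of a polygon and flips -/

section Corners

variable {W : Type*} [DecidableEq W] {D : AbstractSimplicialComplex W}

theorem exists_triangle_of_edge {N : ℕ} {c : ℕ → W} (hc : IsPolygon D N c)
    {T : Finset (Finset W)} (hbd : bdry T = pathChain c N) {i : ℕ} (hi : i < N) :
    ∃ t ∈ T, c i ∈ t ∧ c (i + 1) ∈ t := by
  have he2 := Finset.card_pair (hc.adj i hi).1
  have h1 : bdry T {c i, c (i + 1)} = 1 := by
    have hmem : {c i, c (i + 1)} ∈ IsPolygon.edges N c :=
      Finset.mem_image.2 ⟨i, Finset.mem_range.2 hi, rfl⟩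
    rw [hbd, hc.pathChain_apply, if_pos hmem]
  rw [bdry_apply _ he2] at h1
  have : (T.filter ({c i, c (i + 1)} ⊆ ·)).Nonempty := by
    rw [Finset.nonempty_iff_ne_empty]
    intro h
    rw [h] at h1
    simp at h1
  obtain ⟨t, ht⟩ := this
  rw [Finset.mem_filter] at ht
  exact ⟨t, ht.1, ht.2 (by simp), ht.2 (by simp)⟩

theorem one_le_corner {N : ℕ} {c : ℕ → W} (hc : IsPolygon D N c)
    {T : Finset (Finset W)} (hbd : bdry T = pathChain c N) {i : ℕ} (hi : i < N) :
    1 ≤ (T.filter (c i ∈ ·)).card := by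
  obtain ⟨t, ht, h1, -⟩ := exists_triangle_of_edge hc hbd hi
  exact Finset.card_pos.2 ⟨t, Finset.mem_filter.2 ⟨ht, h1⟩⟩

theorem eq_triple_of_mem {a b w : W} (hab : a ≠ b) (haw : a ≠ w) (hwb : w ≠ b) {t : Finset W}
    (ht : t.card = 3) (ha : a ∈ t) (hb : b ∈ t) (hw : w ∈ t) : t = {w, a, b} := by
  symm
  apply Finset.eq_of_subset_of_card_le
  · simp [Finset.insert_subset_iff, ha, hb, hw]
  · rw [ht, Finset.card_eq_three.2 ⟨w, a, b, haw.symm, hwb, hab, rfl⟩]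

/-- A corner of a polygon with at most two triangles is a triangle or can be flipped. -/
theorem corner_cases {N : ℕ} {c : ℕ → W} (hc : IsPolygon D N c)
    {T : Finset (Finset W)} (hT : IsTriangles D T) (hbd : bdry T = pathChain c N) {i : ℕ}
    (h0 : 0 < i) (hi : i < N) (hle : (T.filter (c i ∈ ·)).card ≤ 2) :
    {c i, c (i - 1), c (i + 1)} ∈ T ∨
      (2 ≤ (T.filter (c i ∈ ·)).card ∧ ∃ y, y ≠ c i ∧ y ≠ c (i - 1) ∧ y ≠ c (i + 1) ∧
        {c i, c (i - 1), y} ∈ T ∧ {c i, c (i + 1), y} ∈ T) := by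
  have h3 := hc.three_le
  have hi1 : i - 1 + 1 = i := Nat.sub_add_cancel h0
  obtain ⟨t₁, ht₁, ha₁, hw₁⟩ := exists_triangle_of_edge hc hbd (i := i - 1) (by omega)
  obtain ⟨t₂, ht₂, hw₂, hb₂⟩ := exists_triangle_of_edge hc hbd hi
  have haw : c (i - 1) ≠ c i := by
    have := (hc.adj (i - 1) (by omega)).1
    rwa [hi1] at this
  have hwb : c i ≠ c (i + 1) := (hc.adj i hi).1
  have hab : c (i - 1) ≠ c (i + 1) := fun h => by
    have := hc.index_eq (by omega) (by omega) h
    omega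
  rw [hi1] at hw₁
  by_cases h12 : t₁ = t₂
  · left
    subst h12
    rw [← eq_triple_of_mem hab haw hwb (hT _ ht₁).2 ha₁ hb₂ hw₁]
    exact ht₁
  have hpair : ({t₁, t₂} : Finset (Finset W)) = T.filter (c i ∈ ·) := by
    apply Finset.eq_of_subset_of_card_le
    · intro t ht
      simp only [Finset.mem_insert, Finset.mem_singleton] at ht
      rcases ht with rfl | rfl <;> simp [*]
    · rw [Finset.card_pair h12]; exact hle
  by_cases hb₁ : c (i + 1) ∈ t₁
  · left
    rw [← eq_triple_of_mem hab haw hwb (hT _ ht₁).2 ha₁ hb₁ hw₁]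
    exact ht₁
  by_cases ha₂ : c (i - 1) ∈ t₂
  · left
    rw [← eq_triple_of_mem hab haw hwb (hT _ ht₂).2 ha₂ hb₂ hw₂]
    exact ht₂
  right
  refine ⟨by rw [← hpair, Finset.card_pair h12], ?_⟩
  obtain ⟨y, hwy, hya, rfl⟩ := exists_eq_triple' haw.symm (hT _ ht₁).2
    (by simp [Finset.insert_subset_iff, ha₁, hw₁] : {c i, c (i - 1)} ⊆ t₁)
  have hyb : y ≠ c (i + 1) := by
    rintro rfl
    exact hb₁ (by simp)
  refine ⟨y, hwy.symm, hya, hyb, ht₁, ?_⟩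
  -- The edge from c i to y is not on the polygon, so a second triangle of T lies behind it; with
  -- only two triangles at c i, that one must be t₂.
  have heven : Even (T.filter ({c i, y} ⊆ ·)).card := by
    have h1 : bdry T {c i, y} = 0 := by
      rw [hbd, hc.pathChain_apply, if_neg]
      intro hmem
      have hy : y ∈ ({c i, y} : Finset W) := by simp
      rcases (hc.mem_edges_iff h0 hi).1 ⟨hmem, by simp⟩ with h | h
      · rw [h] at hy
        simp only [Finset.mem_insert, Finset.mem_singleton] at hy
        exact hy.elim hya hwy.symm
      · rw [h] at hy
        simp only [Finset.mem_insert, Finset.mem_singleton] at hy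
        exact hy.elim hwy.symm hyb
    rw [bdry_apply _ (Finset.card_pair hwy), CharP.cast_eq_zero_iff _ 2] at h1
    exact even_iff_two_dvd.2 h1
  rw [Finset.pair_comm] at ht₁
  obtain ⟨z, hwz, hzy, hza, hz⟩ := exists_other_apex hT hwy heven ht₁
  have hz' : ({c i, y, z} : Finset W) ∈ T.filter (c i ∈ ·) :=
    Finset.mem_filter.2 ⟨hz, by simp⟩
  rw [← hpair] at hz'
  simp only [Finset.mem_insert, Finset.mem_singleton] at hz'
  rcases hz' with h | h
  · have : z ∈ ({c i, c (i - 1), y} : Finset W) := h ▸ (by simp)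
    simp only [Finset.mem_insert, Finset.mem_singleton] at this
    rcases this with h | h | h
    · exact (hwz h.symm).elim
    · exact (hza h).elim
    · exact (hzy h).elim
  · have hy₂ : y ∈ t₂ := h ▸ (by simp)
    rw [← eq_triple_of_mem hyb.symm hwb.symm hwy (hT _ ht₂).2 hb₂ hy₂ hw₂]
    exact ht₂

/-- Moving one vertex affects only the two edges next to it. Requiring 0 < i < N keeps the common
end point c 0 = c N fixed. -/
theorem pathChain_update {c : ℕ → W} {N i : ℕ} (h0 : 0 < i) (hi : i < N) (y : W) :
    pathChain (Function.update c i y) N + (edgeChain (c (i - 1)) (c i) +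
      edgeChain (c i) (c (i + 1))) =
    pathChain c N + (edgeChain (c (i - 1)) y + edgeChain y (c (i + 1))) := by
  obtain ⟨m, rfl⟩ : ∃ m, i = m + 1 := ⟨i - 1, by omega⟩
  obtain ⟨r, rfl⟩ : ∃ r, N = m + 1 + 1 + r := ⟨N - (m + 1 + 1), by omega⟩
  simp only [pathChain, Finset.sum_range_add, Finset.sum_range_succ _ (m + 1),
    Finset.sum_range_succ _ m, Nat.add_sub_cancel]
  have h1 : ∑ x ∈ Finset.range m, edgeChain (Function.update c (m + 1) y x)
      (Function.update c (m + 1) y (x + 1)) = ∑ x ∈ Finset.range m, edgeChain (c x) (c (x + 1)) := by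
    refine Finset.sum_congr rfl fun x hx => ?_
    rw [Finset.mem_range] at hx
    rw [Function.update_of_ne (by omega), Function.update_of_ne (by omega)]
  have h2 : ∑ x ∈ Finset.range r, edgeChain (Function.update c (m + 1) y (m + 1 + 1 + x))
      (Function.update c (m + 1) y (m + 1 + 1 + x + 1)) =
      ∑ x ∈ Finset.range r, edgeChain (c (m + 1 + 1 + x)) (c (m + 1 + 1 + x + 1)) := by
    refine Finset.sum_congr rfl fun x hx => ?_
    rw [Function.update_of_ne (by omega), Function.update_of_ne (by omega)]
  rw [h1, h2, Function.update_self, Function.update_of_ne (by omega : m ≠ m + 1),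
    Function.update_of_ne (by omega : m + 1 + 1 ≠ m + 1)]
  abel

/-- The two triangles share the edge from c i to y, so mod 2 their boundary is the old two-edge path
plus the new one through y; removing both pushes the polygon across them. -/
theorem exists_flip {N : ℕ} {c : ℕ → W} (hc : IsPolygon D N c)
    {T : Finset (Finset W)} (hbd : bdry T = pathChain c N) {i : ℕ}
    (h0 : 0 < i) (hi : i < N) {y : W} (hyw : y ≠ c i) (hya : y ≠ c (i - 1)) (hyb : y ≠ c (i + 1))
    (h1 : {c i, c (i - 1), y} ∈ T) (h2 : {c i, c (i + 1), y} ∈ T) :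
    ∃ T' ⊂ T, bdry T' = pathChain (Function.update c i y) N := by
  have h3 := hc.three_le
  have haw : c (i - 1) ≠ c i := by
    have := (hc.adj (i - 1) (by omega)).1
    rwa [Nat.sub_add_cancel h0] at this
  have hwb : c i ≠ c (i + 1) := (hc.adj i hi).1
  have hab : c (i - 1) ≠ c (i + 1) := fun h => by
    have := hc.index_eq (by omega) (by omega) h
    omega
  have hne : ({c i, c (i - 1), y} : Finset W) ≠ {c i, c (i + 1), y} := fun h => by
    have : c (i - 1) ∈ ({c i, c (i + 1), y} : Finset W) := h ▸ (by simp)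
    simp only [Finset.mem_insert, Finset.mem_singleton] at this
    rcases this with h | h | h
    · exact haw h
    · exact hab h
    · exact hya h.symm
  have hsub : ({{c i, c (i - 1), y}, {c i, c (i + 1), y}} : Finset (Finset W)) ⊆ T := by
    simp [Finset.insert_subset_iff, h1, h2]
  refine ⟨_, Finset.sdiff_ssubset hsub (by simp), ?_⟩
  have e1 := Finset.sum_sdiff (f := triChain) hsub
  rw [Finset.sum_pair hne] at e1
  change bdry _ + _ = bdry T at e1
  rw [← edgeChain_add_add haw.symm hya.symm hyw.symm,
    ← edgeChain_add_add hwb hyb.symm hyw.symm, hbd] at e1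
  have e2 := pathChain_update (c := c) h0 hi y
  have s1 := add_self_chain (edgeChain (c (i - 1)) (c i))
  have s2 := add_self_chain (edgeChain (c i) (c (i + 1)))
  have s3 := add_self_chain (edgeChain (c (i - 1)) y)
  have s4 := add_self_chain (edgeChain y (c (i + 1)))
  have s5 := add_self_chain (edgeChain (c i) y)
  rw [edgeChain_comm (c i) (c (i - 1)), edgeChain_comm (c (i + 1)) y] at e1
  linear_combination e1 - e2 - s5 - s3 - s4

end Corners

/-! ### Least-area geodesic bigons -/

section Geodesics

/-- A closed edge path of length `2 * m + r` made of two paths of length `m` on which the level `ℓ`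
grows up to `k`, and a path `e 0, …, e r` joining their ends. -/
structure IsBigon {W : Type*} (D : AbstractSimplicialComplex W) (ℓ : W → ℕ) (e : ℕ → W)
    (r k m : ℕ) (c : ℕ → W) : Prop where
  closed : c (2 * m + r) = c 0
  up : ∀ i ≤ m, ℓ (c i) + m = k + i
  down : ∀ i, m + r ≤ i → i ≤ 2 * m + r → ℓ (c i) + i = k + m + r
  mid : ∀ i ≤ r, c (m + i) = e i
  adj : ∀ i < 2 * m + r, (skeleton D.toPreAbstractSimplicialComplex).Adj (c i) (c (i + 1))

variable {W : Type*} [DecidableEq W] {D : AbstractSimplicialComplex W}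

/-- A bigon with a filling of least area: it is a polygon, and along the two geodesic sides the
filling has at least three triangles at every vertex. -/
theorem IsBigon.exists_minimal [Fintype W] (hD : IsDisc D) {ℓ : W → ℕ}
    (hℓ : ∀ a b, (skeleton D.toPreAbstractSimplicialComplex).Adj a b → ℓ b ≤ ℓ a + 1)
    {e : ℕ → W} {r k m : ℕ} {c : ℕ → W} (hr : 1 ≤ r)
    (he : Set.InjOn e (Set.Iic r)) (hek : ∀ i, 0 < i → i < r → k < ℓ (e i))
    (hc : IsBigon D ℓ e r k m c) :
    ∃ m c T, 1 ≤ m ∧ IsBigon D ℓ e r k m c ∧ IsPolygon D (2 * m + r) c ∧ IsTriangles D T ∧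
      bdry T = pathChain c (2 * m + r) ∧
      ∀ i, (0 < i ∧ i < m) ∨ (m + r < i ∧ i < 2 * m + r) → 3 ≤ (T.filter (c i ∈ ·)).card := by
  classical
  have hex : ∃ m c, IsBigon D ℓ e r k m c := ⟨m, c, hc⟩
  clear hc c m
  -- The choice is in two stages: first the shortest sides m, then, for that m, a bigon and filling
  -- with the fewest triangles. The first makes the path simple, the second excludes flips.
  obtain ⟨m, ⟨c₀, hc₀⟩, hmin⟩ : ∃ m, (∃ c, IsBigon D ℓ e r k m c) ∧
      ∀ m' < m, ¬ ∃ c, IsBigon D ℓ e r k m' c :=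
    ⟨Nat.find hex, Nat.find_spec hex, fun _ h => Nat.find_min hex h⟩
  have hex2 : ∃ n c T, IsBigon D ℓ e r k m c ∧ IsTriangles D T ∧
      bdry T = pathChain c (2 * m + r) ∧ T.card = n := by
    obtain ⟨T, hT, hbd⟩ := exists_filling_of_closed hD.simplyConnected hc₀.closed hc₀.adj
    exact ⟨_, c₀, T, hc₀, hT, hbd, rfl⟩
  obtain ⟨c, T, hc, hT, hbd, hcard⟩ := Nat.find_spec hex2
  have hTmin : ∀ c' T', IsBigon D ℓ e r k m c' → IsTriangles D T' →
      bdry T' = pathChain c' (2 * m + r) → T.card ≤ T'.card := fun c' T' h1 h2 h3 => by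
    rw [hcard]
    exact Nat.find_min' hex2 ⟨c', T', h1, h2, h3, rfl⟩
  have her : e 0 ≠ e r := fun h => by
    have := he (Nat.zero_le r : 0 ∈ Set.Iic r) (le_refl r : r ∈ Set.Iic r) h
    omega
  have hm : 1 ≤ m := by
    by_contra h
    obtain rfl : m = 0 := by omega
    apply her
    rw [← hc.mid 0 (by omega), ← hc.mid r le_rfl]
    simpa using hc.closed.symm
  have hinj : ∀ i j, i < j → j < 2 * m + r → c i ≠ c j := by
    intro i j hij hj hne
    have hA : ∀ i, i ≤ m → ℓ (c i) + m = k + i := hc.up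
    have hB : ∀ i, m < i → i < m + r → k < ℓ (c i) := fun i h1 h2 => by
      have := hc.mid (i - m) (by omega)
      rw [Nat.add_sub_cancel' h1.le] at this
      rw [this]
      exact hek _ (by omega) (by omega)
    have hC := hc.down
    rcases le_or_gt i m with hi | hi
    · have h1 := hA i hi
      rcases le_or_gt j m with hj' | hj'
      · have := hA j hj'
        rw [hne] at h1
        omega
      rcases lt_or_ge j (m + r) with hj2 | hj2
      · have := hB j hj' hj2
        rw [hne] at h1
        omega
      have h2 := hC j hj2 hj.le
      rw [hne] at h1
      -- Equal levels on opposite sides force symmetric indices; cutting the bigon there leaves one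
      -- with shorter sides, unless i = m, where the ends of the base would coincide.
      have hsum : i + j = 2 * m + r := by omega
      rcases hi.lt_or_eq with hi | rfl
      · refine hmin (m - i) (by omega) ⟨fun x => c (i + x), ?_, ?_, ?_, ?_, ?_⟩
        · rw [add_zero, hne]
          congr 1
          omega
        · intro x hx
          have := hA (i + x) (by omega)
          omega
        · intro x hx1 hx2
          have := hC (i + x) (by omega) (by omega)
          omega
        · intro x hx
          rw [← hc.mid x hx]
          congr 1
          omega
        · intro x hx
          exact hc.adj (i + x) (by omega)
      · apply her
        rw [← hc.mid 0 (by omega), ← hc.mid r le_rfl]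
        rw [add_zero, show i + r = j by omega]
        exact hne
    rcases lt_or_ge i (m + r) with hi2 | hi2
    · have h1 := hB i hi hi2
      rw [hne] at h1
      rcases lt_or_ge j (m + r) with hj2 | hj2
      · have e1 := hc.mid (i - m) (by omega)
        have e2 := hc.mid (j - m) (by omega)
        rw [Nat.add_sub_cancel' (by omega)] at e1 e2
        rw [e1, e2] at hne
        have := he (show i - m ≤ r by omega : i - m ∈ Set.Iic r)
          (show j - m ≤ r by omega : j - m ∈ Set.Iic r) hne
        omega
      · have := hC j hj2 hj.le
        omega
    · have h1 := hC i hi2 (by omega)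
      have h2 := hC j (by omega) hj.le
      rw [hne] at h1
      omega
  have hpoly : IsPolygon D (2 * m + r) c := by
    refine ⟨by omega, hc.closed, fun i hi j hj hij => ?_, hc.adj⟩
    rcases lt_trichotomy i j with h | h | h
    · exact (hinj i j h hj hij).elim
    · exact h
    · exact (hinj j i h hi hij.symm).elim
  refine ⟨m, c, T, hm, hc, hpoly, hT, hbd, fun x hx => ?_⟩
  by_contra hlt
  have hx0 : 0 < x := by omega
  have hxN : x < 2 * m + r := by omega
  have hx1 : x - 1 + 1 = x := Nat.sub_add_cancel hx0
  -- Levels are strictly monotone through x, so its two neighbours on the path differ by two levels.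
  -- They cannot be adjacent, and any common neighbour has the level of c x, so a flip yields
  -- another bigon.
  have hlev : (ℓ (c x) = ℓ (c (x - 1)) + 1 ∧ ℓ (c (x + 1)) = ℓ (c x) + 1) ∨
      (ℓ (c (x - 1)) = ℓ (c x) + 1 ∧ ℓ (c x) = ℓ (c (x + 1)) + 1) := by
    rcases hx with hx | hx
    · have h1 := hc.up (x - 1) (by omega)
      have h2 := hc.up x (by omega)
      have h3 := hc.up (x + 1) (by omega)
      omega
    · have h1 := hc.down (x - 1) (by omega) (by omega)
      have h2 := hc.down x (by omega) (by omega)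
      have h3 := hc.down (x + 1) (by omega) (by omega)
      omega
  have hadj_of : ∀ {t : Finset W}, t ∈ T → ∀ {a b : W}, a ∈ t → b ∈ t → a ≠ b →
      (skeleton D.toPreAbstractSimplicialComplex).Adj a b := fun ht _ _ ha hb hab =>
    ⟨hab, _, (hT _ ht).1, ha, hb⟩
  rcases corner_cases hpoly hT hbd hx0 hxN (by omega) with h | ⟨-, y, hyw, hya, hyb, h1, h2⟩
  · have hab : c (x - 1) ≠ c (x + 1) := fun h => by
      rw [h] at hlev
      omega
    have l1 := hℓ _ _ (hadj_of h (a := c (x - 1)) (b := c (x + 1)) (by simp) (by simp) hab)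
    have l2 := hℓ _ _ (hadj_of h (a := c (x + 1)) (b := c (x - 1)) (by simp) (by simp) hab.symm)
    omega
  · have aay := hadj_of h1 (a := c (x - 1)) (b := y) (by simp) (by simp) hya.symm
    have ayb := hadj_of h2 (a := y) (b := c (x + 1)) (by simp) (by simp) hyb
    have l1 := hℓ _ _ aay
    have l2 := hℓ _ _ aay.symm
    have l3 := hℓ _ _ ayb
    have l4 := hℓ _ _ ayb.symm
    have hy : ℓ y = ℓ (c x) := by omega
    obtain ⟨T', hT', hbd'⟩ := exists_flip hpoly hbd hx0 hxN hyw hya hyb h1 h2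
    refine absurd (hTmin (Function.update c x y) T' ?_ (fun t ht => hT t (hT'.1 ht)) hbd')
      (not_le.2 (Finset.card_lt_card hT'))
    have hlevel : ∀ i, ℓ (Function.update c x y i) = ℓ (c i) := fun i => by
      by_cases h : i = x
      · rw [h, Function.update_self, hy]
      · rw [Function.update_of_ne h]
    refine ⟨?_, ?_, ?_, ?_, ?_⟩
    · rw [Function.update_of_ne (by omega), Function.update_of_ne (by omega), hc.closed]
    · intro i hi; rw [hlevel]; exact hc.up i hi
    · intro i hi hi'; rw [hlevel]; exact hc.down i hi hi'
    · intro i hi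
      rw [Function.update_of_ne (by omega), hc.mid i hi]
    · intro i hi
      by_cases h : i = x
      · rw [h, Function.update_self, Function.update_of_ne (by omega)]
        exact ayb
      by_cases h' : i + 1 = x
      · rw [h', Function.update_self, Function.update_of_ne h, show i = x - 1 by omega]
        exact aay
      · rw [Function.update_of_ne h, Function.update_of_ne h']
        exact hc.adj i hi

/-- The tip has at least one triangle and each of the 2(m - 1) inner side vertices at least three.
Gauss–Bonnet for 2m + r vertices then leaves at most 3(2m + r) - 6 - 1 - 6(m - 1) = 3r - 1 for the
base. -/
theorem IsBigon.exists_corner_sum_le [Fintype W] (hD : IsDisc D)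
    (hdeg : ∀ w, IsInterior D w → 6 ≤ degree D w) {ℓ : W → ℕ}
    (hℓ : ∀ a b, (skeleton D.toPreAbstractSimplicialComplex).Adj a b → ℓ b ≤ ℓ a + 1)
    {e : ℕ → W} {r k m : ℕ} {c : ℕ → W} (hr : 1 ≤ r)
    (he : Set.InjOn e (Set.Iic r)) (hek : ∀ i, 0 < i → i < r → k < ℓ (e i))
    (hc : IsBigon D ℓ e r k m c) :
    ∃ m c T, 1 ≤ m ∧ IsBigon D ℓ e r k m c ∧ IsPolygon D (2 * m + r) c ∧ IsTriangles D T ∧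
      bdry T = pathChain c (2 * m + r) ∧
      ∑ i ∈ Finset.range (r + 1), (T.filter (e i ∈ ·)).card + 1 ≤ 3 * r := by
  obtain ⟨m, c, T, hm, hc, hpoly, hT, hbd, h3⟩ := hc.exists_minimal hD hℓ hr he hek
  refine ⟨m, c, T, hm, hc, hpoly, hT, hbd, ?_⟩
  have hGB := hpoly.gaussBonnet hD hdeg hT hbd
  obtain ⟨n, rfl⟩ : ∃ n, m = n + 1 := ⟨m - 1, by omega⟩
  have hN : 2 * (n + 1) + r = (n + 1) + (r + 1) + n := by omega
  rw [hN, Finset.sum_range_add, Finset.sum_range_add, Finset.sum_range_succ'] at hGB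
  have h0 := one_le_corner hpoly hbd (i := 0) (by omega)
  have s1 : n * 3 ≤ ∑ i ∈ Finset.range n, (T.filter (c (i + 1) ∈ ·)).card := by
    have := Finset.card_nsmul_le_sum (Finset.range n) (fun i => (T.filter (c (i + 1) ∈ ·)).card) 3
      fun i hi => h3 (i + 1) (Or.inl ⟨by omega, by have := Finset.mem_range.1 hi; omega⟩)
    simpa using this
  have s2 : n * 3 ≤ ∑ i ∈ Finset.range n, (T.filter (c (n + 1 + (r + 1) + i) ∈ ·)).card := by
    have := Finset.card_nsmul_le_sum (Finset.range n)
      (fun i => (T.filter (c (n + 1 + (r + 1) + i) ∈ ·)).card) 3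
      fun i hi => h3 (n + 1 + (r + 1) + i)
        (Or.inr ⟨by omega, by have := Finset.mem_range.1 hi; omega⟩)
    simpa using this
  have s3 : ∑ i ∈ Finset.range (r + 1), (T.filter (c (n + 1 + i) ∈ ·)).card =
      ∑ i ∈ Finset.range (r + 1), (T.filter (e i ∈ ·)).card := by
    refine Finset.sum_congr rfl fun i hi => ?_
    rw [hc.mid i (by have := Finset.mem_range.1 hi; omega)]
  rw [s3] at hGB
  omega

end Geodesics

/-! ### Geometry of the distance function in a disc -/

section Levels

theorem dist_le_of_adj {W : Type*} {D : AbstractSimplicialComplex W} (hD : IsDisc D) (v : W)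
    {a b : W}
    (h : (skeleton D.toPreAbstractSimplicialComplex).Adj a b) :
    (skeleton D.toPreAbstractSimplicialComplex).dist v b ≤
      (skeleton D.toPreAbstractSimplicialComplex).dist v a + 1 := by
  have := hD.simplyConnected.connected.dist_triangle (u := v) (v := a) (w := b)
  rwa [SimpleGraph.dist_eq_one_iff_adj.2 h] at this

theorem exists_adj_dist {W : Type*} {D : AbstractSimplicialComplex W} (hD : IsDisc D)
    {v p : W} {k : ℕ}
    (h : (skeleton D.toPreAbstractSimplicialComplex).dist v p = k + 1) :
    ∃ x, (skeleton D.toPreAbstractSimplicialComplex).Adj x p ∧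
      (skeleton D.toPreAbstractSimplicialComplex).dist v x = k := by
  obtain ⟨w, hw⟩ := hD.simplyConnected.connected.exists_walk_length_eq_dist p v
  rw [SimpleGraph.dist_comm, h] at hw
  cases w with
  | nil => simp at hw
  | @cons _ x _ hadj q =>
    refine ⟨x, hadj.symm, le_antisymm ?_ ?_⟩
    · rw [SimpleGraph.dist_comm]
      refine (SimpleGraph.dist_le q).trans ?_
      simpa using hw.le
    · have := dist_le_of_adj hD v hadj.symm
      omega

theorem exists_geodesic {W : Type*} {D : AbstractSimplicialComplex W} (hD : IsDisc D)
    {v : W} (k : ℕ) :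
    ∀ p, (skeleton D.toPreAbstractSimplicialComplex).dist v p = k →
    ∃ g : ℕ → W, g 0 = v ∧ g k = p ∧
      (∀ i < k, (skeleton D.toPreAbstractSimplicialComplex).Adj (g i) (g (i + 1))) ∧
      ∀ i ≤ k, (skeleton D.toPreAbstractSimplicialComplex).dist v (g i) = i := by
  induction k with
  | zero =>
    intro p h
    have := (hD.simplyConnected.connected.dist_eq_zero_iff).1 h
    exact ⟨fun _ => v, rfl, this, by simp, by simp⟩
  | succ k ih =>
    intro p h
    obtain ⟨x, hx, hdx⟩ := exists_adj_dist hD h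
    obtain ⟨g, h0, hk, hadj, hd⟩ := ih x hdx
    refine ⟨fun i => if i ≤ k then g i else p, by simpa using h0, by simp, fun i hi => ?_,
      fun i hi => ?_⟩
    · rcases Nat.lt_succ_iff_lt_or_eq.1 hi with hi | rfl
      · simpa [hi.le, Nat.succ_le_of_lt hi] using hadj i hi
      · simpa [hk] using hx
    · rcases Nat.le_succ_iff.1 hi with hi | rfl
      · simpa [hi] using hd i hi
      · simpa using h

/-- Go up a geodesic from v to e 0, along e, and down a geodesic from e r. The sides may meet;
minimisation takes care of that later. -/
theorem exists_isBigon {W : Type*} {D : AbstractSimplicialComplex W} (hD : IsDisc D)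
    {v : W} {k r : ℕ} {e : ℕ → W}
    (hr : 1 ≤ r)
    (h0 : (skeleton D.toPreAbstractSimplicialComplex).dist v (e 0) = k)
    (h1 : (skeleton D.toPreAbstractSimplicialComplex).dist v (e r) = k)
    (hadj : ∀ i < r, (skeleton D.toPreAbstractSimplicialComplex).Adj (e i) (e (i + 1))) :
    ∃ c, IsBigon D ((skeleton D.toPreAbstractSimplicialComplex).dist v) e r k k c := by
  obtain ⟨g, hg0, hgk, hga, hgd⟩ := exists_geodesic hD k _ h0
  -- The pieces of the piecewise definition agree at the junctions i = k and i = k + r, so each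
  -- formula can be used on its closed range.
  obtain ⟨g', hg0', hgk', hga', hgd'⟩ := exists_geodesic hD k _ h1
  have hc1 : ∀ i ≤ k, (if i ≤ k then g i else if i ≤ k + r then e (i - k) else g' (2 * k + r - i))
      = g i := fun i hi => if_pos hi
  have hc2 : ∀ i, k ≤ i → i ≤ k + r →
      (if i ≤ k then g i else if i ≤ k + r then e (i - k) else g' (2 * k + r - i)) = e (i - k) := by
    intro i hi hi'
    rcases hi.lt_or_eq with hi | rfl
    · rw [if_neg (by omega), if_pos hi']
    · rw [if_pos le_rfl, hgk, Nat.sub_self]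
  have hc3 : ∀ i, k + r ≤ i →
      (if i ≤ k then g i else if i ≤ k + r then e (i - k) else g' (2 * k + r - i)) =
        g' (2 * k + r - i) := by
    intro i hi
    rcases hi.lt_or_eq with hi | rfl
    · rw [if_neg (by omega), if_neg (by omega)]
    · rw [if_neg (by omega), if_pos le_rfl, show 2 * k + r - (k + r) = k by omega, hgk',
        Nat.add_sub_cancel_left]
  refine ⟨fun i => if i ≤ k then g i else if i ≤ k + r then e (i - k) else g' (2 * k + r - i),
    ?_, ?_, ?_, ?_, ?_⟩
  · rw [hc3 _ (by omega), hc1 _ (by omega), Nat.sub_self, hg0, hg0']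
  · intro i hi
    rw [hc1 i hi, hgd i hi, add_comm]
  · intro i hi hi'
    rw [hc3 i hi, hgd' _ (by omega)]
    omega
  · intro i hi
    rw [hc2 _ (by omega) (by omega), Nat.add_sub_cancel_left]
  · intro i hi
    rcases lt_or_ge i k with h | h
    · rw [hc1 i h.le, hc1 (i + 1) h]
      exact hga i h
    rcases lt_or_ge i (k + r) with h' | h'
    · rw [hc2 i h h'.le, hc2 (i + 1) (by omega) h', show i + 1 - k = i - k + 1 by omega]
      exact hadj _ (by omega)
    · rw [hc3 i h', hc3 (i + 1) (by omega)]
      have := hga' (2 * k + r - (i + 1)) (by omega)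
      rw [show 2 * k + r - (i + 1) + 1 = 2 * k + r - i by omega] at this
      exact this.symm

variable {W : Type*} [DecidableEq W] [Fintype W] {D : AbstractSimplicialComplex W}

/-- For N = 3 Gauss–Bonnet bounds the corner sum by 3, so each corner has exactly one triangle of
the filling, and that triangle is xyz. -/
theorem triangle_mem_faces (hD : IsDisc D) (hdeg : ∀ w, IsInterior D w → 6 ≤ degree D w)
    {x y z : W}
    (hxy : (skeleton D.toPreAbstractSimplicialComplex).Adj x y)
    (hyz : (skeleton D.toPreAbstractSimplicialComplex).Adj y z)
    (hzx : (skeleton D.toPreAbstractSimplicialComplex).Adj z x) : {x, y, z} ∈ D.faces := by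
  let c : ℕ → W := fun i => if i = 1 then y else if i = 2 then z else x
  have hc : IsPolygon D 3 c := by
    refine ⟨le_rfl, rfl, ?_, ?_⟩
    · intro i hi j hj hij
      rw [Set.mem_Iio] at hi hj
      have h1 := hxy.1
      have h2 := hyz.1
      have h3 := hzx.1
      interval_cases i <;> interval_cases j <;> simp_all [c]
    · intro i hi
      interval_cases i
      · exact hxy
      · exact hyz
      · exact hzx
  obtain ⟨T, hT, hbd⟩ := exists_filling_of_closed hD.simplyConnected hc.closed hc.adj
  have hGB := hc.gaussBonnet hD hdeg hT hbd
  have h0 := one_le_corner hc hbd (i := 0) (by omega)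
  have h1 := one_le_corner hc hbd (i := 1) (by omega)
  have h2 := one_le_corner hc hbd (i := 2) (by omega)
  rw [Finset.sum_range_succ, Finset.sum_range_succ, Finset.sum_range_succ,
    Finset.sum_range_zero] at hGB
  rcases corner_cases hc hT hbd (i := 1) (by omega) (by omega) (by omega) with h | ⟨h, -⟩
  · have : ({y, x, z} : Finset W) ∈ T := h
    rw [Finset.insert_comm]
    exact (hT _ this).1
  · omega

/-- Two adjacent vertices at the same distance `k + 1` from `v` have a common neighbour at
distance `k`. -/
theorem exists_common_neighbor (hD : IsDisc D) (hdeg : ∀ w, IsInterior D w → 6 ≤ degree D w)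
    {v p q : W} {k : ℕ} (hpq : (skeleton D.toPreAbstractSimplicialComplex).Adj p q)
    (hp : (skeleton D.toPreAbstractSimplicialComplex).dist v p = k)
    (hq : (skeleton D.toPreAbstractSimplicialComplex).dist v q = k) :
    ∃ u, (skeleton D.toPreAbstractSimplicialComplex).Adj u p ∧
      (skeleton D.toPreAbstractSimplicialComplex).Adj u q ∧
      (skeleton D.toPreAbstractSimplicialComplex).dist v u + 1 = k := by
  let e : ℕ → W := fun i => if i = 0 then p else q
  have he : Set.InjOn e (Set.Iic 1) := by
    intro i hi j hj hij
    rw [Set.mem_Iic] at hi hj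
    have := hpq.1
    interval_cases i <;> interval_cases j <;> simp_all [e]
  obtain ⟨c, hc⟩ := exists_isBigon hD (e := e) (v := v) le_rfl hp hq (fun i hi => by
    obtain rfl : i = 0 := by omega
    exact hpq)
  obtain ⟨m, c, T, hm, hc, hpoly, hT, hbd, hsum⟩ := hc.exists_corner_sum_le hD hdeg
    (fun a b => dist_le_of_adj hD v) le_rfl he (fun i h1 h2 => by omega)
  -- The base is one edge, r = 1: the two corners sum to at most 2, so each has one triangle, and
  -- the triangle at p contains q and the preceding geodesic vertex.
  rw [Finset.sum_range_succ, Finset.sum_range_succ, Finset.sum_range_zero] at hsum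
  have hc0 := hc.mid 0 (by omega)
  have hc1 := hc.mid 1 (by omega)
  rw [add_zero] at hc0
  have h1 := one_le_corner hpoly hbd (i := m + 1) (by omega)
  have h0 := one_le_corner hpoly hbd (i := m) (by omega)
  rw [hc1] at h1
  rcases corner_cases hpoly hT hbd (i := m) (by omega) (by omega) (by rw [hc0]; omega) with
    h | ⟨h, -⟩
  · have hl := hc.up (m - 1) (by omega)
    have hl' := hc.up m le_rfl
    have hne : c (m - 1) ≠ c (m + 1) := fun h' => by
      have := hpoly.index_eq (by omega) (by omega) h'
      omega
    have hne' : c (m - 1) ≠ c m := fun h' => by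
      have := hpoly.index_eq (by omega) (by omega) h'
      omega
    refine ⟨c (m - 1), ?_, ?_, by omega⟩
    · rw [show p = c m from hc0.symm]
      exact ⟨hne', _, (hT _ h).1, by simp, by simp⟩
    · rw [show q = c (m + 1) from hc1.symm]
      exact ⟨hne, _, (hT _ h).1, by simp, by simp⟩
  · rw [hc0] at h
    omega

/-- Two neighbours of `w` that are closer to `v` are adjacent. -/
theorem adj_of_common_neighbor (hD : IsDisc D) (hdeg : ∀ w, IsInterior D w → 6 ≤ degree D w)
    {v p q w : W} {k : ℕ} (hpq : p ≠ q)
    (hpw : (skeleton D.toPreAbstractSimplicialComplex).Adj p w)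
    (hwq : (skeleton D.toPreAbstractSimplicialComplex).Adj w q)
    (hp : (skeleton D.toPreAbstractSimplicialComplex).dist v p = k)
    (hq : (skeleton D.toPreAbstractSimplicialComplex).dist v q = k)
    (hw : (skeleton D.toPreAbstractSimplicialComplex).dist v w = k + 1) :
    (skeleton D.toPreAbstractSimplicialComplex).Adj p q := by
  let e : ℕ → W := fun i => if i = 0 then p else if i = 1 then w else q
  have he : Set.InjOn e (Set.Iic 2) := by
    intro i hi j hj hij
    rw [Set.mem_Iic] at hi hj
    have h1 := hpw.1
    have h2 := hwq.1
    interval_cases i <;> interval_cases j <;> simp_all [e]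
  have hLip : ∀ a b, (skeleton D.toPreAbstractSimplicialComplex).Adj a b → _ :=
    fun a b => dist_le_of_adj hD v (a := a) (b := b)
  obtain ⟨c, hc⟩ := exists_isBigon hD (e := e) (v := v) (r := 2) (by omega) hp hq (fun i hi => by
    interval_cases i
    · exact hpw
    · exact hwq)
  obtain ⟨m, c, T, hm, hc, hpoly, hT, hbd, hsum⟩ := hc.exists_corner_sum_le hD hdeg
    hLip (by omega) he (fun i h1 h2 => by
      obtain rfl : i = 1 := by omega
      have : (skeleton D.toPreAbstractSimplicialComplex).dist v (e 1) = k + 1 := hw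
      omega)
  rw [Finset.sum_range_succ, Finset.sum_range_succ, Finset.sum_range_succ,
    Finset.sum_range_zero] at hsum
  have hc0 : c m = e 0 := hc.mid 0 (by omega)
  have hc1 : c (m + 1) = e 1 := hc.mid 1 (by omega)
  have hc2 : c (m + 1 + 1) = e 2 := hc.mid 2 (by omega)
  have hl0 := hc.up (m - 1) (by omega)
  have hl1 := hc.down (m + 1 + 1 + 1) (by omega) (by omega)
  have hlw : (skeleton D.toPreAbstractSimplicialComplex).dist v (c (m + 1)) = k + 1 := by
    rw [hc1]; exact hw
  have hadj_of : ∀ {t : Finset W}, t ∈ T → ∀ {a b : W}, a ∈ t → b ∈ t → a ≠ b →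
      (skeleton D.toPreAbstractSimplicialComplex).Adj a b := fun ht _ _ ha hb hab =>
    ⟨hab, _, (hT _ ht).1, ha, hb⟩
  -- A single triangle at an end of the base would join w to a vertex two levels below it. With both
  -- end corners at least 2 and the sum at most 5, the middle corner is 1, which is the triangle p,
  -- w, q.
  have h0 : 2 ≤ (T.filter (c m ∈ ·)).card := by
    by_contra hlt
    rcases corner_cases hpoly hT hbd (i := m) (by omega) (by omega) (by omega) with h | ⟨h, -⟩
    · have := hLip _ _ (hadj_of h (a := c (m - 1)) (b := c (m + 1)) (by simp) (by simp)
        (fun h' => by rw [h'] at hl0; omega))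
      omega
    · omega
  have h2 : 2 ≤ (T.filter (c (m + 1 + 1) ∈ ·)).card := by
    by_contra hlt
    rcases corner_cases hpoly hT hbd (i := m + 1 + 1) (by omega) (by omega) (by omega) with
      h | ⟨h, -⟩
    · rw [Nat.add_sub_cancel] at h
      have := hLip _ _ (hadj_of h (a := c (m + 1 + 1 + 1)) (b := c (m + 1)) (by simp) (by simp)
        (fun h' => by rw [h'] at hl1; omega))
      omega
    · omega
  rw [hc0] at h0
  rw [hc2] at h2
  rcases corner_cases hpoly hT hbd (i := m + 1) (by omega) (by omega) (by rw [hc1]; omega) with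
    h | ⟨h, -⟩
  · rw [Nat.add_sub_cancel, hc0, hc2] at h
    exact hadj_of h (a := p) (b := q) (by simp [e]) (by simp [e]) hpq
  · rw [hc1] at h
    omega

end Levels

/-- A level function on a graph with the properties of the distance from a vertex in a disc whose
interior vertices have degree at least six. -/
structure IsLayering {W : Type*} (G : SimpleGraph W) (ℓ : W → ℕ) : Prop where
  le_succ : ∀ a b, G.Adj a b → ℓ b ≤ ℓ a + 1
  exists_down : ∀ w k, ℓ w = k + 1 → ∃ x, G.Adj w x ∧ ℓ x = k
  exists_common : ∀ p q k, G.Adj p q → ℓ p = k + 1 → ℓ q = k + 1 →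
    ∃ u, G.Adj p u ∧ G.Adj q u ∧ ℓ u = k
  adj_of_down : ∀ w p q k, p ≠ q → G.Adj w p → G.Adj w q → ℓ w = k + 1 → ℓ p = k → ℓ q = k →
    G.Adj p q

/-- The neighbours of `w` form an induced cycle `c`. -/
structure IsNeighborCycle {W : Type*} (G : SimpleGraph W) (w : W) (d : ℕ) (c : ZMod d → W) :
    Prop where
  inj : Function.Injective c
  adj_iff : ∀ x, G.Adj w x ↔ ∃ i, x = c i
  adj_adj : ∀ i j, G.Adj (c i) (c j) ↔ j = i + 1 ∨ i = j + 1

/-! ### Discs as layered graphs with cyclic neighbourhoods -/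

section Disc

variable {W : Type*} [DecidableEq W] [Fintype W] {D : AbstractSimplicialComplex W}

theorem isLayering_dist (hD : IsDisc D) (hdeg : ∀ w, IsInterior D w → 6 ≤ degree D w) (v : W) :
    IsLayering (skeleton D.toPreAbstractSimplicialComplex)
      ((skeleton D.toPreAbstractSimplicialComplex).dist v) where
  le_succ _ _ h := dist_le_of_adj hD v h
  exists_down w k h := by
    obtain ⟨x, h1, h2⟩ := exists_adj_dist hD h
    exact ⟨x, h1.symm, h2⟩
  exists_common p q k hpq hp hq := by
    obtain ⟨u, h1, h2, h3⟩ := exists_common_neighbor hD hdeg hpq hp hq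
    exact ⟨u, h1.symm, h2.symm, by omega⟩
  adj_of_down w p q k hpq hwp hwq hw hp hq :=
    adj_of_common_neighbor hD hdeg hpq hwp.symm hwq hp hq hw

/-- The link circle is an induced cycle of the graph: an edge between two neighbours of w completes
a 3-cycle, which is a face by `triangle_mem_faces`, hence an edge of the link. -/
theorem exists_isNeighborCycle (hD : IsDisc D) (hdeg : ∀ w, IsInterior D w → 6 ≤ degree D w)
    {w : W} (hw : IsInterior D w) :
    ∃ c, IsNeighborCycle (skeleton D.toPreAbstractSimplicialComplex) w (degree D w) c := by
  have hw' := hw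
  obtain ⟨d, c, h⟩ := hw
  have hd := hdeg w hw'
  rw [h.degree_eq] at hd ⊢
  refine ⟨c, h.2.1, fun x => h.adj_iff, fun i j => ?_⟩
  have hi := h.adj_iff.2 ⟨i, rfl⟩
  have hj := h.adj_iff.2 ⟨j, rfl⟩
  constructor
  · intro hij
    have := triangle_mem_faces hD hdeg hi hij hj.symm
    obtain ⟨m, ⟨h1, h2⟩ | ⟨h1, h2⟩⟩ := (h.tri_iff hij.1).1 ⟨hi.1, hj.1, this⟩
    · left; rw [h.2.1 h1, h.2.1 h2]
    · right; rw [h.2.1 h1, h.2.1 h2]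
  · intro hij
    have : Fact (1 < d) := ⟨by omega⟩
    have hne : c i ≠ c j := fun heq => by
      have := h.2.1 heq
      subst this
      rcases hij with h1 | h1 <;> simp at h1
    refine ⟨hne, {w, c i, c j}, ?_, by simp, by simp⟩
    refine ((h.tri_iff hne).2 ?_).2.2
    rcases hij with rfl | rfl
    · exact ⟨i, Or.inl ⟨rfl, rfl⟩⟩
    · exact ⟨j, Or.inr ⟨rfl, rfl⟩⟩

end Disc

/-! ### Levels around a single vertex -/

section Local

theorem zmod_small_ne_zero {d : ℕ} (hd : 6 ≤ d) :
    (1 : ZMod d) ≠ 0 ∧ (2 : ZMod d) ≠ 0 ∧ (3 : ZMod d) ≠ 0 ∧ (4 : ZMod d) ≠ 0 := by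
  have key : ∀ m : ℕ, 0 < m → m < 6 → ((m : ℕ) : ZMod d) ≠ 0 := fun m h1 h2 h => by
    rw [CharP.cast_eq_zero_iff (ZMod d) d] at h
    have := Nat.le_of_dvd h1 h
    omega
  exact ⟨by simpa using key 1 (by omega) (by omega), by simpa using key 2 (by omega) (by omega),
    by simpa using key 3 (by omega) (by omega), by simpa using key 4 (by omega) (by omega)⟩

variable {W : Type*} {G : SimpleGraph W} {ℓ : W → ℕ} {w : W} {d : ℕ} {c : ZMod d → W} {k : ℕ}

theorem IsNeighborCycle.adj (hc : IsNeighborCycle G w d c) (i : ZMod d) : G.Adj w (c i) :=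
  (hc.adj_iff _).2 ⟨i, rfl⟩

/-- The lower neighbours of `w` are one vertex or two consecutive vertices of the cycle of
neighbours. -/
theorem IsNeighborCycle.exists_down_eq (hG : IsLayering G ℓ) (hc : IsNeighborCycle G w d c)
    (hd : 6 ≤ d) (hw : ℓ w = k + 1) :
    ∃ i, (∀ j, ℓ (c j) = k ↔ j = i) ∨ (∀ j, ℓ (c j) = k ↔ j = i ∨ j = i + 1) := by
  obtain ⟨h1, h2, h3, h4⟩ := zmod_small_ne_zero hd
  obtain ⟨x, hx, hxk⟩ := hG.exists_down w k hw
  obtain ⟨i, rfl⟩ := (hc.adj_iff x).1 hx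
  -- Lower neighbours are pairwise adjacent, so consecutive on a cycle of length at least 6, which
  -- has room for at most two of them.
  have hcl : ∀ i j, ℓ (c i) = k → ℓ (c j) = k → j ≠ i → j = i + 1 ∨ i = j + 1 := fun i j hi hj hij =>
    (hc.adj_adj i j).1 (hG.adj_of_down w _ _ k (fun h => hij (hc.inj h).symm) (hc.adj i) (hc.adj j)
      hw hi hj)
  by_cases hs : ∃ j, ℓ (c j) = k ∧ j ≠ i
  · obtain ⟨j, hj, hji⟩ := hs
    have key : ∀ a b : ZMod d, b = a + 1 → ℓ (c a) = k → ℓ (c b) = k →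
        ∀ m, ℓ (c m) = k ↔ m = a ∨ m = a + 1 := by
      rintro a _ rfl ha hb m
      constructor
      · intro hm
        by_contra hne
        push Not at hne
        rcases hcl a m ha hm hne.1 with h | h
        · exact hne.2 h
        rcases hcl (a + 1) m hb hm hne.2 with h' | h'
        · exact h3 (by linear_combination -h - h')
        · exact h1 (by linear_combination h' - h)
      · rintro (rfl | rfl) <;> assumption
    rcases hcl i j hxk hj hji with h | h
    · exact ⟨i, Or.inr (key i j h hxk hj)⟩
    · exact ⟨j, Or.inr (key j i h hj hxk)⟩
  · push Not at hs
    exact ⟨i, Or.inl fun j => ⟨fun hj => hs j hj, fun h => h ▸ hxk⟩⟩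

theorem IsNeighborCycle.level_eq_of_adj (hG : IsLayering G ℓ) (hc : IsNeighborCycle G w d c)
    (hw : ℓ w = k + 1) {i j : ZMod d} (hi : ℓ (c i) = k) (hij : G.Adj (c i) (c j))
    (hj : ℓ (c j) ≠ k) : ℓ (c j) = k + 1 := by
  have h1 := hG.le_succ _ _ hij
  have h2 := hG.le_succ _ _ (hc.adj j).symm
  omega

/-- The neighbours of `w` on its own level are the two vertices next to the lower neighbours. -/
theorem IsNeighborCycle.exists_side_eq (hG : IsLayering G ℓ) (hc : IsNeighborCycle G w d c)
    (hd : 6 ≤ d) (hw : ℓ w = k + 1) :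
    ∃ i i', i ≠ i' ∧ ∀ j, ℓ (c j) = k + 1 ↔ j = i ∨ j = i' := by
  obtain ⟨h1, h2, h3, h4⟩ := zmod_small_ne_zero hd
  have hside : ∀ j, ℓ (c j) = k + 1 → ∃ m, ℓ (c m) = k ∧ (m = j + 1 ∨ j = m + 1) := by
    intro j hj
    obtain ⟨u, hu1, hu2, hu⟩ := hG.exists_common w (c j) k (hc.adj j) hw hj
    obtain ⟨m, rfl⟩ := (hc.adj_iff u).1 hu1
    exact ⟨m, hu, (hc.adj_adj j m).1 hu2⟩
  obtain ⟨i, hi | hi⟩ := hc.exists_down_eq hG hd hw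
  · refine ⟨i - 1, i + 1, fun h => h2 (by linear_combination -h), fun j => ⟨fun hj => ?_, ?_⟩⟩
    · obtain ⟨m, hm, hmj⟩ := hside j hj
      rw [hi] at hm
      subst hm
      rcases hmj with h | h
      · left; linear_combination -h
      · right; exact h
    · rintro (rfl | rfl)
      · refine hc.level_eq_of_adj hG hw ((hi i).2 rfl) ((hc.adj_adj _ _).2 (Or.inr (by ring))) ?_
        rw [Ne, hi]
        exact fun h => h1 (by linear_combination -h)
      · refine hc.level_eq_of_adj hG hw ((hi i).2 rfl) ((hc.adj_adj _ _).2 (Or.inl rfl)) ?_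
        rw [Ne, hi]
        exact fun h => h1 (by linear_combination h)
  · refine ⟨i - 1, i + 2, fun h => h3 (by linear_combination -h), fun j => ⟨fun hj => ?_, ?_⟩⟩
    · obtain ⟨m, hm, hmj⟩ := hside j hj
      have hjk : ¬ (j = i ∨ j = i + 1) := by
        rw [← hi, hj]
        omega
      rw [hi] at hm
      rcases hm with rfl | rfl <;> rcases hmj with h | h
      · left; linear_combination -h
      · exact (hjk (Or.inr h)).elim
      · exact (hjk (Or.inl (by linear_combination -h))).elim
      · right; linear_combination h
    · rintro (rfl | rfl)
      · refine hc.level_eq_of_adj hG hw ((hi i).2 (Or.inl rfl))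
          ((hc.adj_adj _ _).2 (Or.inr (by ring))) ?_
        rw [Ne, hi]
        rintro (h | h)
        · exact h1 (by linear_combination -h)
        · exact h2 (by linear_combination -h)
      · refine hc.level_eq_of_adj hG hw ((hi (i + 1)).2 (Or.inr rfl))
          ((hc.adj_adj _ _).2 (Or.inl (by ring))) ?_
        rw [Ne, hi]
        rintro (h | h)
        · exact h2 (by linear_combination h)
        · exact h1 (by linear_combination h)

/-- An edge on a level has exactly one upper common neighbour. -/
theorem IsNeighborCycle.existsUnique_up (hG : IsLayering G ℓ) (hc : IsNeighborCycle G w d c)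
    (hd : 6 ≤ d) (hw : ℓ w = k + 1) {x : W} (hwx : G.Adj w x) (hx : ℓ x = k + 1) :
    ∃! u, G.Adj w u ∧ G.Adj x u ∧ ℓ u = k + 2 := by
  obtain ⟨h1, h2, h3, h4⟩ := zmod_small_ne_zero hd
  obtain ⟨j, rfl⟩ := (hc.adj_iff x).1 hwx
  obtain ⟨u, hu1, hu2, hu⟩ := hG.exists_common w (c j) k hwx hw hx
  obtain ⟨m, rfl⟩ := (hc.adj_iff u).1 hu1
  have hdown : ∀ a b, ℓ (c a) = k → ℓ (c b) = k → b ≠ a → b = a + 1 ∨ a = b + 1 :=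
    fun a b ha hb hab => (hc.adj_adj a b).1 (hG.adj_of_down w _ _ k
      (fun h => hab (hc.inj h).symm) (hc.adj a) (hc.adj b) hw ha hb)
  have hside : ∀ j, ℓ (c j) = k + 1 → ∃ m, ℓ (c m) = k ∧ (m = j + 1 ∨ j = m + 1) := by
    intro j hj
    obtain ⟨u, hu1, hu2, hu⟩ := hG.exists_common w (c j) k (hc.adj j) hw hj
    obtain ⟨m, rfl⟩ := (hc.adj_iff u).1 hu1
    exact ⟨m, hu, (hc.adj_adj j m).1 hu2⟩
  -- `m` and `2 * j - m` are the two neighbours of `j` in the cycle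
  have hm : m = j + 1 ∨ m = j - 1 := by
    rcases (hc.adj_adj j m).1 hu2 with h | h
    · exact Or.inl h
    · right; linear_combination -h
  have hother : ∀ n, G.Adj (c j) (c n) ↔ n = m ∨ n = 2 * j - m := by
    intro n
    rw [hc.adj_adj]
    rcases hm with rfl | rfl
    · refine or_congr Iff.rfl ⟨fun h => by linear_combination -h, fun h => by linear_combination -h⟩
    · rw [or_comm]
      refine or_congr ⟨fun h => by linear_combination -h, fun h => by linear_combination -h⟩
        ⟨fun h => by linear_combination h, fun h => by linear_combination h⟩
  have hle : ℓ (c (2 * j - m)) ≤ k + 2 := by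
    have := hG.le_succ _ _ (hc.adj (2 * j - m))
    omega
  have hge : k ≤ ℓ (c (2 * j - m)) := by
    have := hG.le_succ _ _ (hc.adj (2 * j - m)).symm
    omega
  -- Otherwise two lower neighbours of w would be at cyclic distance two.
  have hne0 : ℓ (c (2 * j - m)) ≠ k := by
    intro h0
    rcases hm with rfl | rfl
    · rcases hdown _ _ hu h0 (fun h => h2 (by linear_combination -h)) with h | h
      · exact h3 (by linear_combination -h)
      · exact h1 (by linear_combination h)
    · rcases hdown _ _ hu h0 (fun h => h2 (by linear_combination h)) with h | h
      · exact h1 (by linear_combination h)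
      · exact h3 (by linear_combination -h)
  -- Otherwise a lower neighbour n would lie just beyond 2j - m, at offset three from the lower
  -- neighbour m; two lower neighbours must be consecutive.
  have hne1 : ℓ (c (2 * j - m)) ≠ k + 1 := by
    intro h0
    obtain ⟨n, hn, hnj⟩ := hside _ h0
    have hnj' : n = 2 * j - m + 1 ∨ n = 2 * j - m - 1 := by
      rcases hnj with h | h
      · exact Or.inl h
      · right; linear_combination -h
    have hnj2 : n ≠ j := fun h => by
      rw [h, hx] at hn
      omega
    rcases hm with rfl | rfl <;> rcases hnj' with rfl | rfl
    · exact hnj2 (by ring)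
    · rcases hdown _ _ hu hn (fun h => h3 (by linear_combination -h)) with h | h
      · exact h4 (by linear_combination -h)
      · exact h2 (by linear_combination h)
    · rcases hdown _ _ hu hn (fun h => h3 (by linear_combination h)) with h | h
      · exact h2 (by linear_combination h)
      · exact h4 (by linear_combination -h)
    · exact hnj2 (by ring)
  refine ⟨c (2 * j - m), ⟨hc.adj _, (hother _).2 (Or.inr rfl), by omega⟩, ?_⟩
  rintro y ⟨hy1, hy2, hy3⟩
  obtain ⟨n, rfl⟩ := (hc.adj_iff y).1 hy1
  rcases (hother n).1 hy2 with rfl | rfl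
  · omega
  · rfl

end Local

/-! ### Numbers of lower, level and upper neighbours -/

section LocalCounts

open scoped Classical in
/-- The number of neighbours of `w` at level `k`. -/
noncomputable def levelDegree {W : Type*} [Fintype W] (G : SimpleGraph W) (ℓ : W → ℕ) (k : ℕ)
    (w : W) : ℕ :=
  (Finset.univ.filter fun x => G.Adj w x ∧ ℓ x = k).card

variable {W : Type*} [Fintype W] {G : SimpleGraph W} {ℓ : W → ℕ} {w : W} {d : ℕ} {c : ZMod d → W}
  {k : ℕ}

theorem IsNeighborCycle.levelDegree_eq (hc : IsNeighborCycle G w d c) {s : Finset (ZMod d)}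
    (hs : ∀ j, ℓ (c j) = k ↔ j ∈ s) : levelDegree G ℓ k w = s.card := by
  classical
  rw [levelDegree, ← Finset.card_image_of_injective s hc.inj]
  congr 1
  ext x
  simp only [Finset.mem_filter, Finset.mem_univ, true_and, Finset.mem_image, hc.adj_iff]
  constructor
  · rintro ⟨⟨i, rfl⟩, h⟩
    exact ⟨i, (hs i).1 h, rfl⟩
  · rintro ⟨i, hi, rfl⟩
    exact ⟨⟨i, rfl⟩, (hs i).2 hi⟩

theorem IsNeighborCycle.levelDegree_down (hG : IsLayering G ℓ) (hc : IsNeighborCycle G w d c)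
    (hd : 6 ≤ d) (hw : ℓ w = k + 1) : levelDegree G ℓ k w = 1 ∨ levelDegree G ℓ k w = 2 := by
  obtain ⟨i, hi | hi⟩ := hc.exists_down_eq hG hd hw
  · left
    rw [hc.levelDegree_eq (s := {i}) (by simpa using hi), Finset.card_singleton]
  · right
    rw [hc.levelDegree_eq (s := {i, i + 1}) (by simpa using hi), Finset.card_pair]
    intro h
    exact (zmod_small_ne_zero hd).1 (by linear_combination -h)

theorem IsNeighborCycle.levelDegree_side (hG : IsLayering G ℓ) (hc : IsNeighborCycle G w d c)
    (hd : 6 ≤ d) (hw : ℓ w = k + 1) : levelDegree G ℓ (k + 1) w = 2 := by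
  obtain ⟨i, i', hne, hi⟩ := hc.exists_side_eq hG hd hw
  rw [hc.levelDegree_eq (s := {i, i'}) (by simpa using hi), Finset.card_pair hne]

theorem IsNeighborCycle.levelDegree_add (hG : IsLayering G ℓ) (hc : IsNeighborCycle G w d c)
    (hd : 6 ≤ d) (hw : ℓ w = k + 1) :
    levelDegree G ℓ k w + levelDegree G ℓ (k + 1) w + levelDegree G ℓ (k + 2) w = d := by
  classical
  have : NeZero d := ⟨by omega⟩
  rw [hc.levelDegree_eq (k := k) (s := Finset.univ.filter fun j => ℓ (c j) = k) (by simp),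
    hc.levelDegree_eq (k := k + 1) (s := Finset.univ.filter fun j => ℓ (c j) = k + 1) (by simp),
    hc.levelDegree_eq (k := k + 2) (s := Finset.univ.filter fun j => ℓ (c j) = k + 2) (by simp),
    ← Finset.card_union_of_disjoint, ← Finset.card_union_of_disjoint]
  · have : (Finset.univ.filter fun j => ℓ (c j) = k) ∪ (Finset.univ.filter fun j => ℓ (c j) = k + 1) ∪
        (Finset.univ.filter fun j => ℓ (c j) = k + 2) = Finset.univ := by
      ext j
      have h1 := hG.le_succ _ _ (hc.adj j)
      have h2 := hG.le_succ _ _ (hc.adj j).symm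
      simp only [Finset.mem_union, Finset.mem_filter, Finset.mem_univ, true_and, iff_true]
      omega
    rw [this, Finset.card_univ, ZMod.card]
  · rw [Finset.disjoint_left]
    intro j
    simp only [Finset.mem_union, Finset.mem_filter, Finset.mem_univ, true_and]
    omega
  · rw [Finset.disjoint_left]
    intro j
    simp only [Finset.mem_filter, Finset.mem_univ, true_and]
    omega

end LocalCounts

/-! ### Double counting between spheres and the recurrence -/

section Counting

variable {W : Type*} [Fintype W] {G : SimpleGraph W} {ℓ : W → ℕ}

open scoped Classical in
/-- The vertices at level `k` that satisfy `Q`. -/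
noncomputable def layer (ℓ : W → ℕ) (Q : W → Prop) (k : ℕ) : Finset W :=
  Finset.univ.filter fun w => ℓ w = k ∧ Q w

open scoped Classical in
/-- The number of neighbours of `w` at level `k` that satisfy `Q`. -/
noncomputable def nbrCount (G : SimpleGraph W) (ℓ : W → ℕ) (Q : W → Prop) (k : ℕ) (w : W) : ℕ :=
  (Finset.univ.filter fun x => G.Adj w x ∧ ℓ x = k ∧ Q x).card

theorem mem_layer {Q : W → Prop} {k : ℕ} {w : W} : w ∈ layer ℓ Q k ↔ ℓ w = k ∧ Q w := by
  simp [layer]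

theorem sum_nbrCount_comm (Q R : W → Prop) (k l : ℕ) :
    ∑ w ∈ layer ℓ Q k, nbrCount G ℓ R l w = ∑ x ∈ layer ℓ R l, nbrCount G ℓ Q k x := by
  classical
  have h := sum_card_filter_comm (layer ℓ Q k) (layer ℓ R l) G.Adj
  convert h using 2
  · rw [nbrCount, layer, Finset.filter_filter]
    congr 1
    ext x
    simp only [Finset.mem_filter, Finset.mem_univ, true_and]
    tauto
  · rw [nbrCount, layer, Finset.filter_filter]
    congr 1
    ext x
    simp only [Finset.mem_filter, Finset.mem_univ, true_and, G.adj_comm]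
    tauto

theorem nbrCount_add_not (Q : W → Prop) (k : ℕ) (w : W) :
    nbrCount G ℓ Q k w + nbrCount G ℓ (fun x => ¬ Q x) k w = levelDegree G ℓ k w := by
  classical
  rw [nbrCount, nbrCount, levelDegree,
    ← Finset.card_filter_add_card_filter_not
      (s := Finset.univ.filter fun x => G.Adj w x ∧ ℓ x = k) (p := Q),
    Finset.filter_filter, Finset.filter_filter]
  simp only [and_assoc]
  congr!

theorem nbrCount_eq_levelDegree {Q : W → Prop} {k : ℕ} {w : W}
    (h : ∀ x, G.Adj w x → ℓ x = k → Q x) : nbrCount G ℓ Q k w = levelDegree G ℓ k w := by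
  classical
  rw [nbrCount, levelDegree]
  congr 1
  ext x
  simp only [Finset.mem_filter, Finset.mem_univ, true_and]
  exact ⟨fun hx => ⟨hx.1, hx.2.1⟩, fun hx => ⟨hx.1, hx.2, h x hx.1 hx.2⟩⟩

theorem sum_layer_true {M : Type*} [AddCommMonoid M] (Q : W → Prop) (k : ℕ) (f : W → M) :
    ∑ w ∈ layer ℓ (fun _ => True) k, f w =
      ∑ w ∈ layer ℓ Q k, f w + ∑ w ∈ layer ℓ (fun w => ¬ Q w) k, f w := by
  classical
  rw [← Finset.sum_filter_add_sum_filter_not _ Q]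
  simp only [layer, Finset.filter_filter, and_true]

/-- Double counting of the triangles with two vertices at level `k + 1` and one at level
`k + 2`. -/
theorem sum_levelDegree_layer (hG : IsLayering G ℓ) {k : ℕ} {Q R : W → Prop}
    (hcyc : ∀ w, ℓ w = k + 1 ∨ ℓ w = k + 2 → ∃ d c, 6 ≤ d ∧ IsNeighborCycle G w d c)
    (hQR : ∀ w x u, ℓ w = k + 1 → ℓ u = k + 2 → Q w → Q x → G.Adj w x → G.Adj w u → G.Adj x u →
      R u)
    (hRQ : ∀ u w, ℓ u = k + 2 → ℓ w = k + 1 → R u → G.Adj u w → Q w) :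
    2 * ∑ u ∈ layer ℓ R (k + 2), levelDegree G ℓ (k + 1) u =
      2 * (layer ℓ R (k + 2)).card + ∑ w ∈ layer ℓ Q (k + 1), nbrCount G ℓ Q (k + 1) w := by
  classical
  -- Ordered pairs are used: each edge of the sphere between `Q`-vertices appears twice.
  let E : Finset (Σ _ : W, W) := (layer ℓ Q (k + 1)).sigma
    fun w => Finset.univ.filter fun x => G.Adj w x ∧ ℓ x = k + 1 ∧ Q x
  have hE : E.card = ∑ w ∈ layer ℓ Q (k + 1), nbrCount G ℓ Q (k + 1) w :=
    Finset.card_sigma _ _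
  have hcomm := sum_card_filter_comm E (layer ℓ R (k + 2)) (fun e u => G.Adj e.1 u ∧ G.Adj e.2 u)
  have h1 : ∀ e ∈ E, ((layer ℓ R (k + 2)).filter fun u => G.Adj e.1 u ∧ G.Adj e.2 u).card = 1 := by
    rintro ⟨w, x⟩ he
    simp only [E, Finset.mem_sigma, mem_layer, Finset.mem_filter, Finset.mem_univ, true_and] at he
    obtain ⟨⟨hw, hQw⟩, hwx, hx, hQx⟩ := he
    obtain ⟨d, c, hd, hc⟩ := hcyc w (Or.inl hw)
    obtain ⟨u, ⟨hu1, hu2, hu3⟩, huniq⟩ := hc.existsUnique_up hG hd hw hwx hx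
    rw [Finset.card_eq_one]
    refine ⟨u, ?_⟩
    ext y
    simp only [Finset.mem_filter, mem_layer, Finset.mem_singleton]
    constructor
    · rintro ⟨⟨h1, -⟩, h2, h3⟩
      exact huniq y ⟨h2, h3, h1⟩
    · rintro rfl
      exact ⟨⟨hu3, hQR w x y hw hu3 hQw hQx hwx hu1 hu2⟩, hu1, hu2⟩
  -- A vertex u with δ lower neighbours lies above δ(δ - 1) ordered pairs; for δ = 1, 2 this equals
  -- 2δ - 2.
  have h2 : ∀ u ∈ layer ℓ R (k + 2), 2 * levelDegree G ℓ (k + 1) u =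
      2 + (E.filter fun e => G.Adj e.1 u ∧ G.Adj e.2 u).card := by
    intro u hu
    rw [mem_layer] at hu
    obtain ⟨hu, hRu⟩ := hu
    obtain ⟨d, c, hd, hc⟩ := hcyc u (Or.inr hu)
    have hδ := hc.levelDegree_down hG hd hu
    have hfil : E.filter (fun e => G.Adj e.1 u ∧ G.Adj e.2 u) =
        (Finset.univ.filter fun x => G.Adj u x ∧ ℓ x = k + 1).offDiag.image
          (fun p => (⟨p.1, p.2⟩ : Σ _ : W, W)) := by
      ext ⟨w, x⟩
      simp only [E, Finset.mem_filter, Finset.mem_sigma, mem_layer, Finset.mem_univ, true_and,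
        Finset.mem_image, Finset.mem_offDiag, Prod.exists, Sigma.mk.injEq, heq_eq_eq]
      constructor
      · rintro ⟨⟨⟨hw, -⟩, hwx, hx, -⟩, hwu, hxu⟩
        exact ⟨w, x, ⟨⟨hwu.symm, hw⟩, ⟨hxu.symm, hx⟩, hwx.ne⟩, rfl, rfl⟩
      · rintro ⟨w, x, ⟨⟨hwu, hw⟩, ⟨hxu, hx⟩, hne⟩, rfl, rfl⟩
        exact ⟨⟨⟨hw, hRQ u w hu hw hRu hwu⟩, hG.adj_of_down u w x (k + 1) hne hwu hxu hu hw hx, hx,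
          hRQ u x hu hx hRu hxu⟩, hwu.symm, hxu.symm⟩
    rw [hfil, Finset.card_image_of_injective, Finset.offDiag_card]
    · change 2 * levelDegree G ℓ (k + 1) u = 2 + (levelDegree G ℓ (k + 1) u *
        levelDegree G ℓ (k + 1) u - levelDegree G ℓ (k + 1) u)
      rcases hδ with h | h <;> rw [h]
    · rintro ⟨a, b⟩ ⟨a', b'⟩ h
      simpa using h
  rw [Finset.sum_congr rfl h1, Finset.sum_const, smul_eq_mul, mul_one] at hcomm
  rw [Finset.mul_sum, Finset.sum_congr rfl h2, Finset.sum_add_distrib, Finset.sum_const,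
    smul_eq_mul, ← hE, hcomm, mul_comm]

/-- The pattern of `s`-vertices (those satisfying `P`) and `t`-vertices on the levels below `n`. -/
structure IsTypedLayering (G : SimpleGraph W) (ℓ : W → ℕ) (P : W → Prop) (s t n : ℕ) : Prop
    extends IsLayering G ℓ where
  cycle_s : ∀ w, ℓ w < n → P w → ∃ c, IsNeighborCycle G w s c
  cycle_t : ∀ w, ℓ w < n → ¬ P w → ∃ c, IsNeighborCycle G w t c
  not_s : ∀ w x, ℓ w < n → ℓ x < n → P w → G.Adj w x → ¬ P x
  two_mul_card : ∀ w, ℓ w + 1 < n → ¬ P w → 2 * {x | G.Adj w x ∧ P x}.ncard = t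
  triangle : ∀ w x u, ℓ w + 1 < n → ¬ P w → ¬ P x → G.Adj w x → G.Adj w u → G.Adj x u → P u

namespace IsTypedLayering

theorem exists_cycle {W : Type*} {G : SimpleGraph W} {ℓ : W → ℕ} {P : W → Prop} {s t n : ℕ}
    (h : IsTypedLayering G ℓ P s t n) (hs : 6 ≤ s) (ht : 6 ≤ t) {w : W}
    (hw : ℓ w < n) : ∃ d c, 6 ≤ d ∧ IsNeighborCycle G w d c := by
  by_cases hP : P w
  · obtain ⟨c, hc⟩ := h.cycle_s w hw hP
    exact ⟨s, c, hs, hc⟩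
  · obtain ⟨c, hc⟩ := h.cycle_t w hw hP
    exact ⟨t, c, ht, hc⟩

variable {P : W → Prop} {s t n k : ℕ}

/-- The degree of an s-vertex splits into lower neighbours, two on its sphere, and upper ones. The
upper ones are t-vertices, so they are counted from above. -/
theorem sum_s_degree (h : IsTypedLayering G ℓ P s t n) (hs : 6 ≤ s) (hk : k + 2 < n) :
    s * (layer ℓ P (k + 1)).card = ∑ w ∈ layer ℓ P (k + 1), levelDegree G ℓ k w +
      2 * (layer ℓ P (k + 1)).card +
      ∑ w ∈ layer ℓ (fun x => ¬ P x) (k + 2), nbrCount G ℓ P (k + 1) w := by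
  have h1 : ∀ w ∈ layer ℓ P (k + 1), levelDegree G ℓ k w + 2 +
      nbrCount G ℓ (fun x => ¬ P x) (k + 2) w = s := by
    intro w hw
    rw [mem_layer] at hw
    obtain ⟨c, hc⟩ := h.cycle_s w (by omega) hw.2
    have h1 := hc.levelDegree_add h.toIsLayering hs hw.1
    have h2 := hc.levelDegree_side h.toIsLayering hs hw.1
    have h3 := nbrCount_eq_levelDegree (G := G) (ℓ := ℓ) (Q := fun x => ¬ P x) (k := k + 2) (w := w)
      fun x hx hxk => h.not_s w x (by omega) (by omega) hw.2 hx
    omega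
  have h2 := Finset.sum_congr rfl h1
  rw [Finset.sum_add_distrib, Finset.sum_add_distrib, Finset.sum_const, Finset.sum_const,
    smul_eq_mul, smul_eq_mul, sum_nbrCount_comm] at h2
  linarith

theorem sum_side (h : IsTypedLayering G ℓ P s t n) (hs : 6 ≤ s) (hk : k + 1 < n) :
    ∑ w ∈ layer ℓ (fun x => ¬ P x) (k + 1), nbrCount G ℓ P (k + 1) w =
      2 * (layer ℓ P (k + 1)).card := by
  rw [sum_nbrCount_comm, mul_comm, ← smul_eq_mul, ← Finset.sum_const]
  refine Finset.sum_congr rfl fun w hw => ?_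
  rw [mem_layer] at hw
  obtain ⟨c, hc⟩ := h.cycle_s w (by omega) hw.2
  rw [nbrCount_eq_levelDegree, hc.levelDegree_side h.toIsLayering hs hw.1]
  exact fun x hx hxk => h.not_s w x (by omega) (by omega) hw.2 hx

theorem sum_s_up (h : IsTypedLayering G ℓ P s t n) (hk : k + 2 < n) :
    ∑ w ∈ layer ℓ (fun x => ¬ P x) (k + 1), nbrCount G ℓ P (k + 2) w =
      ∑ w ∈ layer ℓ P (k + 2), levelDegree G ℓ (k + 1) w := by
  rw [sum_nbrCount_comm]
  refine Finset.sum_congr rfl fun w hw => nbrCount_eq_levelDegree fun x hx hxk => ?_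
  rw [mem_layer] at hw
  exact h.not_s w x (by omega) (by omega) hw.2 hx

/-- The same splitting for t-vertices. Upper edges are counted from level k + 2, where the lower
edges of t-vertices that lead to s-vertices must be taken out; these form the extra sum on the left.
-/
theorem sum_t_degree (h : IsTypedLayering G ℓ P s t n) (ht : 6 ≤ t)
    (hk : k + 2 < n) :
    t * (layer ℓ (fun x => ¬ P x) (k + 1)).card +
      ∑ w ∈ layer ℓ (fun x => ¬ P x) (k + 2), nbrCount G ℓ P (k + 1) w =
      ∑ w ∈ layer ℓ (fun x => ¬ P x) (k + 1), levelDegree G ℓ k w +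
      2 * (layer ℓ (fun x => ¬ P x) (k + 1)).card +
      (∑ w ∈ layer ℓ P (k + 2), levelDegree G ℓ (k + 1) w +
       ∑ w ∈ layer ℓ (fun x => ¬ P x) (k + 2), levelDegree G ℓ (k + 1) w) := by
  have h1 : ∀ w ∈ layer ℓ (fun x => ¬ P x) (k + 1), levelDegree G ℓ k w + 2 +
      (nbrCount G ℓ P (k + 2) w + nbrCount G ℓ (fun x => ¬ P x) (k + 2) w) = t := by
    intro w hw
    rw [mem_layer] at hw
    obtain ⟨c, hc⟩ := h.cycle_t w (by omega) hw.2
    have h1 := hc.levelDegree_add h.toIsLayering ht hw.1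
    have h2 := hc.levelDegree_side h.toIsLayering ht hw.1
    rw [nbrCount_add_not]
    omega
  have h2 := Finset.sum_congr rfl h1
  rw [Finset.sum_add_distrib, Finset.sum_add_distrib, Finset.sum_add_distrib, Finset.sum_const,
    Finset.sum_const, smul_eq_mul, smul_eq_mul, h.sum_s_up hk, sum_nbrCount_comm] at h2
  have h3 : ∑ w ∈ layer ℓ (fun x => ¬ P x) (k + 2), levelDegree G ℓ (k + 1) w =
      ∑ w ∈ layer ℓ (fun x => ¬ P x) (k + 2), nbrCount G ℓ P (k + 1) w +
      ∑ w ∈ layer ℓ (fun x => ¬ P x) (k + 2), nbrCount G ℓ (fun x => ¬ P x) (k + 1) w := by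
    rw [← Finset.sum_add_distrib]
    exact Finset.sum_congr rfl fun w _ => (nbrCount_add_not _ _ _).symm
  linarith

/-- Half of the t neighbours of a t-vertex are s-vertices; they are sorted by level. -/
theorem sum_t_s_neighbors (h : IsTypedLayering G ℓ P s t n) (hs : 6 ≤ s) (hk : k + 2 < n) :
    t * (layer ℓ (fun x => ¬ P x) (k + 1)).card =
      2 * (∑ w ∈ layer ℓ (fun x => ¬ P x) (k + 1), nbrCount G ℓ P k w +
        2 * (layer ℓ P (k + 1)).card + ∑ w ∈ layer ℓ P (k + 2), levelDegree G ℓ (k + 1) w) := by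
  classical
  have h1 : ∀ w ∈ layer ℓ (fun x => ¬ P x) (k + 1), 2 * (nbrCount G ℓ P k w +
      nbrCount G ℓ P (k + 1) w + nbrCount G ℓ P (k + 2) w) = t := by
    intro w hw
    rw [mem_layer] at hw
    have h1 := h.two_mul_card w (by omega) hw.2
    rw [Set.ncard_eq_toFinset_card'] at h1
    rw [← h1, nbrCount, nbrCount, nbrCount, ← Finset.card_union_of_disjoint,
      ← Finset.card_union_of_disjoint]
    · congr 2
      ext x
      simp only [Finset.mem_union, Finset.mem_filter, Finset.mem_univ, true_and,
        Set.mem_toFinset, Set.mem_ofPred_eq]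
      constructor
      · rintro ((h | h) | h) <;> exact ⟨h.1, h.2.2⟩
      · rintro ⟨h1, h2⟩
        have l1 := h.le_succ _ _ h1
        have l2 := h.le_succ _ _ h1.symm
        have : ℓ x = k ∨ ℓ x = k + 1 ∨ ℓ x = k + 2 := by omega
        tauto
    · rw [Finset.disjoint_left]
      intro j
      simp only [Finset.mem_union, Finset.mem_filter, Finset.mem_univ, true_and]
      omega
    · rw [Finset.disjoint_left]
      intro j
      simp only [Finset.mem_filter, Finset.mem_univ, true_and]
      omega
  have h2 := Finset.sum_congr rfl h1
  rw [← Finset.mul_sum, Finset.sum_add_distrib, Finset.sum_add_distrib, Finset.sum_const,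
    smul_eq_mul, h.sum_side hs (by omega), h.sum_s_up hk] at h2
  linarith

/-- An s-vertex with two lower neighbours caps an edge joining two t-vertices, and every such edge
is capped by an s-vertex. The sphere is 2-regular without edges between s-vertices, so with a
s-vertices and b t-vertices it has b - a such edges. -/
theorem sum_levelDegree_s (h : IsTypedLayering G ℓ P s t n) (hs : 6 ≤ s) (ht : 6 ≤ t)
    (hk : k + 2 < n) :
    ∑ w ∈ layer ℓ P (k + 2), levelDegree G ℓ (k + 1) w + (layer ℓ P (k + 1)).card =
      (layer ℓ P (k + 2)).card + (layer ℓ (fun x => ¬ P x) (k + 1)).card := by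
  have h1 := sum_levelDegree_layer (k := k) (Q := fun x => ¬ P x) (R := P) h.toIsLayering
    (fun w hw => h.exists_cycle hs ht (by omega))
    (fun w x u hw hu hPw hPx => h.triangle w x u (by omega) hPw hPx)
    (fun u w hu hw hPu => h.not_s u w (by omega) (by omega) hPu)
  have h2 : ∀ w ∈ layer ℓ (fun x => ¬ P x) (k + 1), nbrCount G ℓ P (k + 1) w +
      nbrCount G ℓ (fun x => ¬ P x) (k + 1) w = 2 := by
    intro w hw
    rw [mem_layer] at hw
    obtain ⟨c, hc⟩ := h.cycle_t w (by omega) hw.2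
    rw [nbrCount_add_not, hc.levelDegree_side h.toIsLayering ht hw.1]
  have h3 := Finset.sum_congr rfl h2
  rw [Finset.sum_add_distrib, Finset.sum_const, smul_eq_mul, h.sum_side hs (by omega)] at h3
  omega

/-- The same count without types: a 2-regular sphere has as many edges as vertices. -/
theorem sum_levelDegree_all (h : IsTypedLayering G ℓ P s t n) (hs : 6 ≤ s) (ht : 6 ≤ t)
    (hk : k + 2 < n) :
    ∑ w ∈ layer ℓ P (k + 2), levelDegree G ℓ (k + 1) w +
      ∑ w ∈ layer ℓ (fun x => ¬ P x) (k + 2), levelDegree G ℓ (k + 1) w =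
      (layer ℓ P (k + 2)).card + (layer ℓ (fun x => ¬ P x) (k + 2)).card +
      ((layer ℓ P (k + 1)).card + (layer ℓ (fun x => ¬ P x) (k + 1)).card) := by
  have h1 := sum_levelDegree_layer (k := k) (Q := fun _ => True) (R := fun _ => True)
    h.toIsLayering (fun w hw => h.exists_cycle hs ht (by omega))
    (fun _ _ _ _ _ _ _ _ _ _ => trivial) (fun _ _ _ _ _ _ => trivial)
  have h2 : ∀ w ∈ layer ℓ (fun _ => True) (k + 1), nbrCount G ℓ (fun _ => True) (k + 1) w = 2 := by
    intro w hw
    rw [mem_layer] at hw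
    obtain ⟨d, c, hd, hc⟩ := h.exists_cycle hs ht (w := w) (by omega)
    rw [nbrCount_eq_levelDegree fun _ _ _ => trivial, hc.levelDegree_side h.toIsLayering hd hw.1]
  have hcard : ∀ m, (layer ℓ (fun _ => True) m).card =
      (layer ℓ P m).card + (layer ℓ (fun x => ¬ P x) m).card := fun m => by
    simp only [Finset.card_eq_sum_ones]
    exact sum_layer_true P m _
  rw [Finset.sum_congr rfl h2, Finset.sum_const, smul_eq_mul, hcard, hcard,
    sum_layer_true P] at h1
  omega

variable {v : W}

/-- The base case is separate because the centre is not a sphere with two neighbours per vertex: its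
s neighbours are all t-vertices with the single lower neighbour v. -/
theorem first_layer (h : IsTypedLayering G ℓ P s t n) (hv : ∀ w, ℓ w = 0 ↔ w = v) (hPv : P v)
    (hn : 1 < n) :
    (layer ℓ P 1).card = 0 ∧ (layer ℓ (fun x => ¬ P x) 1).card = s ∧
    ∑ w ∈ layer ℓ (fun x => ¬ P x) 1, levelDegree G ℓ 0 w = s ∧
    ∑ w ∈ layer ℓ (fun x => ¬ P x) 1, nbrCount G ℓ P 0 w = s := by
  classical
  have hv0 : ℓ v = 0 := (hv v).2 rfl
  have hadj : ∀ w, ℓ w = 1 ↔ G.Adj v w := by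
    intro w
    constructor
    · intro hw
      obtain ⟨x, hx, hx0⟩ := h.exists_down w 0 hw
      rw [hv] at hx0
      subst hx0
      exact hx.symm
    · intro hw
      have h1 := h.le_succ _ _ hw
      have h2 : ℓ w ≠ 0 := fun h0 => hw.ne ((hv w).1 h0).symm
      omega
  have hnP : ∀ w, ℓ w = 1 → ¬ P w := fun w hw =>
    h.not_s v w (by omega) (by omega) hPv ((hadj w).1 hw)
  have hb : (layer ℓ (fun x => ¬ P x) 1).card = s := by
    obtain ⟨c, hc⟩ := h.cycle_s v (by omega) hPv
    have : ((layer ℓ (fun x => ¬ P x) 1 : Finset W) : Set W) = Set.range c := by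
      ext w
      simp only [Finset.mem_coe, mem_layer, Set.mem_range]
      constructor
      · rintro ⟨h1, -⟩
        obtain ⟨i, hi⟩ := (hc.adj_iff w).1 ((hadj w).1 h1)
        exact ⟨i, hi.symm⟩
      · rintro ⟨i, rfl⟩
        have := (hadj _).2 (hc.adj i)
        exact ⟨this, hnP _ this⟩
    rw [← Set.ncard_coe_finset, this, ← Set.image_univ, Set.ncard_image_of_injective _ hc.inj,
      Set.ncard_univ, Nat.card_zmod]
  have hone : ∀ w ∈ layer ℓ (fun x => ¬ P x) 1, levelDegree G ℓ 0 w = 1 := by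
    intro w hw
    rw [mem_layer] at hw
    rw [levelDegree, Finset.card_eq_one]
    refine ⟨v, ?_⟩
    ext x
    simp only [Finset.mem_filter, Finset.mem_univ, true_and, Finset.mem_singleton]
    constructor
    · rintro ⟨-, hx⟩
      exact (hv x).1 hx
    · rintro rfl
      exact ⟨((hadj w).1 hw.1).symm, hv0⟩
  refine ⟨?_, hb, ?_, ?_⟩
  · rw [Finset.card_eq_zero, Finset.eq_empty_iff_forall_notMem]
    intro w hw
    rw [mem_layer] at hw
    exact hnP w hw.1 hw.2
  · rw [Finset.sum_congr rfl hone, Finset.sum_const, hb, smul_eq_mul, mul_one]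
  · have : ∀ w ∈ layer ℓ (fun x => ¬ P x) 1, nbrCount G ℓ P 0 w = 1 := fun w hw => by
      rw [nbrCount_eq_levelDegree, hone w hw]
      intro x _ hx
      rw [(hv x).1 hx]
      exact hPv
    rw [Finset.sum_congr rfl this, Finset.sum_const, hb, smul_eq_mul, mul_one]

end IsTypedLayering

/-- The numbers of `s`-vertices and of `t`-vertices on the spheres of positive radius centred at an
`s`-vertex; the value at `0` extends the recurrence. -/
noncomputable def sphereCounts (s t : ℝ) : ℕ → ℝ × ℝ
  | 0 => (0, 0)
  | 1 => (0, s)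
  | k + 2 => ((t - 4) / 2 * (sphereCounts s t (k + 1)).2 - (sphereCounts s t k).1,
      (s - 4) * (sphereCounts s t (k + 1)).1 + (t - 4) / 2 * (sphereCounts s t (k + 1)).2 -
        (sphereCounts s t k).2)

namespace IsTypedLayering

variable {P : W → Prop} {s t n : ℕ} {v : W}

/-- The two counts alone do not close the induction, so three edge counts towards the lower level
are carried along. The five double-counting identities determine the next five quantities linearly.
All five formulas hold at level 1 with the formal value (0, 0) at level 0, not the true count (1,
0). -/
theorem card_layer_aux (h : IsTypedLayering G ℓ P s t n) (hs : 6 ≤ s) (ht : 6 ≤ t)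
    (hv : ∀ w, ℓ w = 0 ↔ w = v) (hPv : P v) (k : ℕ) (hk : k + 1 < n) :
    ((layer ℓ P (k + 1)).card : ℝ) = (sphereCounts s t (k + 1)).1 ∧
    ((layer ℓ (fun x => ¬ P x) (k + 1)).card : ℝ) = (sphereCounts s t (k + 1)).2 ∧
    ((∑ w ∈ layer ℓ P (k + 1), levelDegree G ℓ k w : ℕ) : ℝ) = (sphereCounts s t (k + 1)).1 +
      (sphereCounts s t k).2 - (sphereCounts s t k).1 ∧
    ((∑ w ∈ layer ℓ (fun x => ¬ P x) (k + 1), levelDegree G ℓ k w : ℕ) : ℝ) =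
      (sphereCounts s t (k + 1)).2 + 2 * (sphereCounts s t k).1 ∧
    ((∑ w ∈ layer ℓ (fun x => ¬ P x) (k + 1), nbrCount G ℓ P k w : ℕ) : ℝ) =
      (sphereCounts s t (k + 1)).2 - (sphereCounts s t (k + 1)).1 + (sphereCounts s t k).1 := by
  induction k with
  | zero =>
    obtain ⟨h1, h2, h3, h4⟩ := h.first_layer hv hPv hk
    have h5 : layer ℓ P 1 = ∅ := Finset.card_eq_zero.1 h1
    rw [zero_add, h2, h3, h4, h5]
    simp [sphereCounts]
  | succ k ih =>
    obtain ⟨i1, i2, i3, i4, i5⟩ := ih (by omega)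
    have e1 := congrArg (Nat.cast : ℕ → ℝ) (h.sum_s_degree hs hk)
    have e2 := congrArg (Nat.cast : ℕ → ℝ) (h.sum_t_degree ht hk)
    have e3 := congrArg (Nat.cast : ℕ → ℝ) (h.sum_t_s_neighbors hs hk)
    have e4 := congrArg (Nat.cast : ℕ → ℝ) (h.sum_levelDegree_s hs ht hk)
    have e5 := congrArg (Nat.cast : ℕ → ℝ) (h.sum_levelDegree_all hs ht hk)
    simp only [Nat.cast_add, Nat.cast_mul, Nat.cast_ofNat] at e1 e2 e3 e4 e5
    rw [i1, i3] at e1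
    rw [i2, i4] at e2
    rw [i1, i2, i5] at e3
    rw [i1, i2] at e4 e5
    simp only [add_assoc, Nat.reduceAdd] at e1 e2 e3 e4 e5 ⊢
    rw [sphereCounts]
    generalize (sphereCounts s t (k + 1)).1 = α₁ at *
    generalize (sphereCounts s t (k + 1)).2 = β₁ at *
    generalize (sphereCounts s t k).1 = α₀ at *
    generalize (sphereCounts s t k).2 = β₀ at *
    refine ⟨?_, ?_, ?_, ?_, ?_⟩ <;> linarith

end IsTypedLayering

end Counting

/-! ### Growth of the recurrence and the limit of the averages -/

section Limit

/-- The solution of `e (k + 2) = q * e (k + 1) - e k` with `e 0 = 0` and `e 1 = 1`. -/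
noncomputable def chebSeq (q : ℝ) : ℕ → ℝ
  | 0 => 0
  | 1 => 1
  | k + 2 => q * chebSeq q (k + 1) - chebSeq q k

/-- The roots of x² - qx + 1 may be complex or double; r is the larger modulus. If it reached l > 1,
the root would be real, since μ + μ⁻¹ is, and then |q| = |μ| + |μ|⁻¹ ≥ l + l⁻¹ = p. -/
theorem exists_root_norm_lt {q p : ℝ} (hp : 2 < p) (hq : |q| < p) :
    ∃ (μ ν : ℂ) (r l : ℝ), μ + ν = q ∧ μ * ν = 1 ∧ ‖μ‖ ≤ r ∧ ‖ν‖ ≤ 1 ∧ 1 ≤ r ∧ r < l ∧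
      l + l⁻¹ = p := by
  have hsq : 0 ≤ p ^ 2 - 4 := by nlinarith
  have hs := Real.sq_sqrt hsq
  have hs0 := Real.sqrt_nonneg (p ^ 2 - 4)
  set l := (p + √(p ^ 2 - 4)) / 2 with hl
  have hl1 : 1 < l := by rw [hl]; linarith
  have hlp : l + l⁻¹ = p := by
    have : l * l + 1 = p * l := by rw [hl]; nlinarith
    field_simp
    linarith
  obtain ⟨μ, hμ⟩ := IsAlgClosed.exists_eq_mul_self ((q : ℂ) ^ 2 - 4)
  -- the two roots of `x ^ 2 - q * x + 1`
  have key : ∀ μ ν : ℂ, μ + ν = q → μ * ν = 1 → ‖ν‖ ≤ 1 →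
      ∃ (μ ν : ℂ) (r l : ℝ), μ + ν = q ∧ μ * ν = 1 ∧ ‖μ‖ ≤ r ∧ ‖ν‖ ≤ 1 ∧ 1 ≤ r ∧ r < l ∧
      l + l⁻¹ = p := by
    intro μ ν h1 h2 hν
    have hn : ‖μ‖ * ‖ν‖ = 1 := by rw [← norm_mul, h2, norm_one]
    have hμ1 : 1 ≤ ‖μ‖ := by
      by_contra h
      push Not at h
      nlinarith [norm_nonneg μ, norm_nonneg ν]
    refine ⟨μ, ν, ‖μ‖, l, h1, h2, le_rfl, hν, hμ1, ?_, hlp⟩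
    by_contra hle
    push Not at hle
    have hμ0 : μ ≠ 0 := by
      rintro rfl
      simp at h2
    have hν' : ν = μ⁻¹ := (inv_eq_of_mul_eq_one_right h2).symm
    have hR : 1 < Complex.normSq μ := by
      rw [Complex.normSq_eq_norm_sq]
      nlinarith
    have him : μ.im = 0 := by
      have := congrArg Complex.im h1
      rw [hν', Complex.add_im, Complex.inv_im, Complex.ofReal_im] at this
      field_simp at this
      have h3 : μ.im * (Complex.normSq μ - 1) = 0 := by linarith
      rcases mul_eq_zero.1 h3 with h | h
      · exact h
      · linarith
    have hre : μ = (μ.re : ℂ) := Complex.ext rfl (by simpa using him)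
    have hqr : q = μ.re + μ.re⁻¹ := by
      have := congrArg Complex.re h1
      rw [hν', hre, ← Complex.ofReal_inv, ← Complex.ofReal_add, Complex.ofReal_re] at this
      simpa using this.symm
    rw [hre, Complex.norm_real, Real.norm_eq_abs] at hle
    have hx0 : μ.re ≠ 0 := fun h => hμ0 (by rw [hre, h]; simp)
    have habs : |q| = |μ.re| + |μ.re|⁻¹ := by
      rw [hqr]
      rcases lt_or_gt_of_ne hx0 with h | h
      · rw [abs_of_neg h, abs_of_neg (by have := inv_lt_zero.2 h; linarith)]
        rw [neg_add, inv_neg]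
      · rw [abs_of_pos h, abs_of_pos (by positivity)]
    have hmono : l + l⁻¹ ≤ |μ.re| + |μ.re|⁻¹ := by
      have hy : 0 < |μ.re| := by positivity
      have hl0 : 0 < l := by linarith
      rw [← sub_nonneg]
      have : |μ.re| + |μ.re|⁻¹ - (l + l⁻¹) = (|μ.re| - l) * (|μ.re| * l - 1) / (|μ.re| * l) := by
        field_simp
        ring
      rw [this]
      have h5 : 1 ≤ |μ.re| * l := by nlinarith
      have h6 : 0 ≤ |μ.re| * l - 1 := by linarith
      have h7 : 0 ≤ |μ.re| - l := by linarith
      positivity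
    linarith
  have h1 : ((q + μ) / 2 : ℂ) + (q - μ) / 2 = q := by ring
  have h2 : ((q + μ) / 2 : ℂ) * ((q - μ) / 2) = 1 := by linear_combination (1 / 4 : ℂ) * hμ
  by_cases h : ‖((q - μ) / 2 : ℂ)‖ ≤ 1
  · exact key _ _ h1 h2 h
  · refine key _ _ (by rw [add_comm, h1]) (by rw [mul_comm, h2]) ?_
    have hn : ‖((q + μ) / 2 : ℂ)‖ * ‖((q - μ) / 2 : ℂ)‖ = 1 := by rw [← norm_mul, h2, norm_one]
    push Not at h
    nlinarith [norm_nonneg ((q + μ) / 2 : ℂ)]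

/-- The first-order recursion e(k+1) = μ e(k) + ν^k avoids dividing by μ - ν; the factor k covers a
double root. -/
theorem abs_chebSeq_le {q r : ℝ} {μ ν : ℂ} (h1 : μ + ν = q) (h2 : μ * ν = 1) (hμ : ‖μ‖ ≤ r)
    (hν : ‖ν‖ ≤ 1) (hr : 1 ≤ r) (k : ℕ) : |chebSeq q k| ≤ k * r ^ k := by
  have hstep : ∀ k, (chebSeq q (k + 1) : ℂ) = μ * chebSeq q k + ν ^ k := by
    intro k
    induction k with
    | zero => simp [chebSeq]
    | succ k ih =>
      rw [chebSeq]
      push_cast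
      rw [← h1, pow_succ]
      linear_combination ν * ih + (chebSeq q k : ℂ) * h2
  induction k with
  | zero => simp [chebSeq]
  | succ k ih =>
    have h3 : |chebSeq q (k + 1)| = ‖(chebSeq q (k + 1) : ℂ)‖ := by
      rw [Complex.norm_real, Real.norm_eq_abs]
    rw [h3, hstep]
    have hν' : ‖ν ^ k‖ ≤ 1 := by
      rw [norm_pow]
      exact pow_le_one₀ (norm_nonneg _) hν
    have h4 : ‖μ * chebSeq q k‖ ≤ r * (k * r ^ k) := by
      rw [norm_mul, Complex.norm_real, Real.norm_eq_abs]
      exact mul_le_mul hμ ih (abs_nonneg _) (by linarith)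
    have h5 : 1 ≤ r ^ (k + 1) := one_le_pow₀ hr
    calc ‖μ * chebSeq q k + ν ^ k‖ ≤ ‖μ * chebSeq q k‖ + ‖ν ^ k‖ := norm_add_le _ _
      _ ≤ r * (k * r ^ k) + r ^ (k + 1) := add_le_add h4 (hν'.trans h5)
      _ = ((k + 1 : ℕ) : ℝ) * r ^ (k + 1) := by push_cast; ring

/-- The same first-order recursion with the positive real roots l and l⁻¹. -/
theorem pow_le_chebSeq {p l : ℝ} (hl : 1 < l) (hp : l + l⁻¹ = p) (k : ℕ) :
    l ^ k ≤ chebSeq p (k + 1) := by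
  have hl0 : l ≠ 0 := by positivity
  have hstep : ∀ k, chebSeq p (k + 1) = l * chebSeq p k + l⁻¹ ^ k := by
    intro k
    induction k with
    | zero => simp [chebSeq]
    | succ k ih =>
      rw [chebSeq, pow_succ]
      have : l * l⁻¹ = 1 := mul_inv_cancel₀ hl0
      linear_combination l⁻¹ * ih + chebSeq p k * this - chebSeq p (k + 1) * hp
  induction k with
  | zero => simp [chebSeq]
  | succ k ih =>
    rw [hstep, pow_succ, mul_comm]
    have h1 : 0 < l⁻¹ ^ (k + 1) := by positivity
    nlinarith

theorem chebSeq_nonneg {p l : ℝ} (hl : 1 < l) (hp : l + l⁻¹ = p) (k : ℕ) : 0 ≤ chebSeq p k := by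
  cases k with
  | zero => exact le_rfl
  | succ k => exact le_trans (by positivity) (pow_le_chebSeq hl hp k)

theorem pow_le_sum_chebSeq {p l : ℝ} (hl : 1 < l) (hp : l + l⁻¹ = p) (n : ℕ) :
    l ^ n ≤ ∑ k ∈ Finset.range (n + 2), chebSeq p k :=
  (pow_le_chebSeq hl hp n).trans (Finset.single_le_sum (f := chebSeq p)
    (fun k _ => chebSeq_nonneg hl hp k) (by simp))

theorem tendsto_inv_sum_chebSeq {p : ℝ} (hp : 2 < p) :
    Tendsto (fun n => (∑ k ∈ Finset.range n, chebSeq p k)⁻¹) atTop (𝓝 0) := by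
  obtain ⟨μ, ν, r, l, -, -, -, -, hr, hrl, hl⟩ := exists_root_norm_lt (q := 0) hp (by simp; linarith)
  have hl1 : 1 < l := hr.trans_lt hrl
  apply Filter.Tendsto.inv_tendsto_atTop
  rw [← tendsto_add_atTop_iff_nat 2]
  exact tendsto_atTop_mono (pow_le_sum_chebSeq hl1 hl) (tendsto_pow_atTop_atTop_of_one_lt hl1)

/-- The numerator is at most n² rⁿ, while the denominator is at least its last term, hence at least
l^(n-2), and r < l. -/
theorem tendsto_sum_chebSeq_div {p q : ℝ} (hp : 2 < p) (hq : |q| < p) :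
    Tendsto (fun n => (∑ k ∈ Finset.range n, chebSeq q k) / ∑ k ∈ Finset.range n, chebSeq p k)
      atTop (𝓝 0) := by
  obtain ⟨μ, ν, r, l, h1, h2, hμ, hν, hr, hrl, hl⟩ := exists_root_norm_lt hp hq
  have hl1 : 1 < l := hr.trans_lt hrl
  have hl0 : 0 < l := by linarith
  have hr0 : 0 < r := by linarith
  rw [← tendsto_add_atTop_iff_nat 2]
  have hlim : Tendsto (fun n : ℕ => l ^ 2 * (((n + 2 : ℕ) : ℝ) ^ 2 * (r / l) ^ (n + 2)))
      atTop (𝓝 (l ^ 2 * 0)) := by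
    refine Tendsto.const_mul _ ?_
    have := tendsto_pow_const_mul_const_pow_of_abs_lt_one 2 (r := r / l) (by
      rw [abs_of_pos (by positivity), div_lt_one hl0]
      exact hrl)
    exact (tendsto_add_atTop_iff_nat (f := fun n : ℕ => (n : ℝ) ^ 2 * (r / l) ^ n) 2).2 this
  rw [mul_zero] at hlim
  refine squeeze_zero_norm (fun n => ?_) hlim
  have hpow : 0 < l ^ n := by positivity
  have hH := pow_le_sum_chebSeq hl1 hl n
  have hE : |∑ k ∈ Finset.range (n + 2), chebSeq q k| ≤ ((n + 2 : ℕ) : ℝ) ^ 2 * r ^ (n + 2) := by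
    calc |∑ k ∈ Finset.range (n + 2), chebSeq q k|
        ≤ ∑ k ∈ Finset.range (n + 2), |chebSeq q k| := Finset.abs_sum_le_sum_abs _ _
      _ ≤ ∑ k ∈ Finset.range (n + 2), ((n + 2 : ℕ) : ℝ) * r ^ (n + 2) := by
        refine Finset.sum_le_sum fun k hk => (abs_chebSeq_le h1 h2 hμ hν hr k).trans ?_
        have hk' := (Finset.mem_range.1 hk).le
        exact mul_le_mul (by exact_mod_cast hk') (pow_le_pow_right₀ hr hk') (by positivity)
          (by positivity)
      _ = _ := by
        rw [Finset.sum_const, Finset.card_range, nsmul_eq_mul]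
        ring
  rw [Real.norm_eq_abs, abs_div, abs_of_pos (hpow.trans_le hH)]
  calc _ ≤ ((n + 2 : ℕ) : ℝ) ^ 2 * r ^ (n + 2) / l ^ n :=
        div_le_div₀ (by positivity) hE hpow hH
    _ = _ := by
      rw [div_pow]
      field_simp
      ring

/-- The average curvature inside the sphere of radius `n`, computed from the sphere counts. -/
noncomputable def sphereAverage (s t : ℝ) (n : ℕ) : ℝ :=
  ((6 - s) + ∑ k ∈ Finset.range n,
      ((6 - s) * (sphereCounts s t k).1 + (6 - t) * (sphereCounts s t k).2)) /
    (1 + ∑ k ∈ Finset.range n, ((sphereCounts s t k).1 + (sphereCounts s t k).2))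

/-- The row vector (s - 4, x) is a left eigenvector, with eigenvalue x, of the matrix multiplying
the (k+1)-st counts: x satisfies x² = ((t - 4)/2) x + (s - 4)(t - 4)/2. This decouples the
recurrence. -/
theorem sphereCounts_eigen {s t x y : ℝ} (hsum : x + y = (t - 4) / 2)
    (hprod : x * y = -((s - 4) * (t - 4) / 2)) (k : ℕ) :
    (s - 4) * (sphereCounts s t k).1 + x * (sphereCounts s t k).2 = x * s * chebSeq x k := by
  induction k using Nat.twoStepInduction with
  | zero => simp [sphereCounts, chebSeq]
  | one => simp [sphereCounts, chebSeq]
  | more k ih0 ih1 =>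
    rw [sphereCounts, chebSeq]
    have hx : x ^ 2 = (t - 4) / 2 * x + (s - 4) * (t - 4) / 2 := by
      linear_combination x * hsum - hprod
    linear_combination x * ih1 - ih0 - (sphereCounts s t (k + 1)).2 * hx

theorem tendsto_sphereAverage_of_roots {s t p q : ℝ} (hs : 6 ≤ s) (hsum : p + q = (t - 4) / 2)
    (hprod : p * q = -((s - 4) * (t - 4) / 2)) (hp : 2 < p) (hq : |q| < p) (hq0 : q < 0) :
    Tendsto (sphereAverage s t) atTop (𝓝 (2 - p)) := by
  have hS : 0 < s - 4 := by linarith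
  have hpq : 0 < p - q := by linarith
  have hH := tendsto_inv_sum_chebSeq hp
  have hE := tendsto_sum_chebSeq_div hp hq
  have hev : ∀ᶠ n in atTop, ∑ k ∈ Finset.range n, chebSeq p k ≠ 0 := by
    obtain ⟨μ, ν, r, l, -, -, -, -, hr, hrl, hl⟩ := exists_root_norm_lt hp hq
    have hl1 : 1 < l := hr.trans_lt hrl
    filter_upwards [eventually_ge_atTop 2] with n hn
    obtain ⟨m, rfl⟩ : ∃ m, n = m + 2 := ⟨n - 2, by omega⟩
    have h1 : 0 < l ^ m := by positivity
    exact (h1.trans_le (pow_le_sum_chebSeq hl1 hl m)).ne'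
  set H : ℕ → ℝ := fun n => ∑ k ∈ Finset.range n, chebSeq p k
  set E : ℕ → ℝ := fun n => ∑ k ∈ Finset.range n, chebSeq q k
  -- The number of vertices is the combination of the two eigenforms with coefficients summing to
  -- (1, 1).
  have hN : ∀ n, ∑ k ∈ Finset.range n, ((sphereCounts s t k).1 + (sphereCounts s t k).2) =
      ((s - 4 - q) * (p * s) * H n + (p - (s - 4)) * (q * s) * E n) / ((s - 4) * (p - q)) := by
    intro n
    rw [eq_div_iff (by positivity), Finset.sum_mul, Finset.mul_sum, Finset.mul_sum,
      ← Finset.sum_add_distrib]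
    refine Finset.sum_congr rfl fun k _ => ?_
    have e1 := sphereCounts_eigen hsum hprod k
    have e2 := sphereCounts_eigen (add_comm p q ▸ hsum) (mul_comm p q ▸ hprod) k
    linear_combination (s - 4 - q) * e1 + (p - (s - 4)) * e2
  -- After subtracting 2 - p times the number of vertices, the curvature is a multiple of the
  -- eigenform for q alone; this is why the limit is exactly 2 - p.
  have hK : ∀ n, ∑ k ∈ Finset.range n,
      ((6 - s) * (sphereCounts s t k).1 + (6 - t) * (sphereCounts s t k).2) =
      (2 - p) * ∑ k ∈ Finset.range n, ((sphereCounts s t k).1 + (sphereCounts s t k).2) -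
        (s - 4 - p) / (s - 4) * (q * s) * E n := by
    intro n
    rw [Finset.mul_sum, Finset.mul_sum, ← Finset.sum_sub_distrib]
    refine Finset.sum_congr rfl fun k _ => ?_
    have e2 := sphereCounts_eigen (add_comm p q ▸ hsum) (mul_comm p q ▸ hprod) k
    have hid : (s - 4 - p) * q = (s - 4) * (t - 4 - p) := by
      linear_combination (s - 4) * hsum - hprod
    field_simp
    linear_combination (-(s - 4 - p)) * e2 + (sphereCounts s t k).2 * hid
  -- Numerator and denominator are divided by H n; the denominator keeps a positive limit because q
  -- < 0 < p.
  have hden : Tendsto (fun n => (H n)⁻¹ + ((s - 4 - q) * (p * s) +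
      (p - (s - 4)) * (q * s) * (E n / H n)) / ((s - 4) * (p - q))) atTop
      (𝓝 (0 + ((s - 4 - q) * (p * s) + (p - (s - 4)) * (q * s) * 0) / ((s - 4) * (p - q)))) :=
    hH.add ((tendsto_const_nhds.add (hE.const_mul _)).div_const _)
  have hnum : Tendsto (fun n => ((6 - s) - (2 - p)) * (H n)⁻¹ -
      (s - 4 - p) / (s - 4) * (q * s) * (E n / H n)) atTop
      (𝓝 (((6 - s) - (2 - p)) * 0 - (s - 4 - p) / (s - 4) * (q * s) * 0)) :=
    (hH.const_mul _).sub (hE.const_mul _)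
  have hpos : 0 < 0 + ((s - 4 - q) * (p * s) + (p - (s - 4)) * (q * s) * 0) /
      ((s - 4) * (p - q)) := by
    have h1 : 0 < s - 4 - q := by linarith
    have h2 : 0 < p := by linarith
    have h3 : 0 < s := by linarith
    rw [mul_zero, add_zero, zero_add]
    positivity
  have hlim := (hnum.div hden hpos.ne').const_add (2 - p)
  rw [mul_zero, mul_zero, sub_zero, zero_div, add_zero] at hlim
  refine hlim.congr' ?_
  filter_upwards [hev, hden.eventually (lt_mem_nhds hpos)] with n hn hd
  have hHn : H n ≠ 0 := hn
  have hd' : (1 + ∑ k ∈ Finset.range n, ((sphereCounts s t k).1 + (sphereCounts s t k).2)) =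
      H n * ((H n)⁻¹ + ((s - 4 - q) * (p * s) +
      (p - (s - 4)) * (q * s) * (E n / H n)) / ((s - 4) * (p - q))) := by
    rw [hN]
    field_simp
  have hn' : (6 - s) + ∑ k ∈ Finset.range n,
      ((6 - s) * (sphereCounts s t k).1 + (6 - t) * (sphereCounts s t k).2) =
      (2 - p) * (1 + ∑ k ∈ Finset.range n, ((sphereCounts s t k).1 + (sphereCounts s t k).2)) +
      H n * (((6 - s) - (2 - p)) * (H n)⁻¹ -
      (s - 4 - p) / (s - 4) * (q * s) * (E n / H n)) := by
    rw [hK]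
    field_simp
    ring
  rw [sphereAverage, hn', hd', add_div, mul_div_mul_left _ _ hHn,
    mul_div_assoc, div_self (mul_ne_zero hHn hd.ne'), mul_one]
  rfl

theorem tendsto_sphereAverage {s t : ℝ} (hs : 6 ≤ s) (ht : 6 ≤ t) (hst : 6 < s ∨ 6 < t) :
    Tendsto (sphereAverage s t) atTop
      (𝓝 (2 - ((t - 4) + √((t - 4) ^ 2 + 8 * (s - 4) * (t - 4))) / 4)) := by
  have hS : 2 ≤ s - 4 := by linarith
  have hT : 2 ≤ t - 4 := by linarith
  have hST : 0 < (s - 4) * (t - 4) := by nlinarith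
  have hrad : 0 ≤ (t - 4) ^ 2 + 8 * (s - 4) * (t - 4) := by nlinarith
  have hsq := Real.sq_sqrt hrad
  set R := √((t - 4) ^ 2 + 8 * (s - 4) * (t - 4)) with hR
  have hRT : t - 4 < R := by
    rw [hR]
    apply Real.lt_sqrt_of_sq_lt
    nlinarith
  -- This says p > 2; after squaring it reads (s - 2)(t - 4) > 8, which fails only at s = t = 6.
  have hbig : 8 - (t - 4) < R := by
    rw [hR]
    apply Real.lt_sqrt_of_sq_lt
    rcases hst with h | h <;> nlinarith
  refine tendsto_sphereAverage_of_roots (q := ((t - 4) - R) / 4) hs (by ring)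
    (by linear_combination (-1 / 16 : ℝ) * hsq) (by linarith) ?_ (by linarith)
  rw [abs_of_neg (by linarith)]
  linarith

end Limit

/-! ### From uniform diagrams to the counts, and the main theorem -/

section Assembly

variable {W : Type*} {D : AbstractSimplicialComplex W}

theorem fullSpan_cycle_mem_iff {w : W} {t : ℕ} {c : ZMod t → W}
    (hc : IsCycleEnum (fullSpan D.toPreAbstractSimplicialComplex
      ((skeleton D.toPreAbstractSimplicialComplex).neighborSet w)) t c) {x : W} :
    (skeleton D.toPreAbstractSimplicialComplex).Adj w x ↔ ∃ i, x = c i := by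
  have h := hc.2.2 {x}
  have h1 : ({x} : Finset W) ∈ (fullSpan D.toPreAbstractSimplicialComplex
      ((skeleton D.toPreAbstractSimplicialComplex).neighborSet w)).faces ↔
      (skeleton D.toPreAbstractSimplicialComplex).Adj w x := by
    simp only [fullSpan, Set.mem_ofPred_eq, Finset.coe_singleton, Set.singleton_subset_iff,
      SimpleGraph.mem_neighborSet, and_iff_right_iff_imp]
    rintro ⟨-, σ, hσ, -, hx⟩
    exact mem_faces_of_subset hσ (by simpa using hx) (by simp)
  rw [← h1, h]
  refine exists_congr fun i => ?_
  rw [Finset.coe_singleton]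
  constructor
  · rintro (h1 | h1)
    · exact Set.singleton_injective h1
    · have : c i ∈ ({x} : Set W) := h1 ▸ (by simp)
      exact (Set.mem_singleton_iff.1 this).symm
  · rintro rfl
    exact Or.inl rfl

theorem fullSpan_cycle_adj [DecidableEq W] {w : W} {t : ℕ} {c : ZMod t → W}
    (hc : IsCycleEnum (fullSpan D.toPreAbstractSimplicialComplex
      ((skeleton D.toPreAbstractSimplicialComplex).neighborSet w)) t c) {i : ZMod t} {u : W}
    (hi : (skeleton D.toPreAbstractSimplicialComplex).Adj w (c i))
    (hu : (skeleton D.toPreAbstractSimplicialComplex).Adj w u)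
    (hiu : (skeleton D.toPreAbstractSimplicialComplex).Adj (c i) u) :
    u = c (i + 1) ∨ u = c (i - 1) := by
  have h : ({c i, u} : Finset W) ∈ (fullSpan D.toPreAbstractSimplicialComplex
      ((skeleton D.toPreAbstractSimplicialComplex).neighborSet w)).faces := by
    refine ⟨(skeleton_adj_iff.1 hiu).2, ?_⟩
    intro x hx
    simp only [Finset.coe_insert, Finset.coe_singleton, Set.mem_insert_iff,
      Set.mem_singleton_iff] at hx
    rcases hx with rfl | rfl
    · exact hi
    · exact hu
  obtain ⟨j, hj | hj⟩ := (hc.2.2 _).1 h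
  · rw [Finset.coe_pair] at hj
    have h1 : c i ∈ ({c j} : Set W) := hj ▸ (by simp)
    have h2 : u ∈ ({c j} : Set W) := hj ▸ (by simp)
    exact (hiu.1 (h1.trans h2.symm)).elim
  · rw [Finset.coe_pair, Set.pair_eq_pair_iff] at hj
    rcases hj with ⟨h1, h2⟩ | ⟨h1, h2⟩
    · left; rw [h2, hc.2.1 h1]
    · right; rw [h2, hc.2.1 h1, add_sub_cancel_right]

/-- Representatives run over 1, …, t, as in the definition of uniformity, so the class 0 is
represented by t. -/
theorem exists_natCast_eq {t : ℕ} (ht : 0 < t) (i : ZMod t) :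
    ∃ j : ℕ, 1 ≤ j ∧ j ≤ t ∧ (j : ZMod t) = i := by
  have : NeZero t := ⟨ht.ne'⟩
  by_cases h : i.val = 0
  · refine ⟨t, ht, le_rfl, ?_⟩
    rw [ZMod.val_eq_zero] at h
    rw [h, ZMod.natCast_self]
  · exact ⟨i.val, by omega, (ZMod.val_lt i).le, ZMod.natCast_zmod_val i⟩

theorem natCast_injOn {t a b : ℕ} (ha : 1 ≤ a) (hat : a ≤ t) (hb : 1 ≤ b) (hbt : b ≤ t)
    (h : (a : ZMod t) = b) : a = b := by
  obtain ⟨a, rfl⟩ : ∃ a', a = a' + 1 := ⟨a - 1, by omega⟩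
  obtain ⟨b, rfl⟩ : ∃ b', b = b' + 1 := ⟨b - 1, by omega⟩
  rw [Nat.cast_add, Nat.cast_add, add_left_inj, ZMod.natCast_eq_natCast_iff] at h
  rw [Nat.ModEq.eq_of_lt_of_lt h (by omega) (by omega)]

theorem IsUniformDiagram.six_le_degree {s t : ℕ} (hU : IsUniformDiagram D s t) (hs : 6 ≤ s)
    (ht : 6 ≤ t) (w : W) (hw : IsInterior D w) : 6 ≤ degree D w := by
  rcases hU.interior w hw with h | h <;> rw [h.2] <;> assumption

/-- The boundary alternatives disappear because vertices at level below n are interior. Statements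
about all neighbours of w need one level of margin. -/
theorem IsUniformDiagram.isTypedLayering [Fintype W] (hD : IsDisc D) {s t : ℕ} (hs : 6 ≤ s)
    (ht : 6 ≤ t) (hteven : Even t) (hst : s ≠ t) (hU : IsUniformDiagram D s t) {v : W} {n : ℕ}
    (hint : ∀ w ∈ inside D v n, IsInterior D w) :
    IsTypedLayering (skeleton D.toPreAbstractSimplicialComplex)
      ((skeleton D.toPreAbstractSimplicialComplex).dist v) (IsKVertex D s) s t n := by
  classical
  have hdeg := hU.six_le_degree hs ht
  have hG := isLayering_dist hD hdeg v
  have hint' : ∀ w, (skeleton D.toPreAbstractSimplicialComplex).dist v w < n → IsInterior D w :=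
    hint
  have hT : ∀ w, (skeleton D.toPreAbstractSimplicialComplex).dist v w < n → ¬ IsKVertex D s w →
      IsKVertex D t w := fun w hw hP => (hU.interior w (hint' w hw)).resolve_left hP
  have hexcl : ∀ w, IsKVertex D t w → ¬ IsKVertex D s w := fun w h1 h2 =>
    hst (h2.2.symm.trans h1.2)
  -- As s ≠ t the two types exclude each other, so the type of a neighbour is equivalent to the
  -- parity of its index.
  have hparity : ∀ w, (skeleton D.toPreAbstractSimplicialComplex).dist v w + 1 < n →
      ¬ IsKVertex D s w → ∃ c : ZMod t → W,
        IsCycleEnum (fullSpan D.toPreAbstractSimplicialComplex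
          ((skeleton D.toPreAbstractSimplicialComplex).neighborSet w)) t c ∧
        ∀ j : ℕ, 1 ≤ j → j ≤ t → (IsKVertex D s (c j) ↔ Even j) := by
    intro w hw hP
    obtain ⟨c, hc, hj⟩ := hU.t_vertex w (hT w (by omega) hP)
    refine ⟨c, hc, fun j h1 h2 => ?_⟩
    have hadj := (fullSpan_cycle_mem_iff hc (x := c j)).2 ⟨_, rfl⟩
    have hcint := hint' (c j) (by have := hG.le_succ _ _ hadj; omega)
    constructor
    · intro h
      by_contra hodd
      rw [Nat.not_even_iff_odd] at hodd
      rcases (hj j h1 h2).1 hodd with h' | h'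
      · exact hexcl _ h' h
      · exact h' hcint
    · intro h
      exact ((hj j h1 h2).2 h).resolve_right (not_not.2 hcint)
  refine { hG with
    cycle_s := fun w hw hP => ?_
    cycle_t := fun w hw hP => ?_
    not_s := fun w x hw hx hP hwx => ?_
    two_mul_card := fun w hw hP => ?_
    triangle := fun w x u hw hPw hPx hwx hwu hxu => ?_ }
  · have := exists_isNeighborCycle hD hdeg (hint' w hw)
    rwa [hP.2] at this
  · have := exists_isNeighborCycle hD hdeg (hint' w hw)
    rwa [(hT w hw hP).2] at this
  · exact hexcl x ((hU.s_vertex w hP x hwx).resolve_right (not_not.2 (hint' x hx)))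
  · obtain ⟨c, hc, hpar⟩ := hparity w hw hP
    obtain ⟨m, hm⟩ := hteven
    have : {x | (skeleton D.toPreAbstractSimplicialComplex).Adj w x ∧ IsKVertex D s x} =
        ((Finset.Icc 1 m).image fun i => c ((2 * i : ℕ) : ZMod t) : Finset W) := by
      ext x
      simp only [Set.mem_ofPred_eq, Finset.coe_image, Set.mem_image, Finset.coe_Icc, Set.mem_Icc]
      constructor
      · rintro ⟨hwx, hPx⟩
        obtain ⟨i, rfl⟩ := (fullSpan_cycle_mem_iff hc).1 hwx
        obtain ⟨j, h1, h2, rfl⟩ := exists_natCast_eq (by omega) i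
        obtain ⟨r, rfl⟩ := (hpar j h1 h2).1 hPx
        exact ⟨r, by omega, by rw [two_mul]⟩
      · rintro ⟨i, hi, rfl⟩
        exact ⟨(fullSpan_cycle_mem_iff hc).2 ⟨_, rfl⟩,
          (hpar _ (by omega) (by omega)).2 (even_two_mul i)⟩
    rw [this, Set.ncard_coe_finset, Finset.card_image_of_injOn, Nat.card_Icc]
    · omega
    · intro i hi j hj hij
      simp only [Finset.coe_Icc, Set.mem_Icc] at hi hj
      have := natCast_injOn (by omega) (by omega) (by omega) (by omega) (hc.2.1 hij)
      omega
  · obtain ⟨c, hc, hpar⟩ := hparity w hw hPw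
    obtain ⟨i, rfl⟩ := (fullSpan_cycle_mem_iff hc).1 hwx
    obtain ⟨j, h1, h2, rfl⟩ := exists_natCast_eq (by omega) i
    rw [hpar j h1 h2] at hPx
    -- Since t is even, the parity pattern closes up around the cycle: an odd j is below t, and the
    -- predecessor of index 1 is the even index t.
    have hjt : j ≠ t := fun h => hPx (h ▸ hteven)
    rcases fullSpan_cycle_adj hc hwx hwu hxu with rfl | rfl
    · have := hpar (j + 1) (by omega) (by omega)
      push_cast at this
      rw [this]
      exact Nat.even_add_one.2 hPx
    · rcases h1.lt_or_eq with h1' | rfl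
      · have := hpar (j - 1) (by omega) (by omega)
        rw [Nat.cast_sub h1, Nat.cast_one] at this
        rw [this]
        rw [Nat.even_sub h1]
        simp [hPx]
      · have := hpar t (by omega) le_rfl
        rw [Nat.cast_one, sub_self, ← ZMod.natCast_self, this]
        exact hteven

/-- Two values x and y treat the curvature (6 - s, 6 - t) and the number of vertices (1, 1) at once.
The separate summand x is the centre, which `sphereCounts` omits at radius 0. -/
theorem IsTypedLayering.sum_inside [Fintype W] {G : SimpleGraph W} {ℓ : W → ℕ} {P : W → Prop}
    {s t n : ℕ} {v : W} (h : IsTypedLayering G ℓ P s t n) (hs : 6 ≤ s) (ht : 6 ≤ t)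
    (hv : ∀ w, ℓ w = 0 ↔ w = v) (hPv : P v) (hn : 1 ≤ n) {f : W → ℝ} {x y : ℝ}
    (hx : ∀ w, ℓ w < n → P w → f w = x) (hy : ∀ w, ℓ w < n → ¬ P w → f w = y) :
    ∑ w with ℓ w < n, f w = x + ∑ k ∈ Finset.range n,
      (x * (sphereCounts s t k).1 + y * (sphereCounts s t k).2) := by
  classical
  rw [← Finset.sum_fiberwise_of_maps_to (t := Finset.range n) (g := ℓ) (by simp)]
  have h1 : ∀ k ∈ Finset.range n, ∑ w ∈ (Finset.univ.filter fun w => ℓ w < n).filter (ℓ · = k), f w =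
      x * ((layer ℓ P k).card : ℝ) + y * ((layer ℓ (fun w => ¬ P w) k).card : ℝ) := by
    intro k hk
    rw [Finset.mem_range] at hk
    have : (Finset.univ.filter fun w => ℓ w < n).filter (ℓ · = k) = layer ℓ (fun _ => True) k := by
      ext w
      simp only [Finset.mem_filter, Finset.mem_univ, true_and, mem_layer, and_true,
        and_iff_right_iff_imp]
      omega
    rw [this, sum_layer_true P]
    congr 1
    · rw [Finset.sum_congr rfl fun w hw => hx w (by rw [(mem_layer.1 hw).1]; exact hk)
        (mem_layer.1 hw).2, Finset.sum_const, nsmul_eq_mul, mul_comm]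
    · rw [Finset.sum_congr rfl fun w hw => hy w (by rw [(mem_layer.1 hw).1]; exact hk)
        (mem_layer.1 hw).2, Finset.sum_const, nsmul_eq_mul, mul_comm]
  rw [Finset.sum_congr rfl h1]
  obtain ⟨m, rfl⟩ : ∃ m, n = m + 1 := ⟨n - 1, by omega⟩
  rw [Finset.sum_range_succ', Finset.sum_range_succ']
  have h2 : layer ℓ P 0 = {v} := by
    ext w
    simp only [mem_layer, hv, Finset.mem_singleton, and_iff_left_iff_imp]
    rintro rfl
    exact hPv
  have h3 : layer ℓ (fun w => ¬ P w) 0 = ∅ := by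
    rw [Finset.eq_empty_iff_forall_notMem]
    intro w hw
    rw [mem_layer, hv] at hw
    exact hw.2 (hw.1 ▸ hPv)
  have h4 : ∀ k ∈ Finset.range m, x * ((layer ℓ P (k + 1)).card : ℝ) +
      y * ((layer ℓ (fun w => ¬ P w) (k + 1)).card : ℝ) =
      x * (sphereCounts s t (k + 1)).1 + y * (sphereCounts s t (k + 1)).2 := by
    intro k hk
    rw [Finset.mem_range] at hk
    obtain ⟨e1, e2, -⟩ := h.card_layer_aux hs ht hv hPv k (by omega)
    rw [e1, e2]
  rw [Finset.sum_congr rfl h4, h2, h3]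
  simp [sphereCounts, add_comm]

theorem avgCurvature_eq_sum [Fintype W] (v : W) (n : ℕ) :
    avgCurvature D v n = (∑ w with (skeleton D.toPreAbstractSimplicialComplex).dist v w < n,
      (6 - (degree D w : ℝ))) /
      ∑ w with (skeleton D.toPreAbstractSimplicialComplex).dist v w < n, (1 : ℝ) := by
  classical
  have : inside D v n = ((Finset.univ.filter fun w =>
      (skeleton D.toPreAbstractSimplicialComplex).dist v w < n : Finset W) : Set W) := by
    ext w
    simp [inside]
  rw [avgCurvature, this, finsum_mem_coe_finset, Set.ncard_coe_finset, Finset.sum_const,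
    nsmul_eq_mul, mul_one]

theorem avgCurvature_eq_sphereAverage (hD : IsDisc D) {s t : ℕ} (hs : 6 ≤ s) (ht : 6 ≤ t)
    (hteven : Even t) (hst : s ≠ t) (hU : IsUniformDiagram D s t) {v : W} (hv : IsKVertex D s v)
    {n : ℕ} (hn : 1 ≤ n) (hint : ∀ w ∈ inside D v n, IsInterior D w) :
    avgCurvature D v n = sphereAverage s t n := by
  have := hD.finite
  have := Fintype.ofFinite W
  have hL := hU.isTypedLayering hD hs ht hteven hst hint
  have hv0 : ∀ w, (skeleton D.toPreAbstractSimplicialComplex).dist v w = 0 ↔ w = v := fun w => by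
    rw [hD.simplyConnected.connected.dist_eq_zero_iff, eq_comm]
  rw [avgCurvature_eq_sum, sphereAverage,
    hL.sum_inside hs ht hv0 hv hn (x := 6 - s) (y := 6 - t)
      (fun w hw hP => by rw [hP.2])
      (fun w hw hP => by rw [((hU.interior w (hint w hw)).resolve_left hP).2]),
    hL.sum_inside hs ht hv0 hv hn (x := 1) (y := 1) (fun w hw hP => rfl) (fun w hw hP => rfl)]
  simp only [one_mul]

theorem avgCurvature_eq_const (hD : IsDisc D) {t : ℕ} {v : W} {n : ℕ} (hn : 1 ≤ n)
    (hdeg : ∀ w ∈ inside D v n, degree D w = t) : avgCurvature D v n = 6 - t := by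
  have := hD.finite
  have := Fintype.ofFinite W
  have h : ∀ w ∈ (Finset.univ.filter fun w =>
      (skeleton D.toPreAbstractSimplicialComplex).dist v w < n),
      (6 : ℝ) - degree D w = 6 - t := fun w hw => by
    rw [hdeg w (Finset.mem_filter.1 hw).2]
  rw [avgCurvature_eq_sum, Finset.sum_congr rfl h, Finset.sum_const, Finset.sum_const,
    nsmul_eq_mul, nsmul_eq_mul, mul_one, mul_div_cancel_left₀]
  rw [Nat.cast_ne_zero]
  refine (Finset.card_pos.2 ⟨v, Finset.mem_filter.2 ⟨Finset.mem_univ _, ?_⟩⟩).ne'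
  rw [SimpleGraph.dist_self]
  exact hn

end Assembly

end STUniform

theorem theorem3p4 (s t : ℕ) (hs : 6 ≤ s) (ht : 6 ≤ t) (hteven : Even t)
    (hst : (s, t) ≠ (6, 6)) :
    ∃ κ : ℕ → ℝ,
      (∀ (V : Type*) (X : AbstractSimplicialComplex V), STUniform.IsUniform X s t →
        ∀ γ : PreAbstractSimplicialComplex V, STUniform.IsLoop X γ →
        ∀ (W : Type) (D : AbstractSimplicialComplex W) (f : W → V),
          STUniform.IsMinimalFilling X γ D f →
        ∀ v : W, STUniform.IsKVertex D s v →
        ∀ n : ℕ, 1 ≤ n → (∀ w ∈ STUniform.inside D v n, STUniform.IsInterior D w) →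
          STUniform.avgCurvature D v n = κ n) ∧
      Tendsto κ atTop
        (𝓝 (2 - (((t : ℝ) - 4) +
          √(((t : ℝ) - 4) ^ 2 + 8 * ((s : ℝ) - 4) * ((t : ℝ) - 4))) / 4)) := by
  -- For s = t the average is constantly 6 - t, and the square root equals 3(t - 4).
  by_cases h : s = t
  · refine ⟨fun _ => 6 - t, ?_, ?_⟩
    · intro V X hX γ hγ W D f hf v _ n hn hint
      exact STUniform.avgCurvature_eq_const hf.1.disc hn fun w hw =>
        (hX.of_eq h γ hγ W D f hf w (hint w hw)).2
    · subst h
      have hs' : (6 : ℝ) ≤ s := by exact_mod_cast hs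
      have hsqrt : √(((s : ℝ) - 4) ^ 2 + 8 * ((s : ℝ) - 4) * ((s : ℝ) - 4)) = 3 * ((s : ℝ) - 4) := by
        rw [show ((s : ℝ) - 4) ^ 2 + 8 * ((s : ℝ) - 4) * ((s : ℝ) - 4) = (3 * ((s : ℝ) - 4)) ^ 2 by
          ring]
        exact Real.sqrt_sq (by linarith)
      rw [hsqrt, show 2 - (((s : ℝ) - 4) + 3 * ((s : ℝ) - 4)) / 4 = 6 - s by ring]
      exact tendsto_const_nhds
  · refine ⟨STUniform.sphereAverage s t, ?_, ?_⟩
    · intro V X hX γ hγ W D f hf v hv n hn hint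
      exact STUniform.avgCurvature_eq_sphereAverage hf.1.disc hs ht hteven h
        (hX.of_ne h γ hγ W D f hf) hv hn hint
    · refine STUniform.tendsto_sphereAverage (by exact_mod_cast hs) (by exact_mod_cast ht) ?_
      rcases hs.lt_or_eq with h' | rfl
      · left; exact_mod_cast h'
      · right
        have : 6 < t := lt_of_le_of_ne ht h
        exact_mod_cast this
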